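/- Let $T>0$, let $\xi=(\xi^1,\dots,\xi^d)$ be $d$ independent space-time white noises on $[0,T]\times S^1$, $S^1=\mathbf R/\mathbf Z$ identified with $[0,1]$, and let $\psi=(\psi(t,x))_{0\le t\le T,\,0\le x\le 1}$ be the continuous $\mathbf R^d$-valued mild solution of $\partial_t\psi=\partial_x^2\psi+\xi$, $\psi(0,\cdot)=0$, that is, $\psi^i(t,x)=\int_0^t\int_0^1\tilde p_{t-s}(x-y)\,\xi^i(ds,dy)$ a.s., where $\tilde p_t(x)=\sum_{n\in\mathbf Z}(4\pi t)^{-1/2}e^{-(x+n)^2/4t}$. For $k=1,2,\dots$ let $\psi(k)(t,\cdot)$ be the piecewise linear interpolation of $\psi(t,\cdot)$ at the points $i2^{-k}$, $0\le i\le 2^k$, and let $\Psi(k)=(\psi(k)(\cdot,0),\Psi(k)^1,\Psi(k)^2)$ be its spatial lift, where, for $0\le x\le y\le 1$, $$\Psi(k)^1_t(x,y)=\psi(k)(t,y)-\psi(k)(t,x),\qquad \Psi(k)^2_t(x,y)=\int_x^y\{\psi(k)(t,u)-\psi(k)(t,x)\}\otimes d_u\psi(k)(t,u).$$ *Besov norms.*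 Let $\mathcal S(T)=\{0\le s\le t\le T\}$ and $\mathcal S=\mathcal S(1)$. For $A$ on $\mathcal S$, $f$ on $[0,T]$ and $G$ on $[0,T]\times\mathcal S$ put $$\|A\|_{B;\alpha,m}=\Bigl(\iint_{\mathcal S}\frac{|A_{x,y}|^m}{|y-x|^{1+m\alpha}}dxdy\Bigr)^{1/m},\qquad \|f\|_{B;\beta,m}=|f_0|+\Bigl(\iint_{\mathcal S(T)}\frac{|f_t-f_s|^m}{|t-s|^{1+\beta m}}dsdt\Bigr)^{1/m},$$ $$\|G\|_{B;\beta,\alpha,m}=\Bigl(\iint_{\mathcal S(T)}dsdt\iint_{\mathcal S}\frac{|G_t(x,y)-G_s(x,y)|^m}{|t-s|^{1+\beta m}|x-y|^{1+\alpha m}}dxdy\Bigr)^{1/m}.$$ *Path space.* $\hat\Omega^B_{\alpha,m}(\mathbf R^d)$ is the set of $(v,A^1,A^2)$ with $v\in\mathbf R^d$, $A^i:\mathcal S\to(\mathbf R^d)^{\otimes i}$ continuous, $A^1_{x,y}=A^1_{x,z}+A^1_{z,y}$ and $A^2_{x,y}=A^2_{x,z}+A^2_{z,y}+A^1_{x,z}\otimes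 A^1_{z,y}$ for $x\le z\le y$, and $\|A^1\|_{B;\alpha,m}+\|A^2\|_{B;2\alpha,m/2}<\infty$, with the distance $|v-u|+\|A^1-B^1\|_{B;\alpha,m}+\|A^2-B^2\|_{B;2\alpha,m/2}$. Its subset $G\hat\Omega^B_{\alpha,m}(\mathbf R^d)$ is the closure of the natural lifts $\bigl(a_0,\ a_y-a_x,\ \int_x^y(a_u-a_x)\otimes da_u\bigr)$ of Lipschitz paths $a:[0,1]\to\mathbf R^d$. Finally $\mathcal P^B_{\beta,m}G\hat\Omega^B_{\alpha,m}(\mathbf R^d)$ is the set of continuous paths $t\mapsto(v_t,A^1_t,A^2_t)$ from $[0,T]$ to $G\hat\Omega^B_{\alpha,m}(\mathbf R^d)$ with $\|v\|_{B;\beta,m}$, $\|A^1\|_{B;\beta,\alpha,m}$ and $\|A^2\|_{B;2\beta,2\alpha,m/2}$ finite, with the distance $$\|v-u\|_{B;\beta,m}+\sum_{i=1,2}\|A^i_0-B^i_0\|_{B;i\alpha,m/i}+\sum_{i=1,2}\|A^i-B^i\|_{B;i\beta,i\alpha,m/i}.$$ **Lemma.** Assume $\alpha\in(1/3,1/2)$,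 $0<4\beta<1-2\alpha$, $m>2$, $\alpha-1/m>1/3$ and $\beta>1/m$. Then there are constants $c>0$ and $\eta\in(0,1)$, independent of $k$, such that for all $k\ge 1$ $$\mathbb E\Bigl[\|\Psi(k+1)^2-\Psi(k)^2\|_{B;2\beta,2\alpha,m/2}^{m/2}\Bigr]^{2/m}\le c\,\eta^k .$$ Moreover there is a random variable $\Psi=(v,\Psi^1,\Psi^2)$ such that $\Psi(k)^2\to\Psi^2$ in the $(2\beta,2\alpha,m/2)$-Besov norm almost surely and in $L^p$ for every $p\in(1,\infty)$ (in particular $\|\Psi(k)^2\|_{B;2\beta,2\alpha,m/2}\in L^p$), and, almost surely, all $\Psi(k)$ and $\Psi$ belong to $\mathcal P^B_{\beta,m}G\hat\Omega^B_{\alpha,m}(\mathbf R^d)$ and $\Psi(k)\to\Psi$ in that space. -/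

import Mathlib

open MeasureTheory ProbabilityTheory Set Filter Topology
open scoped ENNReal

namespace SpatialLift

noncomputable section

/-! ### The stochastic heat equation on the circle -/

/-- The heat kernel of `∂ₜ - ∂ₓ²` on the real line. -/
def heatKernelLine (t x : ℝ) : ℝ :=
  1 / Real.sqrt (4 * Real.pi * t) * Real.exp (-x ^ 2 / (4 * t))

/-- The heat kernel of the circle `ℝ / ℤ`, obtained by periodisation (used for `t > 0`). -/
def heatKernelCircle (t x : ℝ) : ℝ :=
  ∑' n : ℤ, heatKernelLine t (x + n)

/-- Lebesgue measure on `[0,T] × S¹`, the circle being identified with `[0,1]`. -/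
def spaceTimeMeasure (T : ℝ) : Measure (ℝ × ℝ) :=
  volume.restrict (Icc 0 T ×ˢ Icc 0 1)

/-- A white noise with intensity `ν`: a centred Gaussian family `W f` indexed by the
square-integrable functions `f` (the values at other functions are irrelevant), with
`E[W f * W g] = ∫ f g dν`. -/
structure IsWhiteNoise {E Ω : Type*} [MeasurableSpace E] [MeasurableSpace Ω]
    (ν : Measure E) (W : (E → ℝ) → Ω → ℝ) (P : Measure Ω) : Prop where
  measurable : ∀ f, MemLp f 2 ν → Measurable (W f)
  gaussian : IsGaussianProcess (fun f : {f : E → ℝ // MemLp f 2 ν} => W f.1) P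
  mean_zero : ∀ f, MemLp f 2 ν → ∫ ω, W f ω ∂P = 0
  covariance : ∀ f g, MemLp f 2 ν → MemLp g 2 ν →
    ∫ ω, W f ω * W g ω ∂P = ∫ z, f z * g z ∂ν

/-- The integrand `(s, y) ↦ p̃_{t-s}(x - y) 1_{s < t}` of the stochastic convolution. -/
def mildKernel (t x : ℝ) (z : ℝ × ℝ) : ℝ :=
  if z.1 < t then heatKernelCircle (t - z.1) (x - z.2) else 0

/-- `W 0, …, W (d-1)` are independent space-time white noises on `[0,T] × S¹`. -/
structure IsSpaceTimeWhiteNoise {Ω : Type*} [MeasurableSpace Ω] (T : ℝ) {d : ℕ}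
    (W : Fin d → (ℝ × ℝ → ℝ) → Ω → ℝ) (P : Measure Ω) : Prop where
  whiteNoise : ∀ i, IsWhiteNoise (spaceTimeMeasure T) (W i) P
  independent : iIndepFun
    (fun i ω => fun f : {f : ℝ × ℝ → ℝ // MemLp f 2 (spaceTimeMeasure T)} => W i f.1 ω) P

/-- `ψ` is the (continuous version of the) mild solution of `∂ₜψ = ∂ₓ²ψ + ξ`, `ψ(0, ·) = 0`, on
`[0,T] × S¹`, where `W` is the white noise `ξ`:
`ψⁱ(t,x) = ∫₀ᵗ ∫₀¹ p̃_{t-s}(x-y) ξⁱ(ds,dy)` almost surely, for all `(t,x)`. -/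
structure IsStochasticHeatSolution {Ω : Type*} [MeasurableSpace Ω] (T : ℝ) {d : ℕ}
    (W : Fin d → (ℝ × ℝ → ℝ) → Ω → ℝ) (ψ : ℝ → ℝ → Ω → EuclideanSpace ℝ (Fin d))
    (P : Measure Ω) : Prop where
  measurable : ∀ t ∈ Icc (0 : ℝ) T, ∀ x ∈ Icc (0 : ℝ) 1, Measurable (ψ t x)
  continuous : ∀ᵐ ω ∂P,
    ContinuousOn (fun q : ℝ × ℝ => ψ q.1 q.2 ω) (Icc 0 T ×ˢ Icc 0 1)
  mild : ∀ t ∈ Icc (0 : ℝ) T, ∀ x ∈ Icc (0 : ℝ) 1, ∀ i,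
    (fun ω => ψ t x ω i) =ᵐ[P] W i (mildKernel t x)

/-! ### Besov norms

All norms take values in `[0,∞]`; the integrands are only relevant off the (null) diagonal. -/

/-- The simplex `{(s,t) | 0 ≤ s ≤ t ≤ T}`. -/
def simplex (T : ℝ) : Set (ℝ × ℝ) := {p | 0 ≤ p.1 ∧ p.1 ≤ p.2 ∧ p.2 ≤ T}

/-- The `(α,m)`-Besov norm of a two-parameter function on the simplex over `[0,1]`. -/
def besovNorm {V : Type*} [NormedAddCommGroup V] (α m : ℝ) (A : ℝ → ℝ → V) : ℝ≥0∞ :=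
  (∫⁻ p in simplex 1,
    ENNReal.ofReal (‖A p.1 p.2‖ ^ m / (p.2 - p.1) ^ (1 + m * α))) ^ (1 / m)

/-- The `(β,m)`-Besov norm of a path on `[0,T]`. -/
def pathBesovNorm {V : Type*} [NormedAddCommGroup V] (T β m : ℝ) (f : ℝ → V) : ℝ≥0∞ :=
  ‖f 0‖ₑ + (∫⁻ p in simplex T,
    ENNReal.ofReal (‖f p.2 - f p.1‖ ^ m / (p.2 - p.1) ^ (1 + β * m))) ^ (1 / m)

/-- The `(β,α,m)`-Besov norm of `G(t;x,y)`, `t ∈ [0,T]`, `0 ≤ x ≤ y ≤ 1`. -/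
def sheetBesovNorm {V : Type*} [NormedAddCommGroup V] (T β α m : ℝ) (G : ℝ → ℝ → ℝ → V) : ℝ≥0∞ :=
  (∫⁻ q in simplex T, ∫⁻ p in simplex 1,
    ENNReal.ofReal (‖G q.2 p.1 p.2 - G q.1 p.1 p.2‖ ^ m /
      ((q.2 - q.1) ^ (1 + β * m) * (p.2 - p.1) ^ (1 + α * m)))) ^ (1 / m)

/-! ### Rough paths -/

/-- The tensor product `ℝᵈ ⊗ ℝᵈ` is realised as `ℝ^{d × d}` with the Hilbert-Schmidt norm. -/
def tensor {d : ℕ} (a b : EuclideanSpace ℝ (Fin d)) : EuclideanSpace ℝ (Fin d × Fin d) :=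
  WithLp.toLp 2 fun p => a p.1 * b p.2

/-- A triple `(v, A¹, A²)`: an initial value and two levels. Only the values of the levels on
the simplex over `[0,1]` are relevant. -/
structure RoughTriple (d : ℕ) where
  init : EuclideanSpace ℝ (Fin d)
  fst : ℝ → ℝ → EuclideanSpace ℝ (Fin d)
  snd : ℝ → ℝ → EuclideanSpace ℝ (Fin d × Fin d)

/-- `X` is an `(α,m)`-Besov rough path (with initial value): the levels are continuous on the
simplex, satisfy Chen's identity, and have finite Besov norms. -/
structure IsBesovRoughPath {d : ℕ} (α m : ℝ) (X : RoughTriple d) : Prop where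
  continuous_fst : ContinuousOn (fun p : ℝ × ℝ => X.fst p.1 p.2) (simplex 1)
  continuous_snd : ContinuousOn (fun p : ℝ × ℝ => X.snd p.1 p.2) (simplex 1)
  chen_fst : ∀ x z y, 0 ≤ x → x ≤ z → z ≤ y → y ≤ 1 → X.fst x y = X.fst x z + X.fst z y
  chen_snd : ∀ x z y, 0 ≤ x → x ≤ z → z ≤ y → y ≤ 1 →
    X.snd x y = X.snd x z + X.snd z y + tensor (X.fst x z) (X.fst z y)
  fst_finite : besovNorm α m X.fst < ⊤
  snd_finite : besovNorm (2 * α) (m / 2) X.snd < ⊤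

/-- The distance on the space of `(α,m)`-Besov rough paths with initial value. -/
def besovDist {d : ℕ} (α m : ℝ) (X Y : RoughTriple d) : ℝ≥0∞ :=
  ‖X.init - Y.init‖ₑ + besovNorm α m (fun x y => X.fst x y - Y.fst x y) +
    besovNorm (2 * α) (m / 2) (fun x y => X.snd x y - Y.snd x y)

/-- The natural lift of a path `a`, Lipschitz on `[0,1]`:
`(a₀, a_y - a_x, ∫_x^y (a_u - a_x) ⊗ da_u)`. -/
def lift {d : ℕ} (a : ℝ → EuclideanSpace ℝ (Fin d)) : RoughTriple d where
  init := a 0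
  fst := fun x y => a y - a x
  snd := fun x y => WithLp.toLp 2 fun p =>
    ∫ u in x..y, (a u p.1 - a x p.1) * deriv (fun v => a v p.2) u

/-- `X` is a geometric `(α,m)`-Besov rough path (with initial value): it is in the closure of
the natural lifts of Lipschitz paths. -/
structure IsGeometricBesov {d : ℕ} (α m : ℝ) (X : RoughTriple d) : Prop where
  isRough : IsBesovRoughPath α m X
  mem_closure : ∀ ε : ℝ≥0∞, 0 < ε → ∃ a : ℝ → EuclideanSpace ℝ (Fin d),
    (∃ K, LipschitzOnWith K a (Icc 0 1)) ∧ besovDist α m X (lift a) < ε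

/-- `X` is a continuous path `[0,T] → (geometric (α,m)-Besov rough paths)` whose init and first
level are `(β,m)`-Besov and whose second level is `(2β,m/2)`-Besov in `t`. -/
structure IsBesovPath {d : ℕ} (T β α m : ℝ) (X : ℝ → RoughTriple d) : Prop where
  geometric : ∀ t ∈ Icc (0 : ℝ) T, IsGeometricBesov α m (X t)
  continuous : ∀ t ∈ Icc (0 : ℝ) T,
    Tendsto (fun s => besovDist α m (X s) (X t)) (𝓝[Icc 0 T] t) (𝓝 0)
  init_finite : pathBesovNorm T β m (fun t => (X t).init) < ⊤
  fst_finite : sheetBesovNorm T β α m (fun t => (X t).fst) < ⊤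
  snd_finite : sheetBesovNorm T (2 * β) (2 * α) (m / 2) (fun t => (X t).snd) < ⊤

/-- The distance on the space of Besov paths of geometric Besov rough paths. -/
def besovPathDist {d : ℕ} (T β α m : ℝ) (X Y : ℝ → RoughTriple d) : ℝ≥0∞ :=
  pathBesovNorm T β m (fun t => (X t).init - (Y t).init) +
  (besovNorm α m (fun x y => (X 0).fst x y - (Y 0).fst x y) +
    besovNorm (2 * α) (m / 2) (fun x y => (X 0).snd x y - (Y 0).snd x y)) +
  (sheetBesovNorm T β α m (fun t x y => (X t).fst x y - (Y t).fst x y) +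
    sheetBesovNorm T (2 * β) (2 * α) (m / 2) (fun t x y => (X t).snd x y - (Y t).snd x y))

/-! ### Dyadic polygonal approximation -/

/-- The function that agrees with `a` at the points `i / 2ᵏ` and is linear in between. -/
def polygonal {d : ℕ} (k : ℕ) (a : ℝ → EuclideanSpace ℝ (Fin d)) (x : ℝ) :
    EuclideanSpace ℝ (Fin d) :=
  a (⌊x * 2 ^ k⌋ / 2 ^ k) +
    Int.fract (x * 2 ^ k) • (a ((⌊x * 2 ^ k⌋ + 1) / 2 ^ k) - a (⌊x * 2 ^ k⌋ / 2 ^ k))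

/-- `Ψ(k)`: for every `t`, the natural lift in `x` of the `k`-th dyadic polygonal approximation
of `x ↦ ψ(t,x)`. -/
def dyadicLift {Ω : Type*} {d : ℕ} (ψ : ℝ → ℝ → Ω → EuclideanSpace ℝ (Fin d))
    (k : ℕ) (ω : Ω) (t : ℝ) : RoughTriple d :=
  lift (polygonal k fun x => ψ t x ω)

end

end SpatialLift

/-! At a fixed time the field looks in space like a Brownian loop. By Chapman–Kolmogorov each
component has covariance E ψ(t,x)ψ(s,y) = G_{t+s}(x-y) - G_{t-s}(x-y) for s ≤ t, where G_τ is half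
the integral over [0,τ] of the heat kernel of the circle. This gives E|ψ(t,x)-ψ(t,y)|² ≤ 2|x-y| and
E|ψ(t,x)-ψ(s,x)|² ≤ C|t-s|^{1/2}. Dyadic interpolation is linear, so estimates for vector-valued
interpolation, applied to x ↦ ψ(t,x) as a path in L²(P), carry these bounds over to ψ(k) uniformly
in k, and ψ(k+1)-ψ(k) is of order 2^{-k/2} in L². Gaussianity turns L² bounds into L^r bounds.

The iterated integrals need more than variances. The decisive fact is that G_τ is convex on [0,1]
(`convexOn_circleGreen`), so increments over distinct dyadic intervals are non-positively
correlated. Since the increments around the circle sum to zero, each row of their covariance matrix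
has absolute sum at most twice the diagonal entry, and the Schur test bounds the quadratic form by
4·2^{-n} (`integral_sum_incr_sq_le`). Hence ∫ φ dψ(n) has variance at most 4∫φ² for deterministic φ,
uniformly in n, as for a Wiener integral. For two independent components the integrand is frozen and
the same bound applies conditionally (`eLpNorm'_cross_le`); for a component with itself the iterated
integral is half a square. With integration by parts, the second levels of two interpolations at
distance δ in L² differ by O(√(y-x) δ) in every L^r (`eLpNorm'_snd_sub_le`).

The double difference in level and time is therefore bounded in three ways, with δ of order
2^{-k/2}, |t-s|^{1/4} or |y-x|^{1/2}. A weighted geometric mean with exponents ε, θ, 1-ε-θ gives η^k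
|t-s|^{θ/4} |y-x|^{1-(ε+θ)/2}. Finiteness of the Besov integrals asks for 2β < θ/4 and 2α <
1-(ε+θ)/2, and the hypothesis 4β < 1-2α is what leaves room for some ε > 0. Hölder and Fubini then
give geometric decay of the moments of the Besov norms (`exists_level_moments`), so the increments
are almost surely summable.

For convergence in the path space, a chaining estimate of Garsia–Rodemich–Rumsey type for
pseudo-metrics (`exists_besovMetric_le`) is used twice. In time, with the Besov distance of two
slices as the metric, it gives convergence of the slices uniformly in t, hence continuity of the
limit in t. In space, applied to the additive function A²(x,y) + A¹(0,x) ⊗ A¹(x,y), it gives uniform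
convergence of the second levels, hence a continuous limit obeying Chen's identity. Fatou's lemma
identifies the Besov limit with the pointwise one. Polygons are Lipschitz, so the limit is
geometric. -/

namespace SpatialLift

noncomputable section

/-! ### Dyadic interpolation -/

section Interpolation

variable {V : Type*} [NormedAddCommGroup V] [NormedSpace ℝ V]

/-- Dyadic linear interpolation of a vector-valued function. -/
def poly (k : ℕ) (f : ℝ → V) (x : ℝ) : V :=
  f (⌊x * 2 ^ k⌋ / 2 ^ k) +
    Int.fract (x * 2 ^ k) • (f ((⌊x * 2 ^ k⌋ + 1) / 2 ^ k) - f (⌊x * 2 ^ k⌋ / 2 ^ k))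

/-- The right derivative of the dyadic interpolation. -/
def polySlope (k : ℕ) (f : ℝ → V) (x : ℝ) : V :=
  (2 : ℝ) ^ k • (f ((⌊x * 2 ^ k⌋ + 1) / 2 ^ k) - f (⌊x * 2 ^ k⌋ / 2 ^ k))

/-- The increment of `f` over the `c`-th dyadic interval of level `k`. -/
def dyadicIncr (k : ℕ) (f : ℝ → V) (c : ℕ) : V :=
  f ((c + 1) / 2 ^ k) - f (c / 2 ^ k)

/-- The piecewise linear function that is `0` on the left of `[0,1]` and `1` on the right of it. -/
def ramp (v : ℝ) : ℝ := max 0 (min 1 v)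

theorem ramp_of_nonpos {v : ℝ} (h : v ≤ 0) : ramp v = 0 := by
  simp [ramp, h]

theorem ramp_of_one_le {v : ℝ} (h : 1 ≤ v) : ramp v = 1 := by
  simp [ramp, h]

theorem ramp_of_mem {v : ℝ} (h0 : 0 ≤ v) (h1 : v ≤ 1) : ramp v = v := by
  simp [ramp, h0, h1]

theorem ramp_mono : Monotone ramp := fun a b h => by
  unfold ramp; gcongr

theorem continuous_ramp : Continuous ramp := by unfold ramp; fun_prop

/-- Telescoping: a cell to the left of `v` contributes its whole increment, a cell to the right
nothing, and the cell containing `v` the fraction already covered. -/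
theorem sum_ramp_smul (g : ℕ → V) (N : ℕ) {v : ℝ} (h0 : 0 ≤ v) (hN : v ≤ N) :
    ∑ c ∈ Finset.range N, ramp (v - c) • (g (c + 1) - g c) =
      g ⌊v⌋₊ + Int.fract v • (g (⌊v⌋₊ + 1) - g ⌊v⌋₊) - g 0 := by
  induction N with
  | zero =>
    have : v = 0 := le_antisymm (by simpa using hN) h0
    simp [this]
  | succ N ih =>
    rw [Finset.sum_range_succ]
    rcases le_or_gt v N with h | h
    · rw [ih h, ramp_of_nonpos (by linarith)]; simp
    · have h1 : ∑ c ∈ Finset.range N, ramp (v - c) • (g (c + 1) - g c) = g N - g 0 := by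
        rw [← Finset.sum_range_sub]
        refine Finset.sum_congr rfl fun c hc => ?_
        have : (c : ℝ) + 1 ≤ N := by exact_mod_cast Finset.mem_range.1 hc
        rw [ramp_of_one_le (by linarith), one_smul]
      push_cast at hN
      rw [h1, ramp_of_mem (by linarith) (by linarith)]
      rcases hN.lt_or_eq with h2 | h2
      · have h3 : ⌊v⌋₊ = N := (Nat.floor_eq_iff h0).2 ⟨h.le, h2⟩
        have h4 : Int.fract v = v - N := by
          rw [Int.fract, ← natCast_floor_eq_intCast_floor h0, h3]
        rw [h3, h4]; abel
      · have h3 : ⌊v⌋₊ = N + 1 := by rw [h2]; exact_mod_cast Nat.floor_natCast (N + 1)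
        have h4 : Int.fract v = 0 := by rw [h2]; exact_mod_cast Int.fract_natCast (N + 1)
        rw [h3, h4, h2]; simp

/-- Unlike the floor formula, this form displays continuity in `x`, the Lipschitz bound, and the
fact that on [0,1] only the values of `f` at dyadic points of [0,1] matter. -/
theorem poly_eq_sum (k : ℕ) (f : ℝ → V) {x : ℝ} (hx : x ∈ Icc (0 : ℝ) 1) :
    poly k f x = f 0 + ∑ c ∈ Finset.range (2 ^ k), ramp (x * 2 ^ k - c) • dyadicIncr k f c := by
  have h0 : 0 ≤ x * 2 ^ k := by have := hx.1; positivity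
  have h := sum_ramp_smul (fun c : ℕ => f (c / 2 ^ k)) (2 ^ k) h0
    (by push_cast; nlinarith [hx.2, pow_pos (two_pos (α := ℝ)) k])
  simp only [dyadicIncr]
  push_cast at h
  rw [h, natCast_floor_eq_intCast_floor h0]
  simp [poly]

theorem poly_zero (k : ℕ) (f : ℝ → V) : poly k f 0 = f 0 := by simp [poly]

theorem sum_ramp (k : ℕ) {x : ℝ} (hx : x ∈ Icc (0 : ℝ) 1) :
    ∑ c ∈ Finset.range (2 ^ k), ramp (x * 2 ^ k - c) = x * 2 ^ k := by
  have h0 : 0 ≤ x * 2 ^ k := by have := hx.1; positivity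
  have h := sum_ramp_smul (fun c : ℕ => (c : ℝ)) (2 ^ k) h0
    (by push_cast; nlinarith [hx.2, pow_pos (two_pos (α := ℝ)) k])
  simp only [Nat.cast_add, Nat.cast_one, add_sub_cancel_left, smul_eq_mul, mul_one] at h
  rw [h, natCast_floor_eq_intCast_floor h0]
  simp

/-- The ramps are increasing and their sum grows by 2^k (y - x), so the difference is a sum of
increments with non-negative weights of that total mass. -/
theorem norm_poly_sub_le (k : ℕ) (f : ℝ → V) {B : ℝ}
    (hB : ∀ c < 2 ^ k, ‖dyadicIncr k f c‖ ≤ B) {x y : ℝ} (hx : x ∈ Icc (0 : ℝ) 1)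
    (hy : y ∈ Icc (0 : ℝ) 1) : ‖poly k f y - poly k f x‖ ≤ B * 2 ^ k * |y - x| := by
  wlog hxy : x ≤ y generalizing x y
  · rw [norm_sub_rev, abs_sub_comm]; exact this hy hx (le_of_not_ge hxy)
  rw [poly_eq_sum k f hx, poly_eq_sum k f hy, add_sub_add_left_eq_sub, ← Finset.sum_sub_distrib,
    abs_of_nonneg (sub_nonneg.2 hxy)]
  calc _ ≤ ∑ c ∈ Finset.range (2 ^ k), (ramp (y * 2 ^ k - c) - ramp (x * 2 ^ k - c)) * B := by
        refine norm_sum_le_of_le _ fun c hc => ?_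
        have h1 : 0 ≤ ramp (y * 2 ^ k - c) - ramp (x * 2 ^ k - c) :=
          sub_nonneg.2 (ramp_mono (by gcongr))
        rw [← sub_smul, norm_smul, Real.norm_of_nonneg h1]
        exact mul_le_mul_of_nonneg_left (hB c (Finset.mem_range.1 hc)) h1
    _ = B * 2 ^ k * (y - x) := by
        rw [← Finset.sum_mul, Finset.sum_sub_distrib, sum_ramp k hx, sum_ramp k hy]; ring

theorem continuousOn_poly (k : ℕ) (f : ℝ → V) : ContinuousOn (poly k f) (Icc 0 1) := by
  refine ContinuousOn.congr (f := fun x => f 0 +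
    ∑ c ∈ Finset.range (2 ^ k), ramp (x * 2 ^ k - c) • dyadicIncr k f c) ?_
    fun x hx => poly_eq_sum k f hx
  have := continuous_ramp
  exact Continuous.continuousOn (by fun_prop)

theorem poly_sub (k : ℕ) (f g : ℝ → V) (x : ℝ) :
    poly k (fun z => f z - g z) x = poly k f x - poly k g x := by
  simp only [poly, smul_sub]; abel

theorem polySlope_sub (k : ℕ) (f g : ℝ → V) (x : ℝ) :
    polySlope k (fun z => f z - g z) x = polySlope k f x - polySlope k g x := by
  simp only [polySlope, smul_sub]; abel

theorem eventually_floor_eq {v : ℝ} : ∀ᶠ w in 𝓝[>] v, ⌊w⌋ = ⌊v⌋ := by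
  have : Ioo v (⌊v⌋ + 1) ∈ 𝓝[>] v := Ioo_mem_nhdsGT (Int.lt_floor_add_one v)
  filter_upwards [this] with w hw
  exact Int.floor_eq_iff.2 ⟨(Int.floor_le v).trans hw.1.le, hw.2⟩

theorem poly_of_floor_eq (k : ℕ) (f : ℝ → V) {x w : ℝ} (h : ⌊w * 2 ^ k⌋ = ⌊x * 2 ^ k⌋) :
    poly k f w = poly k f x + (w - x) • polySlope k f x := by
  have h1 : Int.fract (w * 2 ^ k) = Int.fract (x * 2 ^ k) + (w - x) * 2 ^ k := by
    rw [Int.fract, Int.fract, h]; ring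
  rw [poly, poly, polySlope, h, h1, add_smul, smul_smul]; abel

/-- A right derivative at every point, kinks included, is enough for the fundamental theorem of
calculus and for integration by parts without exceptional points. -/
theorem hasDerivWithinAt_poly (k : ℕ) (f : ℝ → V) (x : ℝ) :
    HasDerivWithinAt (poly k f) (polySlope k f x) (Ioi x) x := by
  have h1 : HasDerivWithinAt (fun w => poly k f x + (w - x) • polySlope k f x)
      (polySlope k f x) (Ioi x) x := by
    have := (((hasDerivAt_id x).sub_const x).smul_const (polySlope k f x)).const_add (poly k f x)
    simpa using this.hasDerivWithinAt
  refine h1.congr_of_eventuallyEq ?_ (by simp)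
  have h2 : Tendsto (fun w : ℝ => w * 2 ^ k) (𝓝[>] x) (𝓝[>] (x * 2 ^ k)) := by
    refine tendsto_nhdsWithin_iff.2 ⟨?_, ?_⟩
    · exact (Continuous.tendsto (by fun_prop) x).mono_left nhdsWithin_le_nhds
    · filter_upwards [self_mem_nhdsWithin] with w hw
      exact mul_lt_mul_of_pos_right (mem_Ioi.1 hw) (by positivity)
  filter_upwards [h2.eventually eventually_floor_eq] with w hw
  exact poly_of_floor_eq k f hw

theorem hasDerivAt_poly (k : ℕ) (f : ℝ → V) {x : ℝ} (hx : x * 2 ^ k ≠ (⌊x * 2 ^ k⌋ : ℝ)) :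
    HasDerivAt (poly k f) (polySlope k f x) x := by
  have h1 : HasDerivAt (fun w => poly k f x + (w - x) • polySlope k f x)
      (polySlope k f x) x := by
    simpa using
      (((hasDerivAt_id x).sub_const x).smul_const (polySlope k f x)).const_add (poly k f x)
  refine h1.congr_of_eventuallyEq ?_
  have h2 : Tendsto (fun w : ℝ => w * 2 ^ k) (𝓝 x) (𝓝 (x * 2 ^ k)) :=
    Continuous.tendsto (by fun_prop) x
  have h3 : Ioo (⌊x * 2 ^ k⌋ : ℝ) (⌊x * 2 ^ k⌋ + 1) ∈ 𝓝 (x * 2 ^ k) :=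
    Ioo_mem_nhds (lt_of_le_of_ne (Int.floor_le _) (Ne.symm hx)) (Int.lt_floor_add_one _)
  filter_upwards [h2.eventually h3] with w hw
  exact poly_of_floor_eq k f (Int.floor_eq_iff.2 ⟨hw.1.le, hw.2⟩)

theorem ae_ne_floor (k : ℕ) : ∀ᵐ x : ℝ, x * 2 ^ k ≠ (⌊x * 2 ^ k⌋ : ℝ) := by
  have h : {x : ℝ | ¬ (x * 2 ^ k ≠ (⌊x * 2 ^ k⌋ : ℝ))} ⊆ range fun n : ℤ => (n : ℝ) / 2 ^ k := by
    intro x hx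
    simp only [ne_eq, not_not, mem_ofPred_eq] at hx
    exact ⟨⌊x * 2 ^ k⌋, by simp only [← hx]; field_simp⟩
  exact measure_mono_null h ((countable_range _).measure_zero _)

theorem floor_eq_natCast {k : ℕ} {x : ℝ} (hx : x ∈ Ico (0 : ℝ) 1) :
    ∃ c : ℕ, c < 2 ^ k ∧ ⌊x * 2 ^ k⌋ = (c : ℤ) := by
  have h0 : 0 ≤ x * 2 ^ k := by have := hx.1; positivity
  refine ⟨⌊x * 2 ^ k⌋₊, ?_, (Int.natCast_floor_eq_floor h0).symm⟩
  rw [Nat.floor_lt h0]; push_cast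
  nlinarith [hx.2, pow_pos (two_pos (α := ℝ)) k]

theorem norm_polySlope_le (k : ℕ) (f : ℝ → V) {B : ℝ}
    (hB : ∀ c < 2 ^ k, ‖dyadicIncr k f c‖ ≤ B) {x : ℝ} (hx : x ∈ Ico (0 : ℝ) 1) :
    ‖polySlope k f x‖ ≤ B * 2 ^ k := by
  obtain ⟨c, hc, h⟩ := floor_eq_natCast (k := k) hx
  have := hB c hc
  rw [polySlope, norm_smul, h, mul_comm]
  simp only [dyadicIncr] at this
  push_cast
  rw [Real.norm_of_nonneg (by positivity)]
  gcongr

theorem measurable_polySlope [MeasurableSpace V] (k : ℕ) (f : ℝ → V) :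
    Measurable (polySlope k f) := by
  let F : ℤ → V := fun n => (2 : ℝ) ^ k • (f ((n + 1) / 2 ^ k) - f (n / 2 ^ k))
  have hF : Measurable F := Measurable.of_discrete
  exact hF.comp (Int.measurable_floor.comp (measurable_id.mul_const _))

theorem poly_congr {k : ℕ} {f g : ℝ → V} (h : ∀ c : ℕ, c ≤ 2 ^ k → f (c / 2 ^ k) = g (c / 2 ^ k))
    {x : ℝ} (hx : x ∈ Icc (0 : ℝ) 1) : poly k f x = poly k g x := by
  rw [poly_eq_sum k f hx, poly_eq_sum k g hx]
  have h0 := h 0 (by simp)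
  simp only [Nat.cast_zero, zero_div] at h0
  rw [h0]
  refine congrArg _ (Finset.sum_congr rfl fun c hc => ?_)
  have hc' := Finset.mem_range.1 hc
  have h1 := h (c + 1) hc'
  push_cast at h1
  rw [dyadicIncr, dyadicIncr, h1, h c hc'.le]

theorem polySlope_congr {k : ℕ} {f g : ℝ → V}
    (h : ∀ c : ℕ, c ≤ 2 ^ k → f (c / 2 ^ k) = g (c / 2 ^ k))
    {x : ℝ} (hx : x ∈ Ico (0 : ℝ) 1) : polySlope k f x = polySlope k g x := by
  obtain ⟨c, hc, hf⟩ := floor_eq_natCast (k := k) hx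
  have h1 := h (c + 1) hc
  push_cast at h1
  rw [polySlope, polySlope, hf]
  push_cast
  rw [h1, h c hc.le]

theorem dyadic_mem {k c : ℕ} (hc : c ≤ 2 ^ k) : (c : ℝ) / 2 ^ k ∈ Icc (0 : ℝ) 1 := by
  refine ⟨by positivity, (div_le_one (by positivity)).2 (by exact_mod_cast hc)⟩

omit [NormedSpace ℝ V] in
theorem dyadicIncr_le_of_holder {C : ℝ} {f : ℝ → V}
    (hf : ∀ x ∈ Icc (0 : ℝ) 1, ∀ y ∈ Icc (0 : ℝ) 1, ‖f x - f y‖ ≤ C * √|x - y|) {k c : ℕ}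
    (hc : c < 2 ^ k) : ‖dyadicIncr k f c‖ ≤ C * √((2 : ℝ) ^ k)⁻¹ := by
  have h := hf _ (dyadic_mem (k := k) (c := c + 1) hc) _ (dyadic_mem hc.le)
  push_cast at h
  rwa [← sub_div, add_sub_cancel_left, one_div, abs_of_pos (by positivity)] at h

/-- The two nodes and the weight do not depend on the function, so sup bounds for interpolations
become bounds for convex combinations of two values near `x`. -/
theorem exists_dyadic_convex (k : ℕ) {x : ℝ} (hx : x ∈ Icc (0 : ℝ) 1) :
    ∃ a ∈ Icc (0 : ℝ) 1, ∃ b ∈ Icc (0 : ℝ) 1, ∃ θ ∈ Icc (0 : ℝ) 1,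
      |a - x| ≤ ((2 : ℝ) ^ k)⁻¹ ∧ |b - x| ≤ ((2 : ℝ) ^ k)⁻¹ ∧
      ∀ g : ℝ → V, poly k g x = (1 - θ) • g a + θ • g b := by
  have hp : (0 : ℝ) < 2 ^ k := by positivity
  rcases hx.2.lt_or_eq with h | h
  · obtain ⟨c, hc, hf⟩ := floor_eq_natCast (k := k) ⟨hx.1, h⟩
    have h1 := Int.floor_le (x * 2 ^ k)
    have h2 := Int.lt_floor_add_one (x * 2 ^ k)
    rw [hf] at h1 h2
    push_cast at h1 h2
    have h3 := dyadic_mem (k := k) (c := c + 1) hc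
    push_cast at h3
    refine ⟨c / 2 ^ k, dyadic_mem hc.le, (c + 1) / 2 ^ k, h3,
      Int.fract (x * 2 ^ k), ⟨Int.fract_nonneg _, (Int.fract_lt_one _).le⟩, ?_, ?_, fun g => ?_⟩
    · rw [abs_le, ← div_le_iff₀ hp] at *
      constructor
      · rw [neg_le_sub_iff_le_add, ← one_div, ← add_div, le_div_iff₀ hp]; linarith
      · rw [sub_le_iff_le_add]; have := inv_pos.2 hp; linarith
    · rw [abs_le]
      constructor
      · have : x ≤ (c + 1) / 2 ^ k := by rw [le_div_iff₀ hp]; linarith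
        have := inv_pos.2 hp; linarith
      · rw [sub_le_iff_le_add, add_div, one_div]
        have : (c : ℝ) / 2 ^ k ≤ x := by rw [div_le_iff₀ hp]; linarith
        linarith
    · rw [poly, hf, smul_sub, sub_smul, one_smul]; push_cast; abel
  -- At x = 1 the floor selects the cell to the right of [0,1]. Its weight is zero, but its right
  -- node is not an admissible point.
  · refine ⟨1, by simp, 1, by simp, 0, by simp, by simp [h], by simp [h], fun g => ?_⟩
    have h1 : ⌊(2 : ℝ) ^ k⌋ = 2 ^ k := by exact_mod_cast Int.floor_natCast (R := ℝ) (2 ^ k)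
    have h2 : Int.fract ((2 : ℝ) ^ k) = 0 := by
      exact_mod_cast Int.fract_natCast (R := ℝ) (2 ^ k)
    rw [poly, h, one_mul, h1, h2]
    simp

theorem norm_convex_le {θ r : ℝ} (hθ : θ ∈ Icc (0 : ℝ) 1) {a b : V} (ha : ‖a‖ ≤ r) (hb : ‖b‖ ≤ r) :
    ‖(1 - θ) • a + θ • b‖ ≤ r := by
  have h := norm_add_le ((1 - θ) • a) (θ • b)
  rw [norm_smul, norm_smul, Real.norm_of_nonneg hθ.1,
    Real.norm_of_nonneg (sub_nonneg.2 hθ.2)] at h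
  nlinarith [hθ.1, hθ.2]

theorem norm_poly_le {k : ℕ} {f : ℝ → V} {r : ℝ} (hf : ∀ x ∈ Icc (0 : ℝ) 1, ‖f x‖ ≤ r) {x : ℝ}
    (hx : x ∈ Icc (0 : ℝ) 1) : ‖poly k f x‖ ≤ r := by
  obtain ⟨a, ha, b, hb, θ, hθ, -, -, h⟩ := exists_dyadic_convex (V := V) k hx
  rw [h]
  exact norm_convex_le hθ (hf a ha) (hf b hb)

theorem norm_poly_sub_self_le {k : ℕ} {f : ℝ → V} {x r : ℝ} (hx : x ∈ Icc (0 : ℝ) 1)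
    (hf : ∀ z ∈ Icc (0 : ℝ) 1, |z - x| ≤ ((2 : ℝ) ^ k)⁻¹ → ‖f z - f x‖ ≤ r) :
    ‖poly k f x - f x‖ ≤ r := by
  obtain ⟨a, ha, b, hb, θ, hθ, h1, h2, h⟩ := exists_dyadic_convex (V := V) k hx
  have : poly k f x - f x = (1 - θ) • (f a - f x) + θ • (f b - f x) := by
    rw [h]; module
  rw [this]
  exact norm_convex_le hθ (hf a ha h1) (hf b hb h2)

/-- Two regimes. If |x-y| is at least the mesh, both interpolated values are compared with `f`,
which costs three Hölder increments. Below the mesh the slope is at most C·2^{k/2}, and 2^{k/2}|x-y|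
≤ √|x-y|. The point is that the constant does not depend on `k`; the lemma is applied with values in
L²(P). -/
theorem norm_poly_sub_poly_le_of_holder {C : ℝ} (hC : 0 ≤ C) {f : ℝ → V}
    (hf : ∀ x ∈ Icc (0 : ℝ) 1, ∀ y ∈ Icc (0 : ℝ) 1, ‖f x - f y‖ ≤ C * √|x - y|) (k : ℕ) {x y : ℝ}
    (hx : x ∈ Icc (0 : ℝ) 1) (hy : y ∈ Icc (0 : ℝ) 1) :
    ‖poly k f x - poly k f y‖ ≤ 3 * C * √|x - y| := by
  have hp : (0 : ℝ) < 2 ^ k := by positivity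
  rcases le_total ((2 : ℝ) ^ k)⁻¹ |x - y| with h | h
  · have key : ∀ z ∈ Icc (0 : ℝ) 1, ‖poly k f z - f z‖ ≤ C * √|x - y| := fun z hz =>
      norm_poly_sub_self_le hz fun w hw hwz =>
        (hf w hw z hz).trans (mul_le_mul_of_nonneg_left (Real.sqrt_le_sqrt (hwz.trans h)) hC)
    have h1 := key x hx
    have h2 := key y hy
    have h3 := hf x hx y hy
    have : poly k f x - poly k f y = (poly k f x - f x) - (poly k f y - f y) + (f x - f y) := by
      abel
    rw [this]
    have := norm_add_le ((poly k f x - f x) - (poly k f y - f y)) (f x - f y)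
    have := norm_sub_le (poly k f x - f x) (poly k f y - f y)
    linarith
  · have h1 := norm_poly_sub_le k f (fun c hc => dyadicIncr_le_of_holder hf hc) hy hx
    have h2 : √((2 : ℝ) ^ k)⁻¹ * 2 ^ k * |x - y| ≤ √|x - y| := by
      have h3 : |x - y| = √|x - y| * √|x - y| := (Real.mul_self_sqrt (abs_nonneg _)).symm
      have h4 : √|x - y| ≤ √((2 : ℝ) ^ k)⁻¹ := Real.sqrt_le_sqrt h
      have h5 : √((2 : ℝ) ^ k)⁻¹ * √((2 : ℝ) ^ k)⁻¹ = ((2 : ℝ) ^ k)⁻¹ :=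
        Real.mul_self_sqrt (by positivity)
      calc √((2 : ℝ) ^ k)⁻¹ * 2 ^ k * |x - y|
          = √((2 : ℝ) ^ k)⁻¹ * 2 ^ k * √|x - y| * √|x - y| := by rw [mul_assoc _ √|x - y|, ← h3]
        _ ≤ √((2 : ℝ) ^ k)⁻¹ * 2 ^ k * √((2 : ℝ) ^ k)⁻¹ * √|x - y| := by gcongr
        _ = (√((2 : ℝ) ^ k)⁻¹ * √((2 : ℝ) ^ k)⁻¹) * 2 ^ k * √|x - y| := by ring
        _ = √|x - y| := by rw [h5, inv_mul_cancel₀ hp.ne', one_mul]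
    have h6 : 0 ≤ C * √|x - y| := by positivity
    calc _ ≤ C * (√((2 : ℝ) ^ k)⁻¹ * 2 ^ k * |x - y|) := by linarith
      _ ≤ C * √|x - y| := by gcongr
      _ ≤ _ := by linarith

omit [NormedSpace ℝ V] in
theorem exists_bound_dyadicIncr (k : ℕ) (f : ℝ → V) :
    ∃ B, 0 ≤ B ∧ ∀ c < 2 ^ k, ‖dyadicIncr k f c‖ ≤ B :=
  ⟨∑ c ∈ Finset.range (2 ^ k), ‖dyadicIncr k f c‖, Finset.sum_nonneg fun _ _ => norm_nonneg _,
    fun _ hc => Finset.single_le_sum (f := fun c => ‖dyadicIncr k f c‖)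
      (fun _ _ => norm_nonneg _) (Finset.mem_range.2 hc)⟩

theorem ae_mem_Ico {x y : ℝ} (hx : 0 ≤ x) (hxy : x ≤ y) (hy : y ≤ 1) :
    ∀ᵐ u, u ∈ uIoc x y → u ∈ Ico (0 : ℝ) 1 := by
  have : ∀ᵐ u : ℝ, u ≠ 1 := by simp [ae_iff, measure_singleton]
  filter_upwards [this] with u hu h
  rw [uIoc_of_le hxy] at h
  exact ⟨hx.trans h.1.le, lt_of_le_of_ne (h.2.trans hy) hu⟩

theorem intervalIntegrable_polySlope (k : ℕ) (f : ℝ → ℝ) {x y : ℝ} (hx : 0 ≤ x) (hxy : x ≤ y)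
    (hy : y ≤ 1) : IntervalIntegrable (polySlope k f) volume x y := by
  obtain ⟨B, -, hB⟩ := exists_bound_dyadicIncr k f
  rw [intervalIntegrable_iff]
  refine Measure.integrableOn_of_bounded (M := B * 2 ^ k) (by simp)
    (measurable_polySlope k f).aestronglyMeasurable ?_
  rw [ae_restrict_iff' measurableSet_uIoc]
  filter_upwards [ae_mem_Ico hx hxy hy] with u hu h
  exact norm_polySlope_le k f hB (hu h)

end Interpolation

/-! ### Iterated integrals -/

/-- `∫_x^y (p_u - p_x) q'_u du`. -/
def cross (p q' : ℝ → ℝ) (x y : ℝ) : ℝ := ∫ u in x..y, (p u - p x) * q' u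

/-- `∫_x^y (f(k)_u - f(k)_x) dg(k)_u` for the `k`-th dyadic interpolations of `f` and `g`. -/
def area (k : ℕ) (f g : ℝ → ℝ) (x y : ℝ) : ℝ := cross (poly k f) (polySlope k g) x y

theorem intervalIntegrable_cross {p : ℝ → ℝ} (hp : ContinuousOn p (Icc 0 1)) (k : ℕ) (g : ℝ → ℝ)
    {x y : ℝ} (hx : 0 ≤ x) (hxy : x ≤ y) (hy : y ≤ 1) (c : ℝ) :
    IntervalIntegrable (fun u => (p u - c) * polySlope k g u) volume x y := by
  refine (intervalIntegrable_polySlope k g hx hxy hy).continuousOn_mul ?_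
  rw [uIcc_of_le hxy]
  exact (hp.mono (Icc_subset_Icc hx hy)).sub continuousOn_const

theorem cross_sub_left {p₁ p₂ : ℝ → ℝ} (h₁ : ContinuousOn p₁ (Icc 0 1))
    (h₂ : ContinuousOn p₂ (Icc 0 1)) (k : ℕ) (g : ℝ → ℝ) {x y : ℝ} (hx : 0 ≤ x) (hxy : x ≤ y)
    (hy : y ≤ 1) : cross (fun u => p₁ u - p₂ u) (polySlope k g) x y =
      cross p₁ (polySlope k g) x y - cross p₂ (polySlope k g) x y := by
  rw [cross, cross, cross, ← intervalIntegral.integral_sub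
    (intervalIntegrable_cross h₁ k g hx hxy hy _) (intervalIntegrable_cross h₂ k g hx hxy hy _)]
  congr 1; ext u; ring

/-- Integration by parts. The two levels may differ, since the comparison of consecutive
interpolations produces mixed integrals. -/
theorem cross_add_cross_swap (k l : ℕ) (f g : ℝ → ℝ) {x y : ℝ} (hx : 0 ≤ x)
    (hxy : x ≤ y) (hy : y ≤ 1) :
    cross (poly k f) (polySlope l g) x y + cross (poly l g) (polySlope k f) x y =
      (poly k f y - poly k f x) * (poly l g y - poly l g x) := by
  have hsub : uIcc x y ⊆ Icc (0 : ℝ) 1 := by rw [uIcc_of_le hxy]; exact Icc_subset_Icc hx hy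
  have h := intervalIntegral.integral_mul_deriv_eq_deriv_mul_of_hasDeriv_right
    (u := fun u => poly k f u - poly k f x) (v := fun u => poly l g u - poly l g x)
    (a := x) (b := y) (u' := polySlope k f) (v' := polySlope l g)
    (((continuousOn_poly k f).mono hsub).sub continuousOn_const)
    (((continuousOn_poly l g).mono hsub).sub continuousOn_const)
    (fun u _ => (hasDerivWithinAt_poly k f u).sub_const _)
    (fun u _ => (hasDerivWithinAt_poly l g u).sub_const _)
    (intervalIntegrable_polySlope k f hx hxy hy) (intervalIntegrable_polySlope l g hx hxy hy)
  simp only [cross, h, sub_self, mul_zero, sub_zero]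
  simp only [mul_comm (polySlope k f _)]
  ring

theorem area_self (k : ℕ) (f : ℝ → ℝ) {x y : ℝ} (hx : 0 ≤ x) (hxy : x ≤ y) (hy : y ≤ 1) :
    area k f f x y = (poly k f y - poly k f x) ^ 2 / 2 := by
  have := cross_add_cross_swap k k f f hx hxy hy
  unfold area
  linarith

theorem integral_polySlope (k : ℕ) (f : ℝ → ℝ) {x y : ℝ} (hx : 0 ≤ x) (hxy : x ≤ y) (hy : y ≤ 1) :
    ∫ u in x..y, polySlope k f u = poly k f y - poly k f x :=
  intervalIntegral.integral_eq_sub_of_hasDeriv_right_of_le hxy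
    ((continuousOn_poly k f).mono (Icc_subset_Icc hx hy))
    (fun u _ => hasDerivWithinAt_poly k f u) (intervalIntegrable_polySlope k f hx hxy hy)

theorem area_chen (k : ℕ) (f g : ℝ → ℝ) {x z y : ℝ} (hx : 0 ≤ x) (hxz : x ≤ z) (hzy : z ≤ y)
    (hy : y ≤ 1) : area k f g x y = area k f g x z + area k f g z y +
      (poly k f z - poly k f x) * (poly k g y - poly k g z) := by
  have hc := continuousOn_poly k f
  have h1 := intervalIntegrable_cross hc k g hx hxz (hzy.trans hy) (poly k f x)
  have h2 := intervalIntegrable_cross hc k g (hx.trans hxz) hzy hy (poly k f x)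
  have h3 := intervalIntegrable_cross hc k g (hx.trans hxz) hzy hy (poly k f z)
  rw [← integral_polySlope k g (hx.trans hxz) hzy hy, ← intervalIntegral.integral_const_mul]
  simp only [area, cross]
  rw [← intervalIntegral.integral_add_adjacent_intervals h1 h2, add_assoc,
    ← intervalIntegral.integral_add h3
      ((intervalIntegrable_polySlope k g (hx.trans hxz) hzy hy).const_mul _)]
  congr 2; ext u; ring

theorem abs_cross_le {p : ℝ → ℝ} {k : ℕ} {g : ℝ → ℝ} {A B x y : ℝ}
    (hp : ∀ u ∈ Icc x y, |p u - p x| ≤ A) (hB : ∀ c < 2 ^ k, |dyadicIncr k g c| ≤ B)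
    (hx : 0 ≤ x) (hxy : x ≤ y) (hy : y ≤ 1) :
    |cross p (polySlope k g) x y| ≤ A * (B * 2 ^ k) * (y - x) := by
  have h := intervalIntegral.norm_integral_le_of_norm_le_const_ae (a := x) (b := y)
    (f := fun u => (p u - p x) * polySlope k g u) (C := A * (B * 2 ^ k)) ?_
  · rwa [abs_of_nonneg (sub_nonneg.2 hxy)] at h
  · filter_upwards [ae_mem_Ico hx hxy hy] with u hu h
    have h1 := norm_polySlope_le k g hB (hu h)
    rw [uIoc_of_le hxy] at h
    have h2 := hp u ⟨h.1.le, h.2⟩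
    rw [norm_mul]
    exact mul_le_mul h2 h1 (norm_nonneg _) ((abs_nonneg _).trans h2)

theorem area_congr {k : ℕ} {f f' g g' : ℝ → ℝ}
    (hf : ∀ c : ℕ, c ≤ 2 ^ k → f (c / 2 ^ k) = f' (c / 2 ^ k))
    (hg : ∀ c : ℕ, c ≤ 2 ^ k → g (c / 2 ^ k) = g' (c / 2 ^ k))
    {x y : ℝ} (hx : 0 ≤ x) (hxy : x ≤ y) (hy : y ≤ 1) : area k f g x y = area k f' g' x y := by
  refine intervalIntegral.integral_congr_ae ?_
  filter_upwards [ae_mem_Ico hx hxy hy] with u hu h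
  have hu' := hu h
  rw [poly_congr hf ⟨hu'.1, hu'.2.le⟩, poly_congr hf ⟨hx, hxy.trans hy⟩, polySlope_congr hg hu']

/-- `deriv` and `polySlope` can differ only at the dyadic points of level `k`, a null set. -/
theorem lift_polygonal_snd {d : ℕ} (k : ℕ) (a : ℝ → EuclideanSpace ℝ (Fin d)) (x y : ℝ)
    (p : Fin d × Fin d) : (lift (polygonal k a)).snd x y p =
      area k (fun z => a z p.1) (fun z => a z p.2) x y := by
  have hproj : ∀ (i : Fin d) (u : ℝ), polygonal k a u i = poly k (fun z => a z i) u := by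
    intro i u
    simp [polygonal, poly]
  simp only [lift, area, cross, hproj]
  refine intervalIntegral.integral_congr_ae ?_
  filter_upwards [ae_ne_floor k] with u hu _
  rw [(hasDerivAt_poly k (fun z => a z p.2) hu).deriv]

/-! ### The heat kernel -/

theorem heatKernelLine_nonneg (t x : ℝ) : 0 ≤ heatKernelLine t x := by
  unfold heatKernelLine; positivity

theorem heatKernelLine_of_nonpos {t : ℝ} (ht : t ≤ 0) (x : ℝ) : heatKernelLine t x = 0 := by
  have : 4 * Real.pi * t ≤ 0 := mul_nonpos_of_nonneg_of_nonpos (by positivity) ht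
  simp [heatKernelLine, Real.sqrt_eq_zero_of_nonpos this]

theorem heatKernelLine_neg (t x : ℝ) : heatKernelLine t (-x) = heatKernelLine t x := by
  simp [heatKernelLine]

theorem measurable_heatKernelLine : Measurable fun q : ℝ × ℝ => heatKernelLine q.1 q.2 := by
  unfold heatKernelLine; fun_prop

theorem summable_exp_neg_sq {τ : ℝ} (hτ : 0 < τ) (z : ℝ) :
    Summable fun n : ℤ => Real.exp (-(z + n) ^ 2 / (4 * τ)) := by
  have hp := Real.pi_pos
  -- Parameters of the theta series chosen so that its exponent is (-n² + 2|z||n|)/(4τ), which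
  -- dominates -(z+n)²/(4τ).
  have h := summable_pow_mul_jacobiTheta₂_term_bound (|z| / (4 * Real.pi * τ))
    (T := 1 / (4 * Real.pi * τ)) (by positivity) 0
  refine Summable.of_nonneg_of_le (fun _ => (Real.exp_pos _).le) (fun n => ?_) h
  rw [pow_zero, one_mul]
  refine Real.exp_le_exp.2 ?_
  have h1 : -Real.pi * (1 / (4 * Real.pi * τ) * (n : ℝ) ^ 2 -
      2 * (|z| / (4 * Real.pi * τ)) * |(n : ℤ)|) = (-(n : ℝ) ^ 2 + 2 * |z| * |(n : ℝ)|) / (4 * τ) := by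
    push_cast
    field_simp
    ring
  rw [h1]
  gcongr
  have h2 : -(z * n) ≤ |z| * |(n : ℝ)| := by rw [← abs_mul]; exact neg_le_abs _
  nlinarith [sq_nonneg z]

/-- This splits the kernel into a factor u^{-1/2}, integrable at zero, and a factor independent of u
≤ τ that is summable over integer translates. All exchanges of sum and integral below rest on it. -/
theorem heatKernelLine_le {u τ : ℝ} (hu : 0 < u) (huτ : u ≤ τ) (w : ℝ) :
    heatKernelLine u w ≤ u ^ (-(1 / 2) : ℝ) * Real.exp (-w ^ 2 / (4 * τ)) := by
  have h1 : 1 / √(4 * Real.pi * u) ≤ u ^ (-(1 / 2) : ℝ) := by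
    rw [Real.rpow_neg hu.le, ← Real.sqrt_eq_rpow, ← one_div]
    refine one_div_le_one_div_of_le (Real.sqrt_pos.2 hu) (Real.sqrt_le_sqrt ?_)
    nlinarith [Real.pi_gt_three]
  unfold heatKernelLine
  gcongr ?_ * Real.exp ?_
  rw [neg_div, neg_div, neg_le_neg_iff]
  gcongr

theorem summable_heatKernelLine (t x : ℝ) : Summable fun n : ℤ => heatKernelLine t (x + n) := by
  rcases le_or_gt t 0 with h | h
  · simp [heatKernelLine_of_nonpos h, summable_zero]
  · exact Summable.of_nonneg_of_le (fun _ => heatKernelLine_nonneg _ _)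
      (fun n => heatKernelLine_le h le_rfl _) ((summable_exp_neg_sq h x).mul_left _)

theorem heatKernelCircle_nonneg (t x : ℝ) : 0 ≤ heatKernelCircle t x :=
  tsum_nonneg fun _ => heatKernelLine_nonneg _ _

theorem heatKernelCircle_add_one (t x : ℝ) : heatKernelCircle t (x + 1) = heatKernelCircle t x := by
  unfold heatKernelCircle
  rw [← (Equiv.addRight (1 : ℤ)).tsum_eq fun n : ℤ => heatKernelLine t (x + n)]
  refine tsum_congr fun n => ?_
  simp only [Equiv.coe_addRight]; push_cast; ring_nf

theorem heatKernelCircle_neg (t x : ℝ) : heatKernelCircle t (-x) = heatKernelCircle t x := by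
  unfold heatKernelCircle
  rw [← (Equiv.neg ℤ).tsum_eq]
  refine tsum_congr fun n => ?_
  rw [← heatKernelLine_neg]
  simp only [Equiv.neg_apply]; push_cast; ring_nf

theorem ofReal_heatKernelCircle (t x : ℝ) :
    ENNReal.ofReal (heatKernelCircle t x) = ∑' n : ℤ, ENNReal.ofReal (heatKernelLine t (x + n)) :=
  ENNReal.ofReal_tsum_of_nonneg (fun _ => heatKernelLine_nonneg _ _) (summable_heatKernelLine t x)

theorem measurable_heatKernelCircle : Measurable fun q : ℝ × ℝ => heatKernelCircle q.1 q.2 := by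
  have h : (fun q : ℝ × ℝ => heatKernelCircle q.1 q.2) = fun q : ℝ × ℝ =>
      (∑' n : ℤ, ENNReal.ofReal (heatKernelLine q.1 (q.2 + n))).toReal := by
    ext q
    rw [← ofReal_heatKernelCircle, ENNReal.toReal_ofReal (heatKernelCircle_nonneg _ _)]
  rw [h]
  refine (Measurable.tsum fun n => ?_).ennreal_toReal
  exact (measurable_heatKernelLine.comp
    (measurable_fst.prodMk (measurable_snd.add_const _))).ennreal_ofReal

/-! ### Chapman-Kolmogorov -/

theorem lintegral_heatKernelLine {c : ℝ} (hc : 0 < c) (m : ℝ) :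
    ∫⁻ z, ENNReal.ofReal (heatKernelLine c (z - m)) = 1 := by
  have h := lintegral_gaussianPDFReal_eq_one m (v := (2 * c).toNNReal) (by simp [hc])
  rw [← h]
  refine lintegral_congr fun z => ?_
  rw [gaussianPDFReal, heatKernelLine, Real.coe_toNNReal _ (by positivity)]
  congr 1
  rw [one_div]
  ring_nf

/-- Completing the square in `z`: the first factor on the right is free of `z` and the second is a
Gaussian density in `z`. -/
theorem heatKernelLine_mul {a b : ℝ} (ha : 0 < a) (hb : 0 < b) (x y z : ℝ) :
    heatKernelLine a (x - z) * heatKernelLine b (y - z) = heatKernelLine (a + b) (x - y) *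
      heatKernelLine (a * b / (a + b)) (z - (b * x + a * y) / (a + b)) := by
  have hab : 0 < a + b := by positivity
  have hp := Real.pi_pos
  have h1 : √(4 * Real.pi * a) * √(4 * Real.pi * b) =
      √(4 * Real.pi * (a + b)) * √(4 * Real.pi * (a * b / (a + b))) := by
    rw [← Real.sqrt_mul (by positivity), ← Real.sqrt_mul (by positivity)]
    congr 1; field_simp
  have h2 : -(x - z) ^ 2 / (4 * a) + -(y - z) ^ 2 / (4 * b) = -(x - y) ^ 2 / (4 * (a + b)) +
      -(z - (b * x + a * y) / (a + b)) ^ 2 / (4 * (a * b / (a + b))) := by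
    field_simp; ring
  unfold heatKernelLine
  rw [mul_mul_mul_comm, ← Real.exp_add, mul_mul_mul_comm, ← Real.exp_add, h2,
    div_mul_div_comm, div_mul_div_comm, h1]

theorem lintegral_heatKernelLine_mul {a b : ℝ} (ha : 0 < a) (hb : 0 < b) (x y : ℝ) :
    ∫⁻ z, ENNReal.ofReal (heatKernelLine a (x - z)) * ENNReal.ofReal (heatKernelLine b (y - z)) =
      ENNReal.ofReal (heatKernelLine (a + b) (x - y)) := by
  simp_rw [← ENNReal.ofReal_mul (heatKernelLine_nonneg _ _), heatKernelLine_mul ha hb,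
    ENNReal.ofReal_mul (heatKernelLine_nonneg _ _)]
  rw [lintegral_const_mul' _ _ ENNReal.ofReal_ne_top, lintegral_heatKernelLine (by positivity),
    mul_one]

/-- Unfolding: the integer translates of the unit interval tile the line. -/
theorem lintegral_Icc_tsum {f : ℝ → ℝ≥0∞} (hf : Measurable f) :
    ∫⁻ z in Icc (0 : ℝ) 1, ∑' n : ℤ, f (z + n) = ∫⁻ z, f z := by
  rw [setLIntegral_congr Ioc_ae_eq_Icc.symm, lintegral_tsum (fun n => by fun_prop),
    ← setLIntegral_univ (f := f), ← iUnion_Ioc_intCast (α := ℝ),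
    lintegral_iUnion (fun _ => measurableSet_Ioc) (pairwise_disjoint_Ioc_intCast ℝ)]
  refine tsum_congr fun n => ?_
  have h := (measurePreserving_add_right volume (n : ℝ)).setLIntegral_comp_preimage_emb
    (measurableEmbedding_addRight (n : ℝ)) f (Ioc (n : ℝ) (n + 1))
  rw [← h]
  simp

theorem lintegral_heatKernelCircle_mul {a b : ℝ} (ha : 0 < a) (hb : 0 < b) (x y : ℝ) :
    ∫⁻ z in Icc (0 : ℝ) 1, ENNReal.ofReal (heatKernelCircle a (x - z)) *
      ENNReal.ofReal (heatKernelCircle b (y - z)) =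
      ENNReal.ofReal (heatKernelCircle (a + b) (x - y)) := by
  have hm : ∀ t w : ℝ, Measurable fun z => ENNReal.ofReal (heatKernelLine t (w - z)) := fun t w =>
    (measurable_heatKernelLine.comp
      (measurable_const.prodMk (measurable_const.sub measurable_id))).ennreal_ofReal
  -- The product of two periodisations is a double sum, reindexed by the common translation `n` and
  -- the relative one `l`. The sum over `n` unfolds to an integral over the line, where the
  -- semigroup property is known; the sum over `l` rebuilds the kernel of the circle.
  have h1 : ∀ z, ENNReal.ofReal (heatKernelCircle a (x - z)) *
      ENNReal.ofReal (heatKernelCircle b (y - z)) =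
      ∑' l : ℤ, ∑' n : ℤ, ENNReal.ofReal (heatKernelLine a (x - (z + n))) *
        ENNReal.ofReal (heatKernelLine b (y - l - (z + n))) := by
    intro z
    rw [ENNReal.tsum_comm, ofReal_heatKernelCircle, ofReal_heatKernelCircle,
      ← ENNReal.tsum_mul_right, ← (Equiv.neg ℤ).tsum_eq]
    refine tsum_congr fun n => ?_
    rw [ENNReal.tsum_mul_left]
    congr 1
    · simp only [Equiv.neg_apply]; push_cast; ring_nf
    · rw [← ((Equiv.neg ℤ).trans (Equiv.subRight n)).tsum_eq]
      refine tsum_congr fun l => ?_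
      simp only [Equiv.trans_apply, Equiv.neg_apply, Equiv.subRight_apply]
      push_cast; ring_nf
  simp_rw [h1]
  rw [lintegral_tsum fun l => (Measurable.tsum fun n => by
    exact ((hm a x).comp (measurable_id.add_const _)).mul
      ((hm b _).comp (measurable_id.add_const _))).aemeasurable, ofReal_heatKernelCircle]
  refine tsum_congr fun l => ?_
  rw [lintegral_Icc_tsum (f := fun z => ENNReal.ofReal (heatKernelLine a (x - z)) *
        ENNReal.ofReal (heatKernelLine b (y - l - z))) ((hm _ _).mul (hm _ _)),
    lintegral_heatKernelLine_mul ha hb]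
  ring_nf

/-! ### The Green function of the line -/

/-- The Gaussian tail `∫_a^∞ e^{-w²} dw`. -/
def gaussTail (a : ℝ) : ℝ := √Real.pi / 2 - ∫ w in (0 : ℝ)..a, Real.exp (-w ^ 2)

theorem hasDerivAt_gaussTail (a : ℝ) : HasDerivAt gaussTail (-Real.exp (-a ^ 2)) a := by
  have hc : Continuous fun w : ℝ => Real.exp (-w ^ 2) := by fun_prop
  exact (intervalIntegral.integral_hasDerivAt_right (hc.intervalIntegrable _ _)
    hc.stronglyMeasurable.stronglyMeasurableAtFilter hc.continuousAt).const_sub _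

theorem antitone_gaussTail : Antitone gaussTail :=
  antitone_of_deriv_nonpos (fun a => (hasDerivAt_gaussTail a).differentiableAt)
    fun a => by rw [(hasDerivAt_gaussTail a).deriv]; simp [Real.exp_nonneg]

theorem tendsto_gaussTail : Tendsto gaussTail atTop (𝓝 0) := by
  have h := intervalIntegral_tendsto_integral_Ioi (f := fun w : ℝ => Real.exp (-w ^ 2)) 0
    (by simpa using (integrable_exp_neg_mul_sq one_pos).integrableOn) tendsto_id
  have h1 := integral_gaussian_Ioi 1
  simp only [neg_mul, one_mul, div_one] at h1
  rw [h1] at h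
  rw [← sub_self (√Real.pi / 2)]
  exact h.const_sub (√Real.pi / 2)

/-- `½ ∫_0^τ p_u(z) du`, for the heat kernel of the line. -/
def lineGreen (τ z : ℝ) : ℝ := 1 / 2 * ∫ u in (0 : ℝ)..τ, heatKernelLine u z

/-- A closed form of `lineGreen` for `z ≥ 0`. -/
def greenFormula (τ z : ℝ) : ℝ :=
  (√τ * Real.exp (-z ^ 2 / (4 * τ)) - z * gaussTail (z / (2 * √τ))) / (2 * √Real.pi)

theorem sq_div_two_sqrt {τ : ℝ} (hτ : 0 < τ) (z : ℝ) :
    -(z / (2 * √τ)) ^ 2 = -z ^ 2 / (4 * τ) := by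
  rw [div_pow, mul_pow, Real.sq_sqrt hτ.le]; ring

theorem hasDerivAt_greenFormula_time {τ : ℝ} (hτ : 0 < τ) (z : ℝ) :
    HasDerivAt (fun u => greenFormula u z) (1 / 2 * heatKernelLine τ z) τ := by
  have hs : 0 < √τ := Real.sqrt_pos.2 hτ
  have h1 : HasDerivAt (fun u : ℝ => √u) (1 / (2 * √τ)) τ := Real.hasDerivAt_sqrt hτ.ne'
  have h2 : HasDerivAt (fun u : ℝ => -z ^ 2 / (4 * u)) (z ^ 2 / (4 * τ ^ 2)) τ := by
    refine ((((hasDerivAt_id τ).const_mul 4).fun_inv (by simpa using hτ.ne')).const_mul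
      (-z ^ 2)).congr_deriv ?_
    simp only [id]; field_simp
  have h3 : HasDerivAt (fun u : ℝ => z / (2 * √u)) (-z / (4 * τ * √τ)) τ := by
    refine (((h1.const_mul 2).fun_inv (by positivity)).const_mul z).congr_deriv ?_
    rw [mul_pow, Real.sq_sqrt hτ.le]; field_simp; ring
  have h4 := (hasDerivAt_gaussTail (z / (2 * √τ))).comp τ h3
  have h5 := ((h1.mul h2.exp).sub (h4.const_mul z)).div_const (2 * √Real.pi)
  refine h5.congr_deriv ?_
  rw [sq_div_two_sqrt hτ, heatKernelLine]
  have h6 : √(4 * Real.pi * τ) = 2 * √Real.pi * √τ := by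
    rw [mul_assoc, Real.sqrt_mul (by norm_num), Real.sqrt_mul Real.pi_pos.le,
      show √(4 : ℝ) = 2 by rw [Real.sqrt_eq_iff_mul_self_eq] <;> norm_num]; ring
  have h7 : √τ * √τ = τ := Real.mul_self_sqrt hτ.le
  have h8 : 0 < √Real.pi := Real.sqrt_pos.2 Real.pi_pos
  rw [h6]
  generalize √τ = s at *
  subst h7
  field_simp
  ring

theorem hasDerivAt_greenFormula {τ : ℝ} (hτ : 0 < τ) (z : ℝ) :
    HasDerivAt (greenFormula τ) (-gaussTail (z / (2 * √τ)) / (2 * √Real.pi)) z := by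
  have hs : 0 < √τ := Real.sqrt_pos.2 hτ
  have h2 : HasDerivAt (fun z : ℝ => -z ^ 2 / (4 * τ)) (-(2 * z) / (4 * τ)) z := by
    simpa using ((hasDerivAt_id z).pow 2).neg.div_const (4 * τ)
  have h3 : HasDerivAt (fun z : ℝ => z / (2 * √τ)) (1 / (2 * √τ)) z :=
    (hasDerivAt_id z).div_const _
  have h4 := (hasDerivAt_gaussTail (z / (2 * √τ))).comp z h3
  have h5 := ((h2.exp.const_mul √τ).sub ((hasDerivAt_id z).mul h4)).div_const (2 * √Real.pi)
  refine h5.congr_deriv ?_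
  rw [sq_div_two_sqrt hτ]
  have h7 : √τ * √τ = τ := Real.mul_self_sqrt hτ.le
  have h8 : 0 < √Real.pi := Real.sqrt_pos.2 Real.pi_pos
  simp only [id, Function.comp]
  generalize √τ = s at *
  subst h7
  field_simp
  ring

/-- The derivative is a negative multiple of a decreasing Gaussian tail, hence increasing. The
formula is convex on the whole line but is the Green function only for z ≥ 0; the latter is even
with a concave cusp at zero, so its convexity is one-sided. -/
theorem convexOn_greenFormula {τ : ℝ} (hτ : 0 < τ) : ConvexOn ℝ univ (greenFormula τ) := by
  refine Monotone.convexOn_univ_of_deriv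
    (fun z => (hasDerivAt_greenFormula hτ z).differentiableAt) fun a b hab => ?_
  rw [(hasDerivAt_greenFormula hτ a).deriv, (hasDerivAt_greenFormula hτ b).deriv]
  have := antitone_gaussTail (a := a / (2 * √τ)) (b := b / (2 * √τ)) (by gcongr)
  gcongr

/-- A convex function lies above its tangent at zero, here of slope -1/4 whatever τ is; this
uniformity gives a spatial bound independent of time. -/
theorem greenFormula_zero_sub_le {τ z : ℝ} (hτ : 0 < τ) (hz : 0 ≤ z) :
    greenFormula τ 0 - greenFormula τ z ≤ z := by
  have hp : 0 < √Real.pi := Real.sqrt_pos.2 Real.pi_pos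
  rcases hz.eq_or_lt with rfl | hz
  · simp
  have h := (convexOn_greenFormula hτ).le_slope_of_hasDerivAt (mem_univ _) (mem_univ _) hz
    (hasDerivAt_greenFormula hτ 0)
  rw [slope_def_field, le_div_iff₀ (by linarith), zero_div] at h
  have h1 : gaussTail 0 = √Real.pi / 2 := by simp [gaussTail]
  have h2 : -(√Real.pi / 2) / (2 * √Real.pi) = -(1 / 4) := by field_simp; norm_num
  rw [h1, h2] at h
  linarith

theorem tendsto_greenFormula {z : ℝ} (hz : 0 ≤ z) :
    Tendsto (fun u => greenFormula u z) (𝓝[>] 0) (𝓝 0) := by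
  have h1 : Tendsto (fun u : ℝ => √u) (𝓝[>] 0) (𝓝 0) := by
    simpa using (Real.continuous_sqrt.tendsto 0).mono_left nhdsWithin_le_nhds
  have h2 : Tendsto (fun u : ℝ => √u * Real.exp (-z ^ 2 / (4 * u))) (𝓝[>] 0) (𝓝 0) := by
    refine squeeze_zero' (Eventually.of_forall fun u => by positivity) ?_ h1
    filter_upwards [self_mem_nhdsWithin] with u hu
    have hu : 0 < u := hu
    refine mul_le_of_le_one_right (Real.sqrt_nonneg _) (Real.exp_le_one_iff.2 ?_)
    rw [neg_div]; exact neg_nonpos.2 (by positivity)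
  have h3 : Tendsto (fun u : ℝ => z * gaussTail (z / (2 * √u))) (𝓝[>] 0) (𝓝 0) := by
    rcases hz.eq_or_lt with rfl | hz
    · simp
    · have h4 : Tendsto (fun u : ℝ => 2 * √u) (𝓝[>] 0) (𝓝[>] 0) := by
        refine tendsto_nhdsWithin_iff.2 ⟨by simpa using h1.const_mul 2, ?_⟩
        filter_upwards [self_mem_nhdsWithin] with u hu
        have : 0 < √u := Real.sqrt_pos.2 hu
        exact mem_Ioi.2 (by positivity)
      have h5 : Tendsto (fun u : ℝ => z / (2 * √u)) (𝓝[>] 0) atTop := by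
        simp_rw [div_eq_mul_inv]
        exact (tendsto_inv_nhdsGT_zero.comp h4).const_mul_atTop hz
      simpa using (tendsto_gaussTail.comp h5).const_mul z
  simpa [greenFormula] using (h2.sub h3).div_const (2 * √Real.pi)

theorem intervalIntegrable_rpow_neg_half (a b : ℝ) :
    IntervalIntegrable (fun u : ℝ => u ^ (-(1 / 2) : ℝ)) volume a b :=
  intervalIntegral.intervalIntegrable_rpow' (by norm_num)

theorem intervalIntegrable_heatKernelLine {τ : ℝ} (hτ : 0 ≤ τ) (z : ℝ) :
    IntervalIntegrable (fun u => heatKernelLine u z) volume 0 τ := by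
  refine (intervalIntegrable_rpow_neg_half 0 τ).mono_fun ?_ ?_
  · exact (measurable_heatKernelLine.comp
      (measurable_id.prodMk measurable_const)).aestronglyMeasurable
  · rw [uIoc_of_le hτ]
    filter_upwards [ae_restrict_mem measurableSet_Ioc] with u hu
    rw [Real.norm_of_nonneg (heatKernelLine_nonneg _ _),
      Real.norm_of_nonneg (Real.rpow_nonneg hu.1.le _)]
    refine (heatKernelLine_le hu.1 le_rfl z).trans ?_
    refine mul_le_of_le_one_right (Real.rpow_nonneg hu.1.le _) (Real.exp_le_one_iff.2 ?_)
    have := hu.1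
    rw [neg_div]; exact neg_nonpos.2 (by positivity)

/-- Both sides have the same derivative in τ and vanish as τ tends to zero. For negative `z` the
formula does not tend to zero. -/
theorem lineGreen_eq {τ z : ℝ} (hτ : 0 < τ) (hz : 0 ≤ z) : lineGreen τ z = greenFormula τ z := by
  have h := intervalIntegral.integral_eq_sub_of_hasDerivAt_of_tendsto hτ
    (fun u hu => hasDerivAt_greenFormula_time hu.1 z)
    ((intervalIntegrable_heatKernelLine hτ.le z).const_mul _) (tendsto_greenFormula hz)
    ((hasDerivAt_greenFormula_time hτ z).continuousAt.tendsto.mono_left nhdsWithin_le_nhds)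
  rw [lineGreen, ← intervalIntegral.integral_const_mul, h, sub_zero]

theorem lineGreen_neg (τ z : ℝ) : lineGreen τ (-z) = lineGreen τ z := by
  simp [lineGreen, heatKernelLine_neg]

theorem convexOn_lineGreen {τ : ℝ} (hτ : 0 < τ) : ConvexOn ℝ (Ici 0) (lineGreen τ) :=
  ((convexOn_greenFormula hτ).subset (subset_univ _) (convex_Ici 0)).congr
    fun _ hz => (lineGreen_eq hτ hz).symm

theorem convexOn_lineGreen_neg {τ : ℝ} (hτ : 0 < τ) : ConvexOn ℝ (Iic 0) (lineGreen τ) := by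
  have h := (convexOn_greenFormula hτ).comp_linearMap (-LinearMap.id)
  refine (h.subset (subset_univ _) (convex_Iic 0)).congr fun z hz => ?_
  simp only [Function.comp, LinearMap.neg_apply, LinearMap.id_apply]
  rw [← lineGreen_neg, lineGreen_eq hτ (neg_nonneg.2 hz)]

/-! ### The Green function of the circle -/

/-- `½ ∫_0^τ p̃_u(z) du`, for the heat kernel of the circle. -/
def circleGreen (τ z : ℝ) : ℝ := 1 / 2 * ∫ u in (0 : ℝ)..τ, heatKernelCircle u z

theorem heatKernelCircle_le {u τ : ℝ} (hu : 0 < u) (huτ : u ≤ τ) (z : ℝ) :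
    heatKernelCircle u z ≤
      (∑' n : ℤ, Real.exp (-(z + n) ^ 2 / (4 * τ))) * u ^ (-(1 / 2) : ℝ) := by
  rw [mul_comm, ← tsum_mul_left]
  exact (summable_heatKernelLine u z).tsum_le_tsum (fun n => heatKernelLine_le hu huτ _)
    ((summable_exp_neg_sq (hu.trans_le huτ) z).mul_left _)

theorem intervalIntegrable_heatKernelCircle {τ : ℝ} (hτ : 0 ≤ τ) (z : ℝ) :
    IntervalIntegrable (fun u => heatKernelCircle u z) volume 0 τ := by
  refine ((intervalIntegrable_rpow_neg_half 0 τ).const_mul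
    (∑' n : ℤ, Real.exp (-(z + n) ^ 2 / (4 * τ)))).mono_fun ?_ ?_
  · exact (measurable_heatKernelCircle.comp
      (measurable_id.prodMk measurable_const)).aestronglyMeasurable
  · rw [uIoc_of_le hτ]
    filter_upwards [ae_restrict_mem measurableSet_Ioc] with u hu
    rw [Real.norm_of_nonneg (heatKernelCircle_nonneg _ _)]
    exact (heatKernelCircle_le hu.1 hu.2 z).trans (le_abs_self _)

theorem circleGreen_sub {a b : ℝ} (ha : 0 ≤ a) (hb : 0 ≤ b) (z : ℝ) :
    circleGreen b z - circleGreen a z = 1 / 2 * ∫ u in a..b, heatKernelCircle u z := by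
  rw [circleGreen, circleGreen, ← mul_sub, intervalIntegral.integral_interval_sub_left
    (intervalIntegrable_heatKernelCircle hb z) (intervalIntegrable_heatKernelCircle ha z)]

theorem circleGreen_neg (τ z : ℝ) : circleGreen τ (-z) = circleGreen τ z := by
  simp [circleGreen, heatKernelCircle_neg]

theorem hasSum_lineGreen {τ : ℝ} (hτ : 0 < τ) (z : ℝ) :
    HasSum (fun n : ℤ => lineGreen τ (z + n)) (circleGreen τ z) := by
  have hint := fun n : ℤ => (intervalIntegrable_heatKernelLine hτ.le (z + n))
  have h := hasSum_integral_of_summable_integral_norm (μ := volume.restrict (Ioc 0 τ))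
    (F := fun (n : ℤ) u => heatKernelLine u (z + n))
    (fun n => (intervalIntegrable_iff_integrableOn_Ioc_of_le hτ.le).1 (hint n)) ?_
  · simp_rw [lineGreen, circleGreen, intervalIntegral.integral_of_le hτ.le]
    exact h.mul_left _
  · refine Summable.of_nonneg_of_le (fun n => integral_nonneg fun _ => norm_nonneg _)
      (fun n => ?_) ((summable_exp_neg_sq hτ z).mul_left (∫ u in Ioc 0 τ, u ^ (-(1 / 2) : ℝ)))
    rw [← integral_mul_const]
    refine integral_mono_ae
      ((intervalIntegrable_iff_integrableOn_Ioc_of_le hτ.le).1 (hint n)).norm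
      (((intervalIntegrable_iff_integrableOn_Ioc_of_le hτ.le).1
        (intervalIntegrable_rpow_neg_half 0 τ)).mul_const _) ?_
    filter_upwards [ae_restrict_mem measurableSet_Ioc] with u hu
    rw [Real.norm_of_nonneg (heatKernelLine_nonneg _ _)]
    exact heatKernelLine_le hu.1 hu.2 _

/-- Every integer translate of [0,1] lies on one side of the cusp at zero, where the Green function
of the line is convex, so the periodised sum is convex on [0,1]. The sign of all covariances of
increments comes from here. -/
theorem convexOn_circleGreen {τ : ℝ} (hτ : 0 < τ) : ConvexOn ℝ (Icc 0 1) (circleGreen τ) := by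
  refine ⟨convex_Icc 0 1, fun x hx y hy a b ha hb hab => ?_⟩
  refine hasSum_le (fun n : ℤ => ?_) (hasSum_lineGreen hτ _)
    (((hasSum_lineGreen hτ x).mul_left a).add ((hasSum_lineGreen hτ y).mul_left b))
  have h1 : a • x + b • y + (n : ℝ) = a • (x + n) + b • (y + n) := by
    simp only [smul_eq_mul]
    linear_combination (-(n : ℝ)) * hab
  rw [h1]
  rcases le_or_gt 0 n with hn | hn
  · have hn : (0 : ℝ) ≤ n := by exact_mod_cast hn
    exact (convexOn_lineGreen hτ).2 (mem_Ici.2 (by linarith [hx.1]))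
      (mem_Ici.2 (by linarith [hy.1])) ha hb hab
  · have hn : (n : ℝ) ≤ -1 := by exact_mod_cast Int.le_sub_one_of_lt hn
    exact (convexOn_lineGreen_neg hτ).2 (mem_Iic.2 (by linarith [hx.2]))
      (mem_Iic.2 (by linarith [hy.2])) ha hb hab

/-- By evenness, twice the left side is a sum over translates of second differences with step `h`.
Those away from the origin are non-positive by convexity, and the central one is at most 2h. -/
theorem circleGreen_zero_sub_le {τ h : ℝ} (hτ : 0 < τ) (hh : h ∈ Icc (0 : ℝ) 1) :
    circleGreen τ 0 - circleGreen τ h ≤ h := by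
  have h1 := ((hasSum_lineGreen hτ 0).mul_left 2).sub
    ((hasSum_lineGreen hτ h).add (hasSum_lineGreen hτ (-h)))
  have h2 : HasSum (fun n : ℤ => if n = 0 then 2 * h else 0) (2 * h) := hasSum_ite_eq 0 _
  have h3 := hasSum_le (fun n : ℤ => ?_) h1 h2
  · rw [circleGreen_neg] at h3; linarith
  have hmid : ∀ m : ℝ, 1 ≤ m → 2 * lineGreen τ m ≤ lineGreen τ (h + m) + lineGreen τ (-h + m) := by
    intro m hm
    have := (convexOn_lineGreen hτ).2 (mem_Ici.2 (by linarith [hh.1] : 0 ≤ h + m))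
      (mem_Ici.2 (by linarith [hh.2] : 0 ≤ -h + m)) (by norm_num : (0 : ℝ) ≤ 1 / 2)
      (by norm_num : (0 : ℝ) ≤ 1 / 2) (by norm_num)
    simp only [smul_eq_mul] at this
    rw [show 1 / 2 * (h + m) + 1 / 2 * (-h + m) = m by ring] at this
    linarith
  rcases lt_trichotomy n 0 with hn | rfl | hn
  · rw [if_neg hn.ne]
    have hn : (n : ℝ) ≤ -1 := by exact_mod_cast Int.le_sub_one_of_lt hn
    have := hmid (-n) (by linarith)
    rw [lineGreen_neg, ← lineGreen_neg τ (h + -n), ← lineGreen_neg τ (-h + -n)] at this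
    rw [show -(h + -(n : ℝ)) = -h + n by ring, show -(-h + -(n : ℝ)) = h + n by ring] at this
    rw [zero_add]; linarith
  · have := greenFormula_zero_sub_le hτ hh.1
    rw [← lineGreen_eq hτ le_rfl, ← lineGreen_eq hτ hh.1] at this
    simp only [Int.cast_zero, add_zero, lineGreen_neg, if_true]
    linarith
  · rw [if_neg hn.ne']
    have := hmid n (by exact_mod_cast hn)
    rw [zero_add]; linarith

/-- On the diagonal the kernel is at most C u^{-1/2} up to time T, and √b - √a ≤ √(b-a). -/
theorem exists_circleGreen_sub_le (T : ℝ) : ∃ C, 0 ≤ C ∧ ∀ a b, 0 ≤ a → a ≤ b → b ≤ T →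
    circleGreen b 0 - circleGreen a 0 ≤ C * √(b - a) := by
  set C := ∑' n : ℤ, Real.exp (-(0 + (n : ℝ)) ^ 2 / (4 * T))
  have hC : 0 ≤ C := tsum_nonneg fun _ => (Real.exp_pos _).le
  refine ⟨C, hC, fun a b ha hab hb => ?_⟩
  have h1 : ∫ u in a..b, heatKernelCircle u 0 ≤ ∫ u in a..b, C * u ^ (-(1 / 2) : ℝ) := by
    refine intervalIntegral.integral_mono_on_of_le_Ioo hab
      ((intervalIntegrable_heatKernelCircle ha 0).symm.trans
        (intervalIntegrable_heatKernelCircle (ha.trans hab) 0))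
      ((intervalIntegrable_rpow_neg_half a b).const_mul C) fun u hu => ?_
    exact heatKernelCircle_le (ha.trans_lt hu.1) (hu.2.le.trans hb) 0
  rw [intervalIntegral.integral_const_mul, integral_rpow (Or.inl (by norm_num))] at h1
  norm_num [← Real.sqrt_eq_rpow] at h1
  have h2 : √b ≤ √a + √(b - a) := by
    rw [Real.sqrt_le_left (by positivity), add_sq, Real.sq_sqrt ha, Real.sq_sqrt (by linarith)]
    nlinarith [mul_nonneg (Real.sqrt_nonneg a) (Real.sqrt_nonneg (b - a))]
  rw [circleGreen_sub ha (ha.trans hab)]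
  nlinarith

/-! ### Covariance of the stochastic convolution -/

theorem measurable_mildKernel (t x : ℝ) : Measurable (mildKernel t x) := by
  unfold mildKernel
  refine Measurable.ite (measurableSet_lt measurable_fst measurable_const) ?_ measurable_const
  exact measurable_heatKernelCircle.comp ((measurable_const.sub measurable_fst).prodMk
    (measurable_const.sub measurable_snd))

theorem mildKernel_nonneg (t x : ℝ) (z : ℝ × ℝ) : 0 ≤ mildKernel t x z := by
  unfold mildKernel; split_ifs
  exacts [heatKernelCircle_nonneg _ _, le_rfl]

theorem mildKernel_add_one (t x : ℝ) : mildKernel t (x + 1) = mildKernel t x := by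
  ext z
  unfold mildKernel
  rw [add_sub_right_comm, heatKernelCircle_add_one]

/-- The substitution u = t + s - 2r; its Jacobian is the factor 1/2 in `circleGreen`. -/
theorem integral_heatKernelCircle_comp {s t : ℝ} (hs : 0 ≤ s) (hst : s ≤ t) (z : ℝ) :
    IntervalIntegrable (fun r => heatKernelCircle (t + s - 2 * r) z) volume 0 s ∧
    ∫ r in (0 : ℝ)..s, heatKernelCircle (t + s - 2 * r) z =
      circleGreen (t + s) z - circleGreen (t - s) z := by
  have h1 : IntervalIntegrable (fun u => heatKernelCircle u z) volume (t + s - 0) (t + s - 2 * s) :=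
    (intervalIntegrable_heatKernelCircle (τ := t + s - 0) (by linarith) z).symm.trans
      (intervalIntegrable_heatKernelCircle (by linarith) z)
  constructor
  · have h2 := (h1.comp_sub_left (t + s)).comp_mul_left (c := 2)
    simpa using h2
  · rw [circleGreen_sub (by linarith) (by linarith),
      intervalIntegral.integral_comp_sub_mul (fun u => heatKernelCircle u z) two_ne_zero]
    simp only [smul_eq_mul, mul_zero, sub_zero]
    rw [show t + s - 2 * s = t - s by ring]
    norm_num

/-- For each r < s, Chapman–Kolmogorov in the space variable gives the kernel at time t + s - 2r.
Working with the lower Lebesgue integral makes the case s = t a proof that the kernel is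
square-integrable. -/
theorem lintegral_mildKernel_mul {T s t : ℝ} (hs : 0 ≤ s) (hst : s ≤ t) (ht : t ≤ T) (x y : ℝ) :
    ∫⁻ z, ENNReal.ofReal (mildKernel t x z * mildKernel s y z) ∂spaceTimeMeasure T =
      ENNReal.ofReal (circleGreen (t + s) (x - y) - circleGreen (t - s) (x - y)) := by
  obtain ⟨hi, he⟩ := integral_heatKernelCircle_comp hs hst (x - y)
  rw [← he, intervalIntegral.integral_of_le hs, ofReal_integral_eq_lintegral_ofReal
    ((intervalIntegrable_iff_integrableOn_Ioc_of_le hs).1 hi)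
    (Eventually.of_forall fun _ => heatKernelCircle_nonneg _ _),
    setLIntegral_congr (Ioo_ae_eq_Ioc (a := (0 : ℝ)) (b := s)).symm,
    setLIntegral_congr (Ioo_ae_eq_Ico (a := (0 : ℝ)) (b := s)),
    spaceTimeMeasure, Measure.volume_eq_prod, ← Measure.prod_restrict, lintegral_prod _
      (by exact ((measurable_mildKernel t x).mul
        (measurable_mildKernel s y)).ennreal_ofReal.aemeasurable)]
  -- The half-open interval matches the strict inequality in `mildKernel` and excludes r = s, where
  -- one of the kernels would have time zero.
  have hsub : Ico 0 s ⊆ Icc 0 T := fun r hr => ⟨hr.1, (hr.2.le.trans hst).trans ht⟩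
  have h0 : ∀ r, ¬ r < s → ∫⁻ z in Icc (0 : ℝ) 1,
      ENNReal.ofReal (mildKernel t x (r, z) * mildKernel s y (r, z)) = 0 := by
    intro r hr
    simp [mildKernel, hr]
  rw [← lintegral_indicator measurableSet_Icc, ← lintegral_indicator measurableSet_Ico]
  refine lintegral_congr fun r => ?_
  by_cases hr : r ∈ Ico 0 s
  · rw [indicator_of_mem (hsub hr), indicator_of_mem hr]
    have h1 := lintegral_heatKernelCircle_mul (a := t - r) (b := s - r) (by linarith [hr.2])
      (by linarith [hr.2]) x y
    rw [show t - r + (s - r) = t + s - 2 * r by ring] at h1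
    rw [← h1]
    refine lintegral_congr fun z => ?_
    rw [← ENNReal.ofReal_mul (heatKernelCircle_nonneg _ _)]
    simp only [mildKernel, hr.2, hr.2.trans_le hst, if_true]
  · rw [indicator_of_notMem hr]
    by_cases hr' : r ∈ Icc 0 T
    · rw [indicator_of_mem hr']
      exact h0 r fun h => hr ⟨hr'.1, h⟩
    · rw [indicator_of_notMem hr']

theorem memLp_mildKernel {T t : ℝ} (ht : t ∈ Icc 0 T) (x : ℝ) :
    MemLp (mildKernel t x) 2 (spaceTimeMeasure T) := by
  rw [memLp_two_iff_integrable_sq (measurable_mildKernel t x).aestronglyMeasurable]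
  refine ⟨((measurable_mildKernel t x).pow_const 2).aestronglyMeasurable, ?_⟩
  rw [hasFiniteIntegral_iff_ofReal (Eventually.of_forall fun _ => sq_nonneg _)]
  simp_rw [pow_two]
  rw [lintegral_mildKernel_mul ht.1 le_rfl ht.2]
  exact ENNReal.ofReal_lt_top

theorem integral_mildKernel_mul {T s t : ℝ} (hs : 0 ≤ s) (hst : s ≤ t) (ht : t ≤ T) (x y : ℝ) :
    ∫ z, mildKernel t x z * mildKernel s y z ∂spaceTimeMeasure T =
      circleGreen (t + s) (x - y) - circleGreen (t - s) (x - y) := by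
  rw [integral_eq_lintegral_of_nonneg_ae
    (Eventually.of_forall fun z => mul_nonneg (mildKernel_nonneg _ _ _) (mildKernel_nonneg _ _ _))
    ((measurable_mildKernel t x).mul (measurable_mildKernel s y)).aestronglyMeasurable,
    lintegral_mildKernel_mul hs hst ht, ENNReal.toReal_ofReal]
  rw [circleGreen_sub (by linarith) (by linarith)]
  exact mul_nonneg (by norm_num) (intervalIntegral.integral_nonneg (by linarith)
    fun _ _ => heatKernelCircle_nonneg _ _)

theorem circleGreen_zero_left (z : ℝ) : circleGreen 0 z = 0 := by simp [circleGreen]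

theorem integral_mildKernel_mul_self_time {T t : ℝ} (ht : t ∈ Icc 0 T) (x y : ℝ) :
    ∫ z, mildKernel t x z * mildKernel t y z ∂spaceTimeMeasure T = circleGreen (2 * t) (x - y) := by
  rw [integral_mildKernel_mul ht.1 le_rfl ht.2, sub_self, circleGreen_zero_left, sub_zero, two_mul]

theorem integral_sub_sq {E : Type*} [MeasurableSpace E] {ν : Measure E} {f g : E → ℝ}
    (hf : MemLp f 2 ν) (hg : MemLp g 2 ν) : ∫ z, (f z - g z) ^ 2 ∂ν =
      (∫ z, f z * f z ∂ν) + (∫ z, g z * g z ∂ν) - 2 * ∫ z, f z * g z ∂ν := by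
  have h1 : Integrable (fun z => f z * f z) ν := hf.integrable_mul hf
  have h2 : Integrable (fun z => g z * g z) ν := hg.integrable_mul hg
  have h3 : Integrable (fun z => 2 * (f z * g z)) ν := (hf.integrable_mul hg).const_mul 2
  have h4 : Integrable (fun z => f z * f z + g z * g z) ν := h1.add h2
  rw [← integral_const_mul, ← integral_add h1 h2, ← integral_sub h4 h3]
  congr 1; ext z; ring

theorem integral_mildKernel_sub_space {T t : ℝ} (ht : t ∈ Icc 0 T) {x y : ℝ} (hxy : |x - y| ≤ 1) :
    ∫ z, (mildKernel t x z - mildKernel t y z) ^ 2 ∂spaceTimeMeasure T ≤ 2 * |x - y| := by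
  rw [integral_sub_sq (memLp_mildKernel ht x) (memLp_mildKernel ht y)]
  simp only [integral_mildKernel_mul_self_time ht, sub_self]
  rcases ht.1.eq_or_lt with h | h
  · simp [← h, circleGreen_zero_left]
  · have h1 := circleGreen_zero_sub_le (τ := 2 * t) (by linarith) ⟨abs_nonneg (x - y), hxy⟩
    have h2 : circleGreen (2 * t) |x - y| = circleGreen (2 * t) (x - y) := by
      rcases abs_choice (x - y) with h | h <;> rw [h]
      exact circleGreen_neg _ _
    rw [h2] at h1
    linarith

/-- With all Green functions at zero and s ≤ t, the integral is (G_{2t} - G_{t+s}) - (G_{t+s} -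
G_{2s}) + 2G_{t-s}. The middle bracket is dropped by its sign, and the other two terms give C and
2C. -/
theorem exists_integral_mildKernel_sub_time (T : ℝ) : ∃ C, 0 ≤ C ∧ ∀ s ∈ Icc 0 T, ∀ t ∈ Icc 0 T,
    ∀ x, ∫ z, (mildKernel t x z - mildKernel s x z) ^ 2 ∂spaceTimeMeasure T ≤ C * √|t - s| := by
  obtain ⟨C, hC, h⟩ := exists_circleGreen_sub_le (2 * T)
  refine ⟨3 * C, by positivity, fun s hs t ht x => ?_⟩
  wlog hst : s ≤ t generalizing s t
  · have := this t ht s hs (le_of_not_ge hst)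
    rw [abs_sub_comm]
    simpa only [sub_sq_comm] using this
  rw [integral_sub_sq (memLp_mildKernel ht x) (memLp_mildKernel hs x),
    integral_mildKernel_mul_self_time ht, integral_mildKernel_mul_self_time hs,
    integral_mildKernel_mul hs.1 hst ht.2, sub_self, abs_of_nonneg (sub_nonneg.2 hst)]
  have h1 := h (t + s) (2 * t) (by linarith [hs.1]) (by linarith) (by linarith [ht.2])
  have h2 := h 0 (t - s) le_rfl (by linarith) (by linarith [ht.2, hs.1])
  have h3 : 0 ≤ circleGreen (t + s) 0 - circleGreen (2 * s) 0 := by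
    rw [circleGreen_sub (by linarith [hs.1]) (by linarith [hs.1])]
    exact mul_nonneg (by norm_num) (intervalIntegral.integral_nonneg (by linarith)
      fun _ _ => heatKernelCircle_nonneg _ _)
  rw [circleGreen_zero_left, sub_zero, sub_zero] at h2
  rw [show 2 * t - (t + s) = t - s by ring] at h1
  linarith

/-! ### The Gaussian space of a white noise -/

section WhiteNoise

variable {E Ω : Type*} [MeasurableSpace E] [MeasurableSpace Ω] {ν : Measure E}
  {W : (E → ℝ) → Ω → ℝ} {P : Measure Ω}

/-- The linear span of the random variables `W f`. -/
def noiseSpan (ν : Measure E) (W : (E → ℝ) → Ω → ℝ) : Submodule ℝ (Ω → ℝ) :=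
  Submodule.span ℝ (range fun f : {f : E → ℝ // MemLp f 2 ν} => W f.1)

omit [MeasurableSpace Ω] in
theorem mem_noiseSpan {f : E → ℝ} (hf : MemLp f 2 ν) : W f ∈ noiseSpan ν W :=
  Submodule.subset_span ⟨⟨f, hf⟩, rfl⟩

theorem IsWhiteNoise.hasGaussianLaw (hW : IsWhiteNoise ν W P) {S : Ω → ℝ}
    (hS : S ∈ noiseSpan ν W) : HasGaussianLaw S P := by
  obtain ⟨c, rfl⟩ := Finsupp.mem_span_range_iff_exists_finsupp.1 hS
  have h := hW.gaussian.hasGaussianLaw c.support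
  have h1 := h.map_fun (∑ i : c.support, c i • ContinuousLinearMap.proj (R := ℝ) i)
  refine (congrArg (HasGaussianLaw · P) ?_).mp h1
  ext ω
  rw [Finsupp.sum, Finset.sum_apply]
  simpa using Finset.sum_coe_sort c.support fun f => c f * W f.1 ω

theorem IsWhiteNoise.memLp (hW : IsWhiteNoise ν W P) {S : Ω → ℝ}
    (hS : S ∈ noiseSpan ν W) : MemLp S 2 P := (hW.hasGaussianLaw hS).memLp_two

theorem IsWhiteNoise.integral_eq_zero (hW : IsWhiteNoise ν W P) {S : Ω → ℝ}
    (hS : S ∈ noiseSpan ν W) : ∫ ω, S ω ∂P = 0 := by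
  induction hS using Submodule.span_induction with
  | mem x hx => obtain ⟨f, rfl⟩ := hx; exact hW.mean_zero _ f.2
  | zero => simp
  | add x y hx hy h1 h2 =>
    simp only [Pi.add_apply]
    rw [integral_add (hW.hasGaussianLaw hx).integrable (hW.hasGaussianLaw hy).integrable, h1, h2,
      add_zero]
  | smul a x hx h =>
    simp only [Pi.smul_apply]
    rw [integral_smul, h, smul_zero]

/-- The `L^q` norm of a standard Gaussian variable. -/
def gaussMoment (q : ℝ) : ℝ≥0∞ := eLpNorm' (fun x : ℝ => x) q (gaussianReal 0 1)

theorem gaussMoment_ne_top {q : ℝ} (hq : 0 < q) : gaussMoment q ≠ ⊤ := by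
  have h := (memLp_id_gaussianReal' (μ := 0) (v := 1) (ENNReal.ofReal q)
    ENNReal.ofReal_ne_top).2.ne
  rwa [eLpNorm_eq_eLpNorm' (by simpa using hq) ENNReal.ofReal_ne_top,
    ENNReal.toReal_ofReal hq.le] at h

/-- A centred Gaussian variable has the law of its standard deviation times a standard one. Through
this identity every L² estimate becomes an L^q estimate. -/
theorem IsWhiteNoise.eLpNorm'_eq (hW : IsWhiteNoise ν W P) {S : Ω → ℝ}
    (hS : S ∈ noiseSpan ν W) {q : ℝ} (hq : 0 < q) :
    eLpNorm' S q P = gaussMoment q * ENNReal.ofReal √(∫ ω, S ω ^ 2 ∂P) := by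
  have hG := hW.hasGaussianLaw hS
  have h0 := hW.integral_eq_zero hS
  have hlaw := hG.map_eq_gaussianReal
  have hvar : Var[S; P] = ∫ ω, S ω ^ 2 ∂P := variance_of_integral_eq_zero hG.aemeasurable h0
  set v := ∫ ω, S ω ^ 2 ∂P with hv
  have hv0 : 0 ≤ v := integral_nonneg fun _ => sq_nonneg _
  have h1 : P.map S = (gaussianReal 0 1).map (√v * ·) := by
    rw [hlaw, gaussianReal_map_const_mul, h0, hvar, mul_zero, mul_one]
    congr 1
    ext
    simp [Real.sq_sqrt hv0, hv0]
  have h2 : ∫⁻ ω, ‖S ω‖ₑ ^ q ∂P = ∫⁻ x, ‖√v * x‖ₑ ^ q ∂(gaussianReal 0 1) := by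
    rw [← lintegral_map' (f := fun x : ℝ => ‖x‖ₑ ^ q) (by fun_prop) hG.aemeasurable, h1,
      lintegral_map (by fun_prop) (by fun_prop)]
  have h3 : eLpNorm' S q P = eLpNorm' (√v • fun x : ℝ => x) q (gaussianReal 0 1) := by
    simp only [eLpNorm', h2]; rfl
  rw [h3, eLpNorm'_const_smul _ hq, mul_comm, gaussMoment,
    Real.enorm_of_nonneg (Real.sqrt_nonneg _)]

theorem IsWhiteNoise.integral_sub_sq (hW : IsWhiteNoise ν W P) {f g : E → ℝ} (hf : MemLp f 2 ν)
    (hg : MemLp g 2 ν) : ∫ ω, (W f ω - W g ω) ^ 2 ∂P = ∫ z, (f z - g z) ^ 2 ∂ν := by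
  rw [SpatialLift.integral_sub_sq (hW.memLp (mem_noiseSpan hf)) (hW.memLp (mem_noiseSpan hg)),
    SpatialLift.integral_sub_sq hf hg, hW.covariance f f hf hf, hW.covariance g g hg hg,
    hW.covariance f g hf hg]

/-- The class of `S` in `L²(P)` (zero if `S` is not square-integrable). -/
def toL2 (P : Measure Ω) (S : Ω → ℝ) : Lp ℝ 2 P :=
  open Classical in if h : MemLp S 2 P then h.toLp S else 0

theorem toL2_of_memLp {S : Ω → ℝ} (h : MemLp S 2 P) : toL2 P S = h.toLp S := by
  simp [toL2, h]

theorem toL2_sub {S R : Ω → ℝ} (hS : MemLp S 2 P) (hR : MemLp R 2 P) :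
    toL2 P (fun ω => S ω - R ω) = toL2 P S - toL2 P R := by
  rw [toL2_of_memLp hS, toL2_of_memLp hR, ← MemLp.toLp_sub hS hR, ← toL2_of_memLp]; rfl

theorem toL2_add {S R : Ω → ℝ} (hS : MemLp S 2 P) (hR : MemLp R 2 P) :
    toL2 P (fun ω => S ω + R ω) = toL2 P S + toL2 P R := by
  rw [toL2_of_memLp hS, toL2_of_memLp hR, ← MemLp.toLp_add hS hR, ← toL2_of_memLp]; rfl

theorem toL2_smul {S : Ω → ℝ} (hS : MemLp S 2 P) (a : ℝ) :
    toL2 P (fun ω => a • S ω) = a • toL2 P S := by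
  rw [toL2_of_memLp hS, ← MemLp.toLp_const_smul, ← toL2_of_memLp]; rfl

theorem norm_toL2 {S : Ω → ℝ} (hS : MemLp S 2 P) : ‖toL2 P S‖ = √(∫ ω, S ω ^ 2 ∂P) := by
  rw [toL2_of_memLp hS, Lp.norm_toLp, hS.eLpNorm_eq_integral_rpow_norm two_ne_zero (by simp),
    ENNReal.toReal_ofReal (by positivity), Real.sqrt_eq_rpow]
  simp

/-- Interpolation is linear in the values, so the deterministic estimates can be applied to the
L²(P)-valued path x ↦ X x. -/
theorem poly_toL2 {X : ℝ → Ω → ℝ} (hX : ∀ x, MemLp (X x) 2 P) (k : ℕ) (u : ℝ) :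
    poly k (fun x => toL2 P (X x)) u = toL2 P (fun ω => poly k (fun x => X x ω) u) := by
  have hs := fun a b => toL2_smul (S := fun ω => X a ω - X b ω) ((hX a).sub (hX b))
  have hm : ∀ a b (θ : ℝ), MemLp (fun ω => θ • (X a ω - X b ω)) 2 P := fun a b θ =>
    ((hX a).sub (hX b)).const_smul θ
  unfold poly
  rw [toL2_add (hX _) (hm _ _ _), hs, toL2_sub (hX _) (hX _)]

theorem memLp_poly {X : ℝ → Ω → ℝ} (hX : ∀ x, MemLp (X x) 2 P) (k : ℕ) (u : ℝ) :
    MemLp (fun ω => poly k (fun x => X x ω) u) 2 P := by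
  have hm : ∀ a b (θ : ℝ), MemLp (fun ω => θ • (X a ω - X b ω)) 2 P := fun a b θ =>
    ((hX a).sub (hX b)).const_smul θ
  exact (hX _).add (hm _ _ _)

omit [MeasurableSpace Ω] in
theorem poly_mem {X : ℝ → Ω → ℝ} {M : Submodule ℝ (Ω → ℝ)} (hX : ∀ x, X x ∈ M) (k : ℕ) (u : ℝ) :
    (fun ω => poly k (fun x => X x ω) u) ∈ M :=
  M.add_mem (hX _) (M.smul_mem _ (M.sub_mem (hX _) (hX _)))

end WhiteNoise

/-! ### Regularity of the interpolated stochastic convolution in `L²` -/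

section HeatField

variable {Ω : Type*} [MeasurableSpace Ω] {W : (ℝ × ℝ → ℝ) → Ω → ℝ} {P : Measure Ω} {T : ℝ}

/-- The stochastic convolution. -/
def heatField (W : (ℝ × ℝ → ℝ) → Ω → ℝ) (t x : ℝ) (ω : Ω) : ℝ := W (mildKernel t x) ω

omit [MeasurableSpace Ω] in
theorem heatField_mem {t : ℝ} (ht : t ∈ Icc 0 T) (x : ℝ) :
    heatField W t x ∈ noiseSpan (spaceTimeMeasure T) W := mem_noiseSpan (memLp_mildKernel ht x)

variable (hW : IsWhiteNoise (spaceTimeMeasure T) W P)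
include hW

theorem norm_toL2_heatField_sub {t : ℝ} (ht : t ∈ Icc 0 T) {x y : ℝ} (hx : x ∈ Icc (0 : ℝ) 1)
    (hy : y ∈ Icc (0 : ℝ) 1) :
    ‖toL2 P (heatField W t x) - toL2 P (heatField W t y)‖ ≤ 2 * √|x - y| := by
  have h1 := hW.memLp (heatField_mem ht x)
  have h2 := hW.memLp (heatField_mem ht y)
  rw [← toL2_sub h1 h2, norm_toL2 (by exact h1.sub h2)]
  simp only [heatField]
  rw [hW.integral_sub_sq (memLp_mildKernel ht x) (memLp_mildKernel ht y),
    Real.sqrt_le_left (by positivity), mul_pow, Real.sq_sqrt (abs_nonneg _)]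
  have h3 : |x - y| ≤ 1 := by rw [abs_le]; constructor <;> linarith [hx.1, hx.2, hy.1, hy.2]
  linarith [integral_mildKernel_sub_space ht h3, abs_nonneg (x - y)]

theorem rms_poly_sub_le {t : ℝ} (ht : t ∈ Icc 0 T) (k : ℕ) {x y : ℝ} (hx : x ∈ Icc (0 : ℝ) 1)
    (hy : y ∈ Icc (0 : ℝ) 1) :
    √(∫ ω, (poly k (fun z => heatField W t z ω) y - poly k (fun z => heatField W t z ω) x) ^ 2 ∂P)
      ≤ 6 * √|y - x| := by
  have h := fun z => hW.memLp (heatField_mem ht z)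
  rw [← norm_toL2 (by exact (memLp_poly h k y).sub (memLp_poly h k x)), toL2_sub (memLp_poly h k y)
    (memLp_poly h k x), ← poly_toL2 h, ← poly_toL2 h]
  refine (norm_poly_sub_poly_le_of_holder (C := 2) (by norm_num)
    (fun u hu v hv => norm_toL2_heatField_sub hW ht hu hv) k hy hx).trans (le_of_eq (by ring))

/-- Both interpolations are within 2·2^{-k/2} of the field itself. -/
theorem rms_poly_succ_sub_le {t : ℝ} (ht : t ∈ Icc 0 T) (k : ℕ) {x : ℝ} (hx : x ∈ Icc (0 : ℝ) 1) :
    √(∫ ω, (poly (k + 1) (fun z => heatField W t z ω) x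
      - poly k (fun z => heatField W t z ω) x) ^ 2 ∂P) ≤ 4 * √((2 : ℝ) ^ k)⁻¹ := by
  have h := fun z => hW.memLp (heatField_mem ht z)
  rw [← norm_toL2 (by exact (memLp_poly h (k + 1) x).sub (memLp_poly h k x)), toL2_sub
    (memLp_poly h (k + 1) x) (memLp_poly h k x), ← poly_toL2 h, ← poly_toL2 h]
  have key : ∀ l : ℕ, k ≤ l → ‖poly l (fun z => toL2 P (heatField W t z)) x
      - toL2 P (heatField W t x)‖ ≤ 2 * √((2 : ℝ) ^ k)⁻¹ := fun l hl => by
    refine norm_poly_sub_self_le (f := fun z => toL2 P (heatField W t z)) hx fun z hz hzx => ?_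
    refine (norm_toL2_heatField_sub hW ht hz hx).trans ?_
    refine mul_le_mul_of_nonneg_left (Real.sqrt_le_sqrt (hzx.trans ?_)) (by norm_num)
    exact inv_anti₀ (by positivity) (pow_le_pow_right₀ (by norm_num) hl)
  have h1 := key (k + 1) (by omega)
  have h2 := key k le_rfl
  rw [← sub_sub_sub_cancel_right _ _ (toL2 P (heatField W t x))]
  refine (norm_sub_le _ _).trans ?_
  linarith

omit hW in
-- Interpolation does not increase the sup norm, and the increment in time of the interpolation is
-- the interpolation of the increment. The double root is the exponent 1/4.
theorem exists_rms_poly_time_le (T : ℝ) : ∃ C, 0 ≤ C ∧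
    ∀ {Ω : Type _} [MeasurableSpace Ω] {W : (ℝ × ℝ → ℝ) → Ω → ℝ} {P : Measure Ω},
    IsWhiteNoise (spaceTimeMeasure T) W P → ∀ s ∈ Icc 0 T, ∀ t ∈ Icc 0 T, ∀ k : ℕ,
    ∀ x ∈ Icc (0 : ℝ) 1, √(∫ ω, (poly k (fun z => heatField W t z ω) x
      - poly k (fun z => heatField W s z ω) x) ^ 2 ∂P) ≤ C * √√|t - s| := by
  obtain ⟨C, hC, hle⟩ := exists_integral_mildKernel_sub_time T
  refine ⟨√C, Real.sqrt_nonneg _, fun {Ω _ W P} hW s hs t ht k x hx => ?_⟩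
  have h := fun z => hW.memLp (heatField_mem ht z)
  have h' := fun z => hW.memLp (heatField_mem hs z)
  rw [← norm_toL2 (by exact (memLp_poly h k x).sub (memLp_poly h' k x)), toL2_sub
    (memLp_poly h k x) (memLp_poly h' k x), ← poly_toL2 h, ← poly_toL2 h', ← poly_sub]
  refine norm_poly_le (f := fun z => toL2 P (heatField W t z) - toL2 P (heatField W s z))
    (fun z _ => ?_) hx
  rw [← toL2_sub (h z) (h' z), norm_toL2 (by exact (h z).sub (h' z)), ← Real.sqrt_mul hC]
  simp only [heatField]
  rw [hW.integral_sub_sq (memLp_mildKernel ht z) (memLp_mildKernel hs z)]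
  exact Real.sqrt_le_sqrt (hle s hs t ht z)

/-! ### Stochastic integrals of deterministic functions -/

omit [MeasurableSpace Ω] hW in
theorem heatField_incr_mem {t : ℝ} (ht : t ∈ Icc 0 T) (n c : ℕ) :
    (fun ω => dyadicIncr n (fun x => heatField W t x ω) c) ∈ noiseSpan (spaceTimeMeasure T) W :=
  Submodule.sub_mem _ (heatField_mem ht _) (heatField_mem ht _)

theorem integral_incr_mul {t : ℝ} (ht : t ∈ Icc 0 T) (a b c d : ℝ) :
    ∫ ω, (heatField W t a ω - heatField W t b ω) * (heatField W t c ω - heatField W t d ω) ∂P =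
      circleGreen (2 * t) (a - c) - circleGreen (2 * t) (a - d)
        - circleGreen (2 * t) (b - c) + circleGreen (2 * t) (b - d) := by
  have hi : ∀ x y, Integrable (fun ω => heatField W t x ω * heatField W t y ω) P := fun x y =>
    (hW.memLp (heatField_mem ht x)).integrable_mul (hW.memLp (heatField_mem ht y))
  have he : ∀ x y, ∫ ω, heatField W t x ω * heatField W t y ω ∂P = circleGreen (2 * t) (x - y) :=
    fun x y => by
      simp only [heatField]
      rw [hW.covariance _ _ (memLp_mildKernel ht x) (memLp_mildKernel ht y),
        integral_mildKernel_mul_self_time ht]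
  simp only [← he]
  rw [← integral_sub (hi _ _) (hi _ _), ← integral_sub (by exact (hi _ _).sub (hi _ _)) (hi _ _),
    ← integral_add (by exact ((hi _ _).sub (hi _ _)).sub (hi _ _)) (hi _ _)]
  congr 1; ext ω; ring

/-- This covariance is minus a second difference of the Green function with centre (c-c')/2^n and
step 2^{-n}. All three lags lie in [0,1], where that function is convex. -/
theorem incr_covariance_nonpos {t : ℝ} (ht : t ∈ Icc 0 T) {n c c' : ℕ} (hc : c < 2 ^ n)
    (hc' : c' < 2 ^ n) (hne : c ≠ c') :
    ∫ ω, dyadicIncr n (fun x => heatField W t x ω) c *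
      dyadicIncr n (fun x => heatField W t x ω) c' ∂P ≤ 0 := by
  wlog hlt : c' < c generalizing c c'
  · simp only [mul_comm (dyadicIncr n _ c)]
    exact this hc' hc hne.symm (lt_of_le_of_ne (not_lt.1 hlt) hne)
  simp only [dyadicIncr]
  rw [integral_incr_mul hW ht]
  rcases ht.1.eq_or_lt with h0 | h0
  · simp [← h0, circleGreen_zero_left]
  have hp : (0 : ℝ) < 2 ^ n := by positivity
  have h1 : (c' : ℝ) + 1 ≤ c := by exact_mod_cast hlt
  have h2 : (c : ℝ) + 1 ≤ 2 ^ n := by exact_mod_cast hc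
  have h3 : (0 : ℝ) ≤ c' := by positivity
  have h := (convexOn_circleGreen (τ := 2 * t) (by linarith)).2
    (x := ((c : ℝ) + 1) / 2 ^ n - c' / 2 ^ n) (y := c / 2 ^ n - ((c' : ℝ) + 1) / 2 ^ n)
    (by rw [← sub_div]; exact ⟨div_nonneg (by linarith) hp.le, (div_le_one hp).2 (by linarith)⟩)
    (by rw [← sub_div]; exact ⟨div_nonneg (by linarith) hp.le, (div_le_one hp).2 (by linarith)⟩)
    (by norm_num : (0 : ℝ) ≤ 1 / 2) (by norm_num : (0 : ℝ) ≤ 1 / 2) (by norm_num)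
  simp only [smul_eq_mul] at h
  rw [show 1 / 2 * (((c : ℝ) + 1) / 2 ^ n - c' / 2 ^ n) +
    1 / 2 * ((c : ℝ) / 2 ^ n - (c' + 1) / 2 ^ n) = c / 2 ^ n - c' / 2 ^ n by ring] at h
  rw [show ((c : ℝ) + 1) / 2 ^ n - (c' + 1) / 2 ^ n = c / 2 ^ n - c' / 2 ^ n by ring]
  linarith

/-- The increments over the whole circle add up to zero, so every row of the covariance matrix sums
to zero. Its off-diagonal entries are non-positive, hence the absolute row sum is twice the diagonal
entry, a variance of at most 2·2^{-n}. -/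
theorem sum_abs_incr_covariance_le {t : ℝ} (ht : t ∈ Icc 0 T) {n c : ℕ} (hc : c < 2 ^ n) :
    ∑ c' ∈ Finset.range (2 ^ n), |∫ ω, dyadicIncr n (fun x => heatField W t x ω) c *
      dyadicIncr n (fun x => heatField W t x ω) c' ∂P| ≤ 4 * ((2 : ℝ) ^ n)⁻¹ := by
  set R : ℕ → ℝ := fun c' => ∫ ω, dyadicIncr n (fun x => heatField W t x ω) c *
      dyadicIncr n (fun x => heatField W t x ω) c' ∂P with hR
  have hmem := fun c => hW.memLp (heatField_incr_mem ht n c)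
  have hsum : ∑ c' ∈ Finset.range (2 ^ n), R c' = 0 := by
    rw [hR, ← integral_finsetSum _ fun c' _ => by exact (hmem c).integrable_mul (hmem c')]
    simp_rw [← Finset.mul_sum]
    have : ∀ ω, ∑ c' ∈ Finset.range (2 ^ n), dyadicIncr n (fun x => heatField W t x ω) c' = 0 := by
      intro ω
      have := Finset.sum_range_sub (fun c : ℕ => heatField W t (c / 2 ^ n) ω) (2 ^ n)
      push_cast at this
      simp only [dyadicIncr]
      rw [this, div_self (by positivity), zero_div]
      -- Periodicity holds for every ω, not only almost surely: the kernels at 0 and 1 are the same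
      -- function, so the noise is evaluated at the same index.
      have := mildKernel_add_one t 0
      rw [zero_add] at this
      simp [heatField, this]
    simp [this]
  have hdiag : R c ≤ 2 * ((2 : ℝ) ^ n)⁻¹ := by
    have h1 : R c = ∫ ω, (heatField W t ((c + 1) / 2 ^ n) ω - heatField W t (c / 2 ^ n) ω) ^ 2 ∂P :=
      by simp only [hR, dyadicIncr, pow_two]
    have h3 : |((c : ℝ) + 1) / 2 ^ n - c / 2 ^ n| = ((2 : ℝ) ^ n)⁻¹ := by
      rw [← sub_div, add_sub_cancel_left, one_div, abs_of_pos (by positivity)]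
    simp only [heatField] at h1
    rw [h1, hW.integral_sub_sq (memLp_mildKernel ht _) (memLp_mildKernel ht _), ← h3]
    refine integral_mildKernel_sub_space ht ?_
    rw [h3]
    exact inv_le_one_of_one_le₀ (one_le_pow₀ (by norm_num))
  have hdiag0 : 0 ≤ R c := integral_nonneg fun ω => mul_self_nonneg _
  have hc' := Finset.mem_range.2 hc
  rw [← Finset.add_sum_erase _ _ hc'] at hsum
  rw [← Finset.add_sum_erase _ _ hc', abs_of_nonneg hdiag0]
  have : ∑ c' ∈ (Finset.range (2 ^ n)).erase c, |R c'| =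
      - ∑ c' ∈ (Finset.range (2 ^ n)).erase c, R c' := by
    rw [← Finset.sum_neg_distrib]
    refine Finset.sum_congr rfl fun c' h => abs_of_nonpos ?_
    exact incr_covariance_nonpos hW ht hc (Finset.mem_range.1 (Finset.mem_of_mem_erase h))
      (Finset.ne_of_mem_erase h).symm
  rw [this]
  linarith

/-- Schur test: bound each product a_c a_{c'} by the half-sum of squares, and use the bound on
absolute row sums together with symmetry. -/
theorem integral_sum_incr_sq_le {t : ℝ} (ht : t ∈ Icc 0 T) (n : ℕ) (a : ℕ → ℝ) :
    ∫ ω, (∑ c ∈ Finset.range (2 ^ n), a c * dyadicIncr n (fun x => heatField W t x ω) c) ^ 2 ∂P ≤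
      4 * ((2 : ℝ) ^ n)⁻¹ * ∑ c ∈ Finset.range (2 ^ n), a c ^ 2 := by
  set q : ℕ → Ω → ℝ := fun c ω => dyadicIncr n (fun x => heatField W t x ω) c with hq
  have hmem : ∀ c, MemLp (q c) 2 P := fun c => hW.memLp (heatField_incr_mem ht n c)
  set R : ℕ → ℕ → ℝ := fun c c' => ∫ ω, q c ω * q c' ω ∂P with hR
  have hint : ∀ c c', Integrable (fun ω => a c * a c' * (q c ω * q c' ω)) P := fun c c' =>
    ((hmem c).integrable_mul (hmem c')).const_mul _
  have h1 : ∫ ω, (∑ c ∈ Finset.range (2 ^ n), a c * q c ω) ^ 2 ∂P =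
      ∑ c ∈ Finset.range (2 ^ n), ∑ c' ∈ Finset.range (2 ^ n), a c * a c' * R c c' := by
    have : ∀ ω, (∑ c ∈ Finset.range (2 ^ n), a c * q c ω) ^ 2 = ∑ c ∈ Finset.range (2 ^ n),
        ∑ c' ∈ Finset.range (2 ^ n), a c * a c' * (q c ω * q c' ω) := by
      intro ω
      rw [pow_two, Finset.sum_mul_sum]
      refine Finset.sum_congr rfl fun c _ => Finset.sum_congr rfl fun c' _ => by ring
    simp_rw [this]
    rw [integral_finsetSum _ fun c _ => integrable_finsetSum _ fun c' _ => hint c c']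
    refine Finset.sum_congr rfl fun c _ => ?_
    rw [integral_finsetSum _ fun c' _ => hint c c']
    refine Finset.sum_congr rfl fun c' _ => ?_
    rw [integral_const_mul]
  have hsymm : ∀ c c', |R c c'| = |R c' c| := fun c c' => by simp only [hR, mul_comm]
  have h2 : ∀ c c', a c * a c' * R c c' ≤ (a c ^ 2 * |R c c'| + a c' ^ 2 * |R c' c|) / 2 := by
    intro c c'
    rw [hsymm c' c, ← add_mul]
    have h3 : a c * a c' * R c c' ≤ |a c * a c'| * |R c c'| := by
      rw [← abs_mul]; exact le_abs_self _
    have h4 : |a c * a c'| ≤ (a c ^ 2 + a c' ^ 2) / 2 := by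
      rw [abs_le]; constructor <;> nlinarith [sq_nonneg (a c + a c'), sq_nonneg (a c - a c')]
    nlinarith [abs_nonneg (R c c')]
  rw [h1]
  calc _ ≤ ∑ c ∈ Finset.range (2 ^ n), ∑ c' ∈ Finset.range (2 ^ n),
        (a c ^ 2 * |R c c'| + a c' ^ 2 * |R c' c|) / 2 :=
        Finset.sum_le_sum fun c _ => Finset.sum_le_sum fun c' _ => h2 c c'
    _ = ∑ c ∈ Finset.range (2 ^ n), a c ^ 2 * ∑ c' ∈ Finset.range (2 ^ n), |R c c'| := by
        simp_rw [← Finset.sum_div, Finset.sum_add_distrib]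
        rw [Finset.sum_comm (f := fun c c' => a c' ^ 2 * |R c' c|)]
        simp_rw [Finset.mul_sum]
        ring
    _ ≤ ∑ c ∈ Finset.range (2 ^ n), a c ^ 2 * (4 * ((2 : ℝ) ^ n)⁻¹) :=
        Finset.sum_le_sum fun c hc => mul_le_mul_of_nonneg_left
          (sum_abs_incr_covariance_le hW ht (Finset.mem_range.1 hc)) (sq_nonneg _)
    _ = _ := by rw [← Finset.sum_mul, mul_comm]

end HeatField

/-! ### Integrals against the dyadic slopes -/

/-- The indicator function of the `c`-th dyadic interval of level `n`. -/
def cell (n c : ℕ) (u : ℝ) : ℝ := if ⌊u * 2 ^ n⌋ = (c : ℤ) then 1 else 0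

/-- The coefficient of the `c`-th dyadic increment in the integral of `φ` over `[x,y]` against
the dyadic slopes. -/
def cellCoeff (n : ℕ) (φ : ℝ → ℝ) (x y : ℝ) (c : ℕ) : ℝ :=
  ∫ u in x..y, φ u * (2 ^ n * cell n c u)

theorem measurable_cell (n c : ℕ) : Measurable (cell n c) := by
  have h : Measurable fun u : ℝ => ⌊u * 2 ^ n⌋ := Int.measurable_floor.comp (measurable_id.mul_const _)
  exact Measurable.ite (h (measurableSet_singleton _)) measurable_const measurable_const

theorem cell_nonneg (n c : ℕ) (u : ℝ) : 0 ≤ cell n c u := by unfold cell; positivity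

theorem cell_le_one (n c : ℕ) (u : ℝ) : cell n c u ≤ 1 := by
  unfold cell; split_ifs <;> norm_num

theorem intervalIntegrable_cell (n c : ℕ) (x y : ℝ) : IntervalIntegrable (cell n c) volume x y := by
  refine (intervalIntegrable_const (c := (1 : ℝ))).mono_fun
    (measurable_cell n c).aestronglyMeasurable (Eventually.of_forall fun u => ?_)
  simpa [abs_of_nonneg (cell_nonneg n c u)] using cell_le_one n c u

theorem integral_cell_le (n c : ℕ) {x y : ℝ} (hxy : x ≤ y) :
    ∫ u in x..y, cell n c u ≤ ((2 : ℝ) ^ n)⁻¹ := by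
  have hp : (0 : ℝ) < 2 ^ n := by positivity
  have hs : MeasurableSet (Ico ((c : ℝ) / 2 ^ n) ((c + 1) / 2 ^ n)) := measurableSet_Ico
  have h : cell n c = (Ico ((c : ℝ) / 2 ^ n) ((c + 1) / 2 ^ n)).indicator 1 := by
    ext u
    have : ⌊u * 2 ^ n⌋ = (c : ℤ) ↔ u ∈ Ico ((c : ℝ) / 2 ^ n) ((c + 1) / 2 ^ n) := by
      rw [Int.floor_eq_iff, mem_Ico, div_le_iff₀ hp, lt_div_iff₀ hp]; rfl
    by_cases hu : u ∈ Ico ((c : ℝ) / 2 ^ n) ((c + 1) / 2 ^ n)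
    · rw [indicator_of_mem hu, cell, if_pos (this.2 hu)]; rfl
    · rw [indicator_of_notMem hu, cell, if_neg (fun h => hu (this.1 h))]
  rw [intervalIntegral.integral_of_le hxy, h, integral_indicator_one hs, measureReal_restrict_apply hs]
  refine (measureReal_mono inter_subset_left (by simp)).trans ?_
  rw [Real.volume_real_Ico_of_le (by gcongr; linarith)]
  rw [← sub_div, add_sub_cancel_left, one_div]

section

variable {n : ℕ} {φ : ℝ → ℝ} {x y : ℝ} (hφ : ContinuousOn φ (Icc x y)) (hx : 0 ≤ x) (hxy : x ≤ y)
  (hy : y ≤ 1)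
include hφ hx hxy hy

theorem integral_mul_polySlope (f : ℝ → ℝ) :
    ∫ u in x..y, φ u * polySlope n f u =
      ∑ c ∈ Finset.range (2 ^ n), cellCoeff n φ x y c * dyadicIncr n f c := by
  have hint : ∀ c, IntervalIntegrable (fun u => φ u * (2 ^ n * cell n c u) * dyadicIncr n f c)
      volume x y := fun c => (((intervalIntegrable_cell n c x y).const_mul _).continuousOn_mul
        (by rwa [uIcc_of_le hxy])).mul_const _
  simp only [cellCoeff]
  simp_rw [← intervalIntegral.integral_mul_const]
  rw [← intervalIntegral.integral_finsetSum fun c _ => hint c]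
  refine intervalIntegral.integral_congr_ae ?_
  filter_upwards [ae_mem_Ico hx hxy hy] with u hu h
  obtain ⟨c, hc, hf⟩ := floor_eq_natCast (k := n) (hu h)
  rw [Finset.sum_eq_single c]
  · simp [cell, hf, polySlope, dyadicIncr]; ring
  · intro c' _ hc'
    have : ¬ (c : ℤ) = c' := by exact_mod_cast hc'.symm
    simp [cell, hf, this]
  · intro h; exact absurd (Finset.mem_range.2 hc) h

omit hx hy in
-- A Bessel inequality, cell by cell: the integral of (φ - a)² over the cell is non-negative, where
-- `a` is the coefficient. Only the upper bound 2^{-n} on the length is used, so cells cut by `x` or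
-- `y` need no separate treatment.
theorem sum_cellCoeff_sq_le : ((2 : ℝ) ^ n)⁻¹ *
    ∑ c ∈ Finset.range (2 ^ n), cellCoeff n φ x y c ^ 2 ≤ ∫ u in x..y, φ u ^ 2 := by
  have hp : (0 : ℝ) < 2 ^ n := by positivity
  have hφ' : ContinuousOn φ (uIcc x y) := by rwa [uIcc_of_le hxy]
  have hφ2 : ContinuousOn (fun u => φ u ^ 2) (uIcc x y) := hφ'.pow 2
  have hi := fun c => intervalIntegrable_cell n c x y
  have h1 : ∀ c, ((2 : ℝ) ^ n)⁻¹ * cellCoeff n φ x y c ^ 2 ≤ ∫ u in x..y, φ u ^ 2 * cell n c u := by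
    intro c
    set a := cellCoeff n φ x y c with ha
    have h2 : ∫ u in x..y, φ u * cell n c u = ((2 : ℝ) ^ n)⁻¹ * a := by
      rw [ha, cellCoeff, ← intervalIntegral.integral_const_mul]
      congr 1; ext u; field_simp
    have h3 : ∫ u in x..y, (φ u - a) ^ 2 * cell n c u = (∫ u in x..y, φ u ^ 2 * cell n c u)
        - 2 * a * (((2 : ℝ) ^ n)⁻¹ * a) + a ^ 2 * ∫ u in x..y, cell n c u := by
      rw [← h2, ← intervalIntegral.integral_const_mul, ← intervalIntegral.integral_const_mul,
        ← intervalIntegral.integral_sub ((hi c).continuousOn_mul hφ2)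
          (((hi c).continuousOn_mul hφ').const_mul _),
        ← intervalIntegral.integral_add (((hi c).continuousOn_mul hφ2).sub
          (((hi c).continuousOn_mul hφ').const_mul _)) ((hi c).const_mul _)]
      congr 1; ext u; ring
    have h4 : 0 ≤ ∫ u in x..y, (φ u - a) ^ 2 * cell n c u :=
      intervalIntegral.integral_nonneg hxy fun u _ => mul_nonneg (sq_nonneg _) (cell_nonneg _ _ _)
    nlinarith [mul_le_mul_of_nonneg_left (integral_cell_le n c hxy) (sq_nonneg a)]
  rw [Finset.mul_sum]
  refine (Finset.sum_le_sum fun c _ => h1 c).trans ?_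
  rw [← intervalIntegral.integral_finsetSum fun c _ => (hi c).continuousOn_mul hφ2]
  refine intervalIntegral.integral_mono_ae_restrict hxy ?_ (hφ2.intervalIntegrable)
    (Eventually.of_forall fun u => ?_)
  · have := IntervalIntegrable.sum (Finset.range (2 ^ n)) fun c _ =>
      (hi c).continuousOn_mul hφ2
    simpa only [Finset.sum_fn] using this
  · simp only
    rw [← Finset.mul_sum]
    refine mul_le_of_le_one_right (sq_nonneg _) ?_
    by_cases h : ∃ c : ℕ, ⌊u * 2 ^ n⌋ = (c : ℤ)
    · obtain ⟨c, hc⟩ := h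
      have : ∀ c', cell n c' u = if c = c' then 1 else 0 := by
        intro c'; simp [cell, hc]
      simp only [this, Finset.sum_ite_eq]
      split_ifs <;> norm_num
    · have : ∀ c', cell n c' u = 0 := fun c' => if_neg fun h' => h ⟨c', h'⟩
      simp [this]

omit hx hy in
-- A substitute for the Itô isometry with constant 2, uniform in the level `n`: the factor 2^{-n} of
-- the covariance bound is absorbed by the Bessel inequality.
theorem eLpNorm'_integral_polySlope_le {Ω : Type*} [MeasurableSpace Ω] {W : (ℝ × ℝ → ℝ) → Ω → ℝ}
    {P : Measure Ω} {T : ℝ} (hW : IsWhiteNoise (spaceTimeMeasure T) W P) {t : ℝ} (ht : t ∈ Icc 0 T)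
    {r : ℝ} (hr : 0 < r) :
    eLpNorm' (fun ω => ∑ c ∈ Finset.range (2 ^ n), cellCoeff n φ x y c *
      dyadicIncr n (fun z => heatField W t z ω) c) r P ≤
      gaussMoment r * ENNReal.ofReal (2 * √(∫ u in x..y, φ u ^ 2)) := by
  have hmem : (fun ω => ∑ c ∈ Finset.range (2 ^ n), cellCoeff n φ x y c *
      dyadicIncr n (fun z => heatField W t z ω) c) ∈ noiseSpan (spaceTimeMeasure T) W := by
    have := Submodule.sum_mem (noiseSpan (spaceTimeMeasure T) W) (t := Finset.range (2 ^ n))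
      (f := fun c => cellCoeff n φ x y c • fun ω => dyadicIncr n (fun z => heatField W t z ω) c)
      fun c _ => Submodule.smul_mem _ _ (heatField_incr_mem ht n c)
    convert this using 1
    ext ω; simp
  rw [hW.eLpNorm'_eq hmem hr]
  gcongr
  rw [Real.sqrt_le_left (by positivity), mul_pow, Real.sq_sqrt
    (intervalIntegral.integral_nonneg hxy fun _ _ => sq_nonneg _)]
  have h1 := integral_sum_incr_sq_le hW ht n (cellCoeff n φ x y)
  have h2 := sum_cellCoeff_sq_le (n := n) hφ hxy
  linarith

end

/-! ### Decoupling -/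

/-- The index set of a white noise on `[0,T] × S¹`. -/
abbrev NoiseIndex (T : ℝ) : Type := {f : ℝ × ℝ → ℝ // MemLp f 2 (spaceTimeMeasure T)}

/-- The white noise as a random function. -/
def noisePath {Ω : Type*} (T : ℝ) (W : (ℝ × ℝ → ℝ) → Ω → ℝ) (ω : Ω) : NoiseIndex T → ℝ :=
  fun f => W f.1 ω

theorem lintegral_of_indepFun {Ω E F : Type*} [MeasurableSpace Ω] [MeasurableSpace E]
    [MeasurableSpace F] {P : Measure Ω} [IsProbabilityMeasure P] {X : Ω → E} {Y : Ω → F}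
    (hX : Measurable X) (hY : Measurable Y) (h : IndepFun X Y P) {g : E × F → ℝ≥0∞}
    (hg : Measurable g) : ∫⁻ ω, g (X ω, Y ω) ∂P = ∫⁻ ω, ∫⁻ ω', g (X ω, Y ω') ∂P ∂P := by
  have hY' : IsProbabilityMeasure (P.map Y) := Measure.isProbabilityMeasure_map hY.aemeasurable
  rw [← lintegral_map hg (hX.prodMk hY), (indepFun_iff_map_prod_eq_prod_map_map
    hX.aemeasurable hY.aemeasurable).1 h, lintegral_prod _ hg.aemeasurable,
    lintegral_map hg.lintegral_prod_right' hX]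
  refine lintegral_congr fun ω => ?_
  rw [lintegral_map (by exact hg.comp measurable_prodMk_left) hY]

theorem ofReal_sqrt_integral_sq {φ : ℝ → ℝ} {x y : ℝ} (hφ : ContinuousOn φ (Icc x y))
    (hxy : x ≤ y) : ENNReal.ofReal √(∫ u in x..y, φ u ^ 2) =
      eLpNorm' φ 2 (volume.restrict (Ioc x y)) := by
  have hi : IntegrableOn (fun u => φ u ^ 2) (Ioc x y) :=
    ((hφ.pow 2).integrableOn_Icc).mono_set Ioc_subset_Icc_self
  rw [Real.sqrt_eq_rpow, ← ENNReal.ofReal_rpow_of_nonneg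
    (intervalIntegral.integral_nonneg hxy fun _ _ => sq_nonneg _) (by norm_num),
    intervalIntegral.integral_of_le hxy, ofReal_integral_eq_lintegral_ofReal hi
    (Eventually.of_forall fun _ => sq_nonneg _), eLpNorm']
  congr 1
  refine lintegral_congr fun u => ?_
  rw [← sq_abs, ENNReal.ofReal_pow (abs_nonneg _), ← Real.enorm_eq_ofReal_abs]
  norm_cast

section

variable {Ω : Type*} [MeasurableSpace Ω] {P : Measure Ω} [IsProbabilityMeasure P] {T : ℝ}
  {W₁ W₂ : (ℝ × ℝ → ℝ) → Ω → ℝ}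

omit [IsProbabilityMeasure P] in
theorem IsWhiteNoise.measurable_noisePath {W : (ℝ × ℝ → ℝ) → Ω → ℝ}
    (hW : IsWhiteNoise (spaceTimeMeasure T) W P) : Measurable (noisePath T W) :=
  measurable_pi_iff.2 fun f => hW.measurable f.1 f.2

/-- Conditionally on the first noise the integral is a Gaussian functional of the second with
deterministic integrand, so its L^r norm is controlled by the L² norm in `u` of the integrand. The
integrand is given as a function of the path of the first noise so that it can be frozen. -/
theorem eLpNorm'_cross_le (hW₁ : IsWhiteNoise (spaceTimeMeasure T) W₁ P)
    (hW₂ : IsWhiteNoise (spaceTimeMeasure T) W₂ P)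
    (hind : IndepFun (noisePath T W₁) (noisePath T W₂) P)
    {p : (NoiseIndex T → ℝ) → ℝ → ℝ} (hp : Measurable (Function.uncurry p))
    (hpc : ∀ w, ContinuousOn (p w) (Icc 0 1)) {t : ℝ} (ht : t ∈ Icc 0 T) (n : ℕ) {x y : ℝ}
    (hx : 0 ≤ x) (hxy : x ≤ y) (hy : y ≤ 1) {r : ℝ} (hr : 2 ≤ r) {M : ℝ≥0∞}
    (hM : ∀ u ∈ Icc x y, eLpNorm' (fun ω => p (noisePath T W₁ ω) u - p (noisePath T W₁ ω) x) r P
      ≤ M) :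
    eLpNorm' (fun ω => cross (p (noisePath T W₁ ω))
      (polySlope n fun z => heatField W₂ t z ω) x y) r P ≤
      gaussMoment r * 2 * ENNReal.ofReal √(y - x) * M := by
  have hr0 : 0 < r := by linarith
  set V := volume.restrict (Ioc x y) with hV
  have hVu : V univ = ENNReal.ofReal (y - x) := by rw [hV]; simp
  set Φ := noisePath T W₁ with hΦ
  have hΦm : Measurable Φ := hW₁.measurable_noisePath
  set D : (NoiseIndex T → ℝ) → ℝ → ℝ := fun w u => p w u - p w x with hD
  have hpx : Measurable fun w => p w x := hp.comp (measurable_id.prodMk measurable_const)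
  have hDm : Measurable (Function.uncurry D) := hp.sub (hpx.comp measurable_fst)
  have hDc : ∀ w, ContinuousOn (D w) (Icc x y) := fun w =>
    ((hpc w).mono (Icc_subset_Icc hx hy)).sub continuousOn_const
  let Y : (NoiseIndex T → ℝ) → ℝ → ℝ := fun w z => w ⟨mildKernel t z, memLp_mildKernel ht z⟩
  -- Written as a finite sum, the integral is a measurable function on the product of the two noise
  -- spaces, on which the joint law is a product measure.
  let B : (NoiseIndex T → ℝ) × (NoiseIndex T → ℝ) → ℝ := fun w =>
    ∑ c ∈ Finset.range (2 ^ n), cellCoeff n (D w.1) x y c * dyadicIncr n (Y w.2) c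
  have hcoef : ∀ c, Measurable fun w => cellCoeff n (D w) x y c := by
    intro c
    simp only [cellCoeff, intervalIntegral.integral_of_le hxy]
    refine (StronglyMeasurable.integral_prod_right (ν := V) (f := fun w u =>
      D w u * (2 ^ n * cell n c u)) (Measurable.stronglyMeasurable ?_)).measurable
    exact hDm.mul (((measurable_cell n c).comp measurable_snd).const_mul _)
  have hYm : ∀ z, Measurable fun w => Y w z := fun z => measurable_pi_apply _
  have hB : Measurable B := Finset.measurable_sum _ fun c _ =>
    ((hcoef c).comp measurable_fst).mul
      (((hYm _).comp measurable_snd).sub ((hYm _).comp measurable_snd))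
  have hcross : ∀ ω, cross (p (Φ ω)) (polySlope n fun z => heatField W₂ t z ω) x y =
      B (Φ ω, noisePath T W₂ ω) := fun ω =>
    integral_mul_polySlope (hDc (Φ ω)) hx hxy hy (fun z => heatField W₂ t z ω)
  -- The first noise is frozen. Hölder's inequality on (x,y] replaces the L² norm in `u` by the L^r
  -- norm, for which Fubini with P is available; this needs r ≥ 2.
  have hinner : ∀ ω, ∫⁻ ω', ‖B (Φ ω, noisePath T W₂ ω')‖ₑ ^ r ∂P ≤
      (gaussMoment r * 2 * ENNReal.ofReal (y - x) ^ (1 / 2 - 1 / r)) ^ r *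
        ∫⁻ u, ‖D (Φ ω) u‖ₑ ^ r ∂V := by
    intro ω
    have h1 := eLpNorm'_integral_polySlope_le (n := n) (hDc (Φ ω)) hxy hW₂ ht hr0
    have h2 : eLpNorm' (D (Φ ω)) 2 V ≤ eLpNorm' (D (Φ ω)) r V * V univ ^ (1 / 2 - 1 / r) :=
      eLpNorm'_le_eLpNorm'_mul_rpow_measure_univ two_pos hr
        (hDm.comp measurable_prodMk_left).aestronglyMeasurable
    rw [ENNReal.ofReal_mul (by norm_num), ofReal_sqrt_integral_sq (hDc _) hxy] at h1
    have h3 : eLpNorm' (fun ω' => B (Φ ω, noisePath T W₂ ω')) r P ≤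
        gaussMoment r * 2 * ENNReal.ofReal (y - x) ^ (1 / 2 - 1 / r) * eLpNorm' (D (Φ ω)) r V := by
      refine h1.trans ?_
      rw [hVu] at h2
      rw [ENNReal.ofReal_ofNat, mul_assoc, mul_assoc, mul_comm (_ ^ _)]
      gcongr
    have h4 := ENNReal.rpow_le_rpow h3 hr0.le
    rw [ENNReal.mul_rpow_of_nonneg _ _ hr0.le] at h4
    simpa only [eLpNorm', ← ENNReal.rpow_mul, one_div, inv_mul_cancel₀ hr0.ne',
      ENNReal.rpow_one] using h4
  have hswap : ∫⁻ ω, ∫⁻ u, ‖D (Φ ω) u‖ₑ ^ r ∂V ∂P ≤ M ^ r * ENNReal.ofReal (y - x) := by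
    rw [lintegral_lintegral_swap (by
      exact ((hDm.comp ((hΦm.comp measurable_fst).prodMk measurable_snd)).enorm.pow_const
        r).aemeasurable), ← hVu, ← lintegral_const]
    refine lintegral_mono_ae ?_
    rw [hV]
    filter_upwards [ae_restrict_mem measurableSet_Ioc] with u hu
    have h4 := ENNReal.rpow_le_rpow (hM u ⟨hu.1.le, hu.2⟩) hr0.le
    simpa only [eLpNorm', ← ENNReal.rpow_mul, one_div, inv_mul_cancel₀ hr0.ne',
      ENNReal.rpow_one] using h4
  simp only [hcross]
  rw [eLpNorm', lintegral_of_indepFun hΦm hW₂.measurable_noisePath hind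
    (g := fun w => ‖B w‖ₑ ^ r) (hB.enorm.pow_const r), one_div, ENNReal.rpow_inv_le_iff hr0]
  refine (lintegral_mono hinner).trans ?_
  have hDmm : Measurable fun ω => ∫⁻ u, ‖D (Φ ω) u‖ₑ ^ r ∂V :=
    Measurable.lintegral_prod_right' (f := fun q : Ω × ℝ => ‖D (Φ q.1) q.2‖ₑ ^ r)
      ((hDm.comp ((hΦm.comp measurable_fst).prodMk measurable_snd)).enorm.pow_const r)
  rw [lintegral_const_mul _ hDmm]
  refine (mul_le_mul_right hswap _).trans (le_of_eq ?_)
  -- Powers of the length y - x are combined below, which requires it to be non-zero.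
  rcases hxy.eq_or_lt with rfl | hlt
  · simp [hr0]
  have h0 : ENNReal.ofReal (y - x) ≠ 0 := by simpa using hlt
  rw [Real.sqrt_eq_rpow, ← ENNReal.ofReal_rpow_of_nonneg (by linarith) (by norm_num)]
  simp only [ENNReal.mul_rpow_of_nonneg _ _ hr0.le, ← ENNReal.rpow_mul]
  have h5 : ENNReal.ofReal (y - x) ^ (1 / 2 * r) =
      ENNReal.ofReal (y - x) ^ ((1 / 2 - 1 / r) * r) * ENNReal.ofReal (y - x) := by
    nth_rewrite 3 [← ENNReal.rpow_one (ENNReal.ofReal (y - x))]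
    rw [← ENNReal.rpow_add _ _ h0 ENNReal.ofReal_ne_top]
    congr 1; field_simp; ring
  rw [h5]
  ring

end

/-! ### Joint measurability -/

section Measurability

variable {A V : Type*} [MeasurableSpace A]

theorem measurable_comp_floor [MeasurableSpace V] {f : A → ℝ → V} (hf : ∀ z, Measurable fun a => f a z)
    (k : ℕ) (e : ℤ → ℝ) : Measurable fun q : A × ℝ => f q.1 (e ⌊q.2 * 2 ^ k⌋) := by
  have h : Measurable fun q : A × ℤ => f q.1 (e q.2) :=
    measurable_from_prod_countable_left fun n => hf (e n)
  exact h.comp (measurable_fst.prodMk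
    (Int.measurable_floor.comp (measurable_snd.mul_const _)))

theorem measurable_poly [NormedAddCommGroup V] [NormedSpace ℝ V] [MeasurableSpace V] [BorelSpace V]
    [SecondCountableTopology V] {f : A → ℝ → V} (hf : ∀ z, Measurable fun a => f a z)
    (k : ℕ) : Measurable fun q : A × ℝ => poly k (f q.1) q.2 := by
  have h1 := measurable_comp_floor hf k fun n => (n : ℝ) / 2 ^ k
  have h2 := measurable_comp_floor hf k fun n => ((n : ℝ) + 1) / 2 ^ k
  exact h1.add ((measurable_fract.comp (measurable_snd.mul_const _)).smul (h2.sub h1))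

theorem measurable_polySlope_prod [NormedAddCommGroup V] [NormedSpace ℝ V] [MeasurableSpace V]
    [BorelSpace V] [SecondCountableTopology V] {f : A → ℝ → V}
    (hf : ∀ z, Measurable fun a => f a z) (k : ℕ) :
    Measurable fun q : A × ℝ => polySlope k (f q.1) q.2 := by
  have h1 := measurable_comp_floor hf k fun n => (n : ℝ) / 2 ^ k
  have h2 := measurable_comp_floor hf k fun n => ((n : ℝ) + 1) / 2 ^ k
  exact (h2.sub h1).const_smul ((2 : ℝ) ^ k)

theorem measurable_cross {p q' : A → ℝ → ℝ} (hp : Measurable fun q : A × ℝ => p q.1 q.2)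
    (hq : Measurable fun q : A × ℝ => q' q.1 q.2) :
    Measurable fun a : A × ℝ × ℝ => cross (p a.1) (q' a.1) a.2.1 a.2.2 := by
  have h0 : Measurable fun a : (A × ℝ × ℝ) × ℝ =>
      (p a.1.1 a.2 - p a.1.1 a.1.2.1) * q' a.1.1 a.2 := by
    have h1 : Measurable fun a : (A × ℝ × ℝ) × ℝ => (a.1.1, a.2) := by fun_prop
    have h2 : Measurable fun a : (A × ℝ × ℝ) × ℝ => (a.1.1, a.1.2.1) := by fun_prop
    exact ((hp.comp h1).sub (hp.comp h2)).mul (hq.comp h1)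
  have key : ∀ l r : A × ℝ × ℝ → ℝ, Measurable l → Measurable r → Measurable fun a : A × ℝ × ℝ =>
      ∫ u in Ioc (l a) (r a), (p a.1 u - p a.1 a.2.1) * q' a.1 u := by
    intro l r hl hr
    have hs : MeasurableSet {a : (A × ℝ × ℝ) × ℝ | a.2 ∈ Ioc (l a.1) (r a.1)} :=
      (measurableSet_lt (hl.comp measurable_fst) measurable_snd).inter
        (measurableSet_le measurable_snd (hr.comp measurable_fst))
    have h3 := (h0.indicator hs).stronglyMeasurable.integral_prod_right' (ν := volume)
    convert h3.measurable using 1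
    ext a
    rw [← integral_indicator measurableSet_Ioc]
    rfl
  simp only [cross, intervalIntegral]
  exact (key _ _ (by fun_prop) (by fun_prop)).sub (key _ _ (by fun_prop) (by fun_prop))

theorem measurable_area {f g : A → ℝ → ℝ} (hf : ∀ z, Measurable fun a => f a z)
    (hg : ∀ z, Measurable fun a => g a z) (k : ℕ) :
    Measurable fun a : A × ℝ × ℝ => area k (f a.1) (g a.1) a.2.1 a.2.2 :=
  measurable_cross (p := fun a => poly k (f a)) (q' := fun a => polySlope k (g a))
    (measurable_poly hf k) (measurable_polySlope_prod hg k)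

end Measurability

/-! ### Moments of the iterated integrals -/

section eLpNorm'

variable {Ω : Type*} [MeasurableSpace Ω] {P : Measure Ω}

theorem eLpNorm'_sub_le {F : Type*} [NormedAddCommGroup F] {f g : Ω → F} {r : ℝ}
    (hf : AEStronglyMeasurable f P)
    (hg : AEStronglyMeasurable g P) (hr : 1 ≤ r) :
    eLpNorm' (fun ω => f ω - g ω) r P ≤ eLpNorm' f r P + eLpNorm' g r P := by
  have := eLpNorm'_add_le hf hg.neg hr
  rw [eLpNorm'_neg] at this
  simpa only [sub_eq_add_neg] using! this

theorem eLpNorm'_mul_le {f g : Ω → ℝ} {r : ℝ} (hf : AEStronglyMeasurable f P)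
    (hg : AEStronglyMeasurable g P) (hr : 0 < r) :
    eLpNorm' (fun ω => f ω * g ω) r P ≤ eLpNorm' f (2 * r) P * eLpNorm' g (2 * r) P :=
  eLpNorm'_smul_le_mul_eLpNorm' hg hf hr (by linarith) (by field_simp; norm_num)

end eLpNorm'

section Moments

variable {Ω : Type*} [MeasurableSpace Ω] {P : Measure Ω} {T : ℝ}

/-- The dyadic interpolation of the stochastic convolution. -/
def heatPoly (W : (ℝ × ℝ → ℝ) → Ω → ℝ) (a : ℕ × ℝ) (u : ℝ) (ω : Ω) : ℝ :=
  poly a.1 (fun z => heatField W a.2 z ω) u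

/-- The right derivative of the dyadic interpolation of the stochastic convolution. -/
def heatSlope (W : (ℝ × ℝ → ℝ) → Ω → ℝ) (a : ℕ × ℝ) (u : ℝ) (ω : Ω) : ℝ :=
  polySlope a.1 (fun z => heatField W a.2 z ω) u

omit [MeasurableSpace Ω] in
theorem heatPoly_mem {W : (ℝ × ℝ → ℝ) → Ω → ℝ} {a : ℕ × ℝ} (ha : a.2 ∈ Icc 0 T) (u : ℝ) :
    heatPoly W a u ∈ noiseSpan (spaceTimeMeasure T) W :=
  poly_mem (fun z => heatField_mem ha z) a.1 u

theorem IsWhiteNoise.measurable_heatField {W : (ℝ × ℝ → ℝ) → Ω → ℝ} {P : Measure Ω}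
    (hW : IsWhiteNoise (spaceTimeMeasure T) W P) {t : ℝ} (ht : t ∈ Icc 0 T) (z : ℝ) :
    Measurable (heatField W t z) := hW.measurable _ (memLp_mildKernel ht z)

theorem eLpNorm'_le_of_rms_le {W : (ℝ × ℝ → ℝ) → Ω → ℝ}
    (hW : IsWhiteNoise (spaceTimeMeasure T) W P) {S : Ω → ℝ}
    (hS : S ∈ noiseSpan (spaceTimeMeasure T) W) {δ r : ℝ} (hr : 0 < r)
    (h : √(∫ ω, S ω ^ 2 ∂P) ≤ δ) : eLpNorm' S r P ≤ gaussMoment r * ENNReal.ofReal δ := by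
  rw [hW.eLpNorm'_eq hS hr]
  gcongr

theorem measurable_heatPoly {W : (ℝ × ℝ → ℝ) → Ω → ℝ}
    (hW : IsWhiteNoise (spaceTimeMeasure T) W P) {a : ℕ × ℝ} (ha : a.2 ∈ Icc 0 T) :
    Measurable fun q : Ω × ℝ => heatPoly W a q.2 q.1 :=
  measurable_poly (f := fun ω z => heatField W a.2 z ω) (fun z => hW.measurable_heatField ha z) a.1

theorem measurable_heatPoly_left {W : (ℝ × ℝ → ℝ) → Ω → ℝ}
    (hW : IsWhiteNoise (spaceTimeMeasure T) W P) {a : ℕ × ℝ} (ha : a.2 ∈ Icc 0 T) (u : ℝ) :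
    Measurable (heatPoly W a u) := by
  have h1 := (measurable_heatPoly hW ha).comp (measurable_prodMk_right (y := u))
  simp only [Function.comp_def] at h1
  exact h1

theorem measurable_heatSlope {W : (ℝ × ℝ → ℝ) → Ω → ℝ}
    (hW : IsWhiteNoise (spaceTimeMeasure T) W P) {a : ℕ × ℝ} (ha : a.2 ∈ Icc 0 T) :
    Measurable fun q : Ω × ℝ => heatSlope W a q.2 q.1 :=
  measurable_polySlope_prod (f := fun ω z => heatField W a.2 z ω)
    (fun z => hW.measurable_heatField ha z) a.1

theorem eLpNorm'_heatPoly_incr_le [IsProbabilityMeasure P] {W : (ℝ × ℝ → ℝ) → Ω → ℝ}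
    (hW : IsWhiteNoise (spaceTimeMeasure T) W P) {a : ℕ × ℝ} (ha : a.2 ∈ Icc 0 T) {x u y r : ℝ}
    (hr : 0 < r) (hx : 0 ≤ x) (hu : u ∈ Icc x y) (hy : y ≤ 1) :
    eLpNorm' (fun ω => heatPoly W a u ω - heatPoly W a x ω) r P ≤
      gaussMoment r * ENNReal.ofReal (6 * √(y - x)) := by
  refine eLpNorm'_le_of_rms_le hW (Submodule.sub_mem _ (heatPoly_mem ha u) (heatPoly_mem ha x)) hr
    ((rms_poly_sub_le hW ha a.1 ⟨hx, (hu.1.trans hu.2).trans hy⟩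
      ⟨hx.trans hu.1, hu.2.trans hy⟩).trans ?_)
  rw [abs_of_nonneg (sub_nonneg.2 hu.1)]
  gcongr
  exact hu.2

/-- The difference of the interpolations `a` and `b` is at most `δ` in `L²`. -/
def RmsClose (P : Measure Ω) (W : (ℝ × ℝ → ℝ) → Ω → ℝ) (a b : ℕ × ℝ) (δ : ℝ) : Prop :=
  ∀ u ∈ Icc (0 : ℝ) 1, √(∫ ω, (heatPoly W a u ω - heatPoly W b u ω) ^ 2 ∂P) ≤ δ

theorem eLpNorm'_heatPoly_diff_incr_le [IsProbabilityMeasure P] {W : (ℝ × ℝ → ℝ) → Ω → ℝ}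
    (hW : IsWhiteNoise (spaceTimeMeasure T) W P) {a b : ℕ × ℝ} (ha : a.2 ∈ Icc 0 T)
    (hb : b.2 ∈ Icc 0 T) {δ : ℝ} (hδ : RmsClose P W a b δ) {x y r : ℝ}
    (hr : 1 ≤ r) (hx : x ∈ Icc (0 : ℝ) 1) (hy : y ∈ Icc (0 : ℝ) 1) :
    eLpNorm' (fun ω => (heatPoly W a y ω - heatPoly W b y ω)
      - (heatPoly W a x ω - heatPoly W b x ω)) r P ≤
      2 * gaussMoment r * ENNReal.ofReal δ := by
  have h : ∀ u ∈ Icc (0 : ℝ) 1, eLpNorm' (fun ω => heatPoly W a u ω - heatPoly W b u ω) r P ≤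
      gaussMoment r * ENNReal.ofReal δ := fun u hu =>
    eLpNorm'_le_of_rms_le hW (Submodule.sub_mem _ (heatPoly_mem ha u) (heatPoly_mem hb u))
      (by linarith) (hδ u hu)
  have hm : ∀ u, AEStronglyMeasurable (fun ω => heatPoly W a u ω - heatPoly W b u ω) P := fun u =>
    ((measurable_heatPoly_left hW ha u).sub (measurable_heatPoly_left hW hb u)).aestronglyMeasurable
  refine (eLpNorm'_sub_le (hm y) (hm x) hr).trans ((add_le_add (h y hy) (h x hx)).trans ?_)
  rw [two_mul, add_mul]

/-- The second level of the lift of the interpolation `a`. -/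
def heatArea (W₁ W₂ : (ℝ × ℝ → ℝ) → Ω → ℝ) (a : ℕ × ℝ) (x y : ℝ) (ω : Ω) : ℝ :=
  area a.1 (fun z => heatField W₁ a.2 z ω) (fun z => heatField W₂ a.2 z ω) x y

/-- The integrand of `eLpNorm'_cross_le` for the difference of two interpolations. -/
theorem eLpNorm'_cross_heat_le [IsProbabilityMeasure P] {W₁ W₂ : (ℝ × ℝ → ℝ) → Ω → ℝ}
    (hW₁ : IsWhiteNoise (spaceTimeMeasure T) W₁ P) (hW₂ : IsWhiteNoise (spaceTimeMeasure T) W₂ P)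
    (hind : IndepFun (noisePath T W₁) (noisePath T W₂) P)
    {a b c : ℕ × ℝ} (ha : a.2 ∈ Icc 0 T) (hb : b.2 ∈ Icc 0 T) (hc : c.2 ∈ Icc 0 T)
    {δ : ℝ} (hδ : RmsClose P W₁ a b δ) {x y r : ℝ} (hx : 0 ≤ x) (hxy : x ≤ y) (hy : y ≤ 1)
    (hr : 2 ≤ r) :
    eLpNorm' (fun ω => cross (fun u => heatPoly W₁ a u ω - heatPoly W₁ b u ω)
      (fun u => heatSlope W₂ c u ω) x y) r P ≤
      4 * gaussMoment r ^ 2 * ENNReal.ofReal √(y - x) * ENNReal.ofReal δ := by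
  let Y : ∀ t ∈ Icc 0 T, (NoiseIndex T → ℝ) → ℝ → ℝ := fun t ht w z =>
    w ⟨mildKernel t z, memLp_mildKernel ht z⟩
  let p : (NoiseIndex T → ℝ) → ℝ → ℝ := fun w u =>
    poly a.1 (Y a.2 ha w) u - poly b.1 (Y b.2 hb w) u
  have hp : Measurable (Function.uncurry p) :=
    (measurable_poly (f := Y a.2 ha) (fun z => measurable_pi_apply _) a.1).sub
      (measurable_poly (f := Y b.2 hb) (fun z => measurable_pi_apply _) b.1)
  have h := eLpNorm'_cross_le hW₁ hW₂ hind hp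
    (fun w => (continuousOn_poly _ _).sub (continuousOn_poly _ _)) hc c.1 hx hxy hy hr
    (M := 2 * gaussMoment r * ENNReal.ofReal δ) fun u hu =>
      eLpNorm'_heatPoly_diff_incr_le hW₁ ha hb hδ (by linarith) ⟨hx, hxy.trans hy⟩
        ⟨hx.trans hu.1, hu.2.trans hy⟩
  refine h.trans (le_of_eq ?_)
  ring

theorem eLpNorm'_heatArea_indep_le [IsProbabilityMeasure P] {W₁ W₂ : (ℝ × ℝ → ℝ) → Ω → ℝ}
    (hW₁ : IsWhiteNoise (spaceTimeMeasure T) W₁ P) (hW₂ : IsWhiteNoise (spaceTimeMeasure T) W₂ P)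
    (hind : IndepFun (noisePath T W₁) (noisePath T W₂) P)
    {a : ℕ × ℝ} (ha : a.2 ∈ Icc 0 T) {x y r : ℝ} (hx : 0 ≤ x) (hxy : x ≤ y) (hy : y ≤ 1)
    (hr : 2 ≤ r) :
    eLpNorm' (heatArea W₁ W₂ a x y) r P ≤
      12 * gaussMoment r ^ 2 * ENNReal.ofReal √(y - x) * ENNReal.ofReal √(y - x) := by
  let Y : (NoiseIndex T → ℝ) → ℝ → ℝ := fun w z => w ⟨mildKernel a.2 z, memLp_mildKernel ha z⟩
  have h := eLpNorm'_cross_le hW₁ hW₂ hind (p := fun w => poly a.1 (Y w))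
    (measurable_poly (f := Y) (fun z => measurable_pi_apply _) a.1)
    (fun w => continuousOn_poly _ _) ha a.1 hx hxy hy hr
    (M := gaussMoment r * ENNReal.ofReal (6 * √(y - x))) fun u hu =>
      eLpNorm'_heatPoly_incr_le hW₁ ha (by linarith) hx hu hy
  refine h.trans (le_of_eq ?_)
  rw [ENNReal.ofReal_mul (by norm_num), ENNReal.ofReal_ofNat]
  ring

/-- With p, q the two components, ∫p_a dq_a - ∫p_b dq_b = ∫(p_a-p_b) dq_a - ∫(q_a-q_b) dp_b + Δp_b
Δ(q_a-q_b), by two integrations by parts. The differences thus appear only as integrands or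
increments, never as integrators, where their L² closeness could not be used. -/
theorem eLpNorm'_heatArea_sub_indep_le [IsProbabilityMeasure P] {W₁ W₂ : (ℝ × ℝ → ℝ) → Ω → ℝ}
    (hW₁ : IsWhiteNoise (spaceTimeMeasure T) W₁ P) (hW₂ : IsWhiteNoise (spaceTimeMeasure T) W₂ P)
    (hind : IndepFun (noisePath T W₁) (noisePath T W₂) P)
    {a b : ℕ × ℝ} (ha : a.2 ∈ Icc 0 T) (hb : b.2 ∈ Icc 0 T)
    {δ : ℝ} (hδ₁ : RmsClose P W₁ a b δ) (hδ₂ : RmsClose P W₂ a b δ) {x y r : ℝ} (hx : 0 ≤ x)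
    (hxy : x ≤ y) (hy : y ≤ 1) (hr : 2 ≤ r) :
    eLpNorm' (fun ω => heatArea W₁ W₂ a x y ω - heatArea W₁ W₂ b x y ω) r P ≤
      (8 * gaussMoment r ^ 2 + 12 * gaussMoment (2 * r) ^ 2) *
        (ENNReal.ofReal √(y - x) * ENNReal.ofReal δ) := by
  have hr1 : 1 ≤ r := by linarith
  have hx1 : x ∈ Icc (0 : ℝ) 1 := ⟨hx, hxy.trans hy⟩
  have hy1 : y ∈ Icc (0 : ℝ) 1 := ⟨hx.trans hxy, hy⟩
  set f : Ω → ℝ := fun ω => cross (fun u => heatPoly W₁ a u ω - heatPoly W₁ b u ω)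
      (fun u => heatSlope W₂ a u ω) x y with hf
  set g : Ω → ℝ := fun ω => cross (fun u => heatPoly W₂ a u ω - heatPoly W₂ b u ω)
      (fun u => heatSlope W₁ b u ω) x y with hg
  set h₁ : Ω → ℝ := fun ω => heatPoly W₁ b y ω - heatPoly W₁ b x ω with hh₁
  set h₂ : Ω → ℝ := fun ω => (heatPoly W₂ a y ω - heatPoly W₂ b y ω)
      - (heatPoly W₂ a x ω - heatPoly W₂ b x ω) with hh₂
  have heq : (fun ω => heatArea W₁ W₂ a x y ω - heatArea W₁ W₂ b x y ω) =
      fun ω => f ω - g ω + h₁ ω * h₂ ω := by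
    ext ω
    have hPa := continuousOn_poly a.1 fun z => heatField W₁ a.2 z ω
    have hPb := continuousOn_poly b.1 fun z => heatField W₁ b.2 z ω
    have hQa := continuousOn_poly a.1 fun z => heatField W₂ a.2 z ω
    have hQb := continuousOn_poly b.1 fun z => heatField W₂ b.2 z ω
    have e1 : f ω = _ := cross_sub_left hPa hPb a.1 (fun z => heatField W₂ a.2 z ω) hx hxy hy
    have e2 : g ω = _ := cross_sub_left hQa hQb b.1 (fun z => heatField W₁ b.2 z ω) hx hxy hy
    have e3 := cross_add_cross_swap b.1 a.1 (fun z => heatField W₁ b.2 z ω)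
      (fun z => heatField W₂ a.2 z ω) hx hxy hy
    have e4 := cross_add_cross_swap b.1 b.1 (fun z => heatField W₁ b.2 z ω)
      (fun z => heatField W₂ b.2 z ω) hx hxy hy
    rw [e1, e2]
    simp only [heatArea, area, hh₁, hh₂, heatPoly]
    linear_combination e3 - e4
  have hm : ∀ {W : (ℝ × ℝ → ℝ) → Ω → ℝ} {c : ℕ × ℝ} (_ : IsWhiteNoise (spaceTimeMeasure T) W P)
      (_ : c.2 ∈ Icc 0 T), Measurable fun q : Ω × ℝ => heatPoly W c q.2 q.1 := fun h h' =>
    measurable_heatPoly h h'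
  have hxy_m : Measurable fun ω : Ω => (ω, x, y) := measurable_id.prodMk measurable_const
  have hfm : AEStronglyMeasurable f P := ((measurable_cross
    (p := fun ω u => heatPoly W₁ a u ω - heatPoly W₁ b u ω) (q' := fun ω u => heatSlope W₂ a u ω)
    ((hm hW₁ ha).sub (hm hW₁ hb))
    (measurable_heatSlope hW₂ ha)).comp hxy_m).aestronglyMeasurable
  have hgm : AEStronglyMeasurable g P := ((measurable_cross
    (p := fun ω u => heatPoly W₂ a u ω - heatPoly W₂ b u ω) (q' := fun ω u => heatSlope W₁ b u ω)
    ((hm hW₂ ha).sub (hm hW₂ hb))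
    (measurable_heatSlope hW₁ hb)).comp hxy_m).aestronglyMeasurable
  have hh₁m : AEStronglyMeasurable h₁ P := ((measurable_heatPoly_left hW₁ hb y).sub
    (measurable_heatPoly_left hW₁ hb x)).aestronglyMeasurable
  have hh₂m : AEStronglyMeasurable h₂ P := (((measurable_heatPoly_left hW₂ ha y).sub
    (measurable_heatPoly_left hW₂ hb y)).sub ((measurable_heatPoly_left hW₂ ha x).sub
    (measurable_heatPoly_left hW₂ hb x))).aestronglyMeasurable
  have b1 := eLpNorm'_cross_heat_le hW₁ hW₂ hind ha hb ha hδ₁ hx hxy hy hr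
  have b2 := eLpNorm'_cross_heat_le hW₂ hW₁ hind.symm ha hb hb hδ₂ hx hxy hy hr
  have b3 : eLpNorm' h₁ (2 * r) P ≤ _ :=
    eLpNorm'_heatPoly_incr_le hW₁ hb (r := 2 * r) (by linarith) hx ⟨hxy, le_rfl⟩ hy
  have b4 : eLpNorm' h₂ (2 * r) P ≤ _ :=
    eLpNorm'_heatPoly_diff_incr_le hW₂ ha hb hδ₂ (r := 2 * r) (by linarith) hx1 hy1
  rw [heq]
  refine (eLpNorm'_add_le (hfm.sub hgm) (hh₁m.mul hh₂m) hr1).trans ?_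
  refine (add_le_add ((eLpNorm'_sub_le hfm hgm hr1).trans (add_le_add b1 b2))
    ((eLpNorm'_mul_le hh₁m hh₂m (by linarith)).trans (mul_le_mul' b3 b4))).trans (le_of_eq ?_)
  rw [ENNReal.ofReal_mul (by norm_num), ENNReal.ofReal_ofNat]
  ring

theorem eLpNorm'_heatArea_diag_le [IsProbabilityMeasure P] {W : (ℝ × ℝ → ℝ) → Ω → ℝ}
    (hW : IsWhiteNoise (spaceTimeMeasure T) W P)
    {a : ℕ × ℝ} (ha : a.2 ∈ Icc 0 T) {x y r : ℝ} (hx : 0 ≤ x) (hxy : x ≤ y) (hy : y ≤ 1)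
    (hr : 2 ≤ r) :
    eLpNorm' (heatArea W W a x y) r P ≤
      36 * gaussMoment (2 * r) ^ 2 * ENNReal.ofReal √(y - x) * ENNReal.ofReal √(y - x) := by
  set h : Ω → ℝ := fun ω => heatPoly W a y ω - heatPoly W a x ω with hh
  have hm : AEStronglyMeasurable h P := ((measurable_heatPoly_left hW ha y).sub
    (measurable_heatPoly_left hW ha x)).aestronglyMeasurable
  have b1 : eLpNorm' h (2 * r) P ≤ _ :=
    eLpNorm'_heatPoly_incr_le hW ha (r := 2 * r) (by linarith) hx ⟨hxy, le_rfl⟩ hy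
  have hle : eLpNorm' (heatArea W W a x y) r P ≤ eLpNorm' (fun ω => h ω * h ω) r P := by
    refine eLpNorm'_mono_ae (by linarith) (Eventually.of_forall fun ω => ?_)
    have : heatArea W W a x y ω = h ω ^ 2 / 2 := area_self a.1 _ hx hxy hy
    rw [this, Real.norm_of_nonneg (by positivity), Real.norm_of_nonneg (mul_self_nonneg _)]
    nlinarith [sq_nonneg (h ω)]
  refine hle.trans ((eLpNorm'_mul_le hm hm (by linarith)).trans
    ((mul_le_mul' b1 b1).trans (le_of_eq ?_)))
  rw [ENNReal.ofReal_mul (by norm_num), ENNReal.ofReal_ofNat]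
  ring

/-- Independence is not available for one component against itself, but the iterated integral is
then half a squared increment. The difference of squares factors into a difference of size δ and a
sum of size √(y-x). -/
theorem eLpNorm'_heatArea_sub_diag_le [IsProbabilityMeasure P] {W : (ℝ × ℝ → ℝ) → Ω → ℝ}
    (hW : IsWhiteNoise (spaceTimeMeasure T) W P)
    {a b : ℕ × ℝ} (ha : a.2 ∈ Icc 0 T) (hb : b.2 ∈ Icc 0 T)
    {δ : ℝ} (hδ : RmsClose P W a b δ) {x y r : ℝ} (hx : 0 ≤ x)
    (hxy : x ≤ y) (hy : y ≤ 1) (hr : 2 ≤ r) :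
    eLpNorm' (fun ω => heatArea W W a x y ω - heatArea W W b x y ω) r P ≤
      24 * gaussMoment (2 * r) ^ 2 * (ENNReal.ofReal √(y - x) * ENNReal.ofReal δ) := by
  have hx1 : x ∈ Icc (0 : ℝ) 1 := ⟨hx, hxy.trans hy⟩
  have hy1 : y ∈ Icc (0 : ℝ) 1 := ⟨hx.trans hxy, hy⟩
  set h : ℕ × ℝ → Ω → ℝ := fun a ω => heatPoly W a y ω - heatPoly W a x ω with hh
  set h₂ : Ω → ℝ := fun ω => (heatPoly W a y ω - heatPoly W b y ω)
      - (heatPoly W a x ω - heatPoly W b x ω) with hh₂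
  have hm : ∀ {a : ℕ × ℝ}, a.2 ∈ Icc 0 T → AEStronglyMeasurable (h a) P := fun ha =>
    ((measurable_heatPoly_left hW ha y).sub
      (measurable_heatPoly_left hW ha x)).aestronglyMeasurable
  have hh₂m : AEStronglyMeasurable h₂ P := (((measurable_heatPoly_left hW ha y).sub
    (measurable_heatPoly_left hW hb y)).sub ((measurable_heatPoly_left hW ha x).sub
    (measurable_heatPoly_left hW hb x))).aestronglyMeasurable
  have b1 : ∀ {a : ℕ × ℝ}, a.2 ∈ Icc 0 T → eLpNorm' (h a) (2 * r) P ≤ _ := fun ha =>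
    eLpNorm'_heatPoly_incr_le hW ha (r := 2 * r) (by linarith) hx ⟨hxy, le_rfl⟩ hy
  have b2 : eLpNorm' (fun ω => h a ω + h b ω) (2 * r) P ≤ _ :=
    (eLpNorm'_add_le (hm ha) (hm hb) (by linarith)).trans (add_le_add (b1 ha) (b1 hb))
  have b4 : eLpNorm' h₂ (2 * r) P ≤ _ :=
    eLpNorm'_heatPoly_diff_incr_le hW ha hb hδ (r := 2 * r) (by linarith) hx1 hy1
  have hle : eLpNorm' (fun ω => heatArea W W a x y ω - heatArea W W b x y ω) r P ≤
      eLpNorm' (fun ω => h₂ ω * (h a ω + h b ω)) r P := by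
    refine eLpNorm'_mono_ae (by linarith) (Eventually.of_forall fun ω => ?_)
    have e1 : ∀ a, heatArea W W a x y ω = h a ω ^ 2 / 2 := fun a => area_self a.1 _ hx hxy hy
    have e2 : h₂ ω = h a ω - h b ω := by simp only [hh₂, hh]; ring
    rw [e1, e1, e2, show h a ω ^ 2 / 2 - h b ω ^ 2 / 2 =
      1 / 2 * ((h a ω - h b ω) * (h a ω + h b ω)) by ring, norm_mul (1 / 2 : ℝ)]
    norm_num
    nlinarith [mul_nonneg (abs_nonneg (h a ω - h b ω)) (abs_nonneg (h a ω + h b ω))]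
  refine hle.trans ((eLpNorm'_mul_le hh₂m ((hm ha).add (hm hb)) (by linarith)).trans
    ((mul_le_mul' b4 b2).trans (le_of_eq ?_)))
  rw [ENNReal.ofReal_mul (by norm_num), ENNReal.ofReal_ofNat]
  ring

end Moments

/-! ### Besov norms as weighted `Lᵖ` norms -/

section Weighted

theorem measurableSet_simplex (T : ℝ) : MeasurableSet (simplex T) :=
  ((isClosed_le continuous_const continuous_fst).inter
    ((isClosed_le continuous_fst continuous_snd).inter
      (isClosed_le continuous_snd continuous_const))).measurableSet

/-- The measure `|y - x|⁻ᵉ dx dy` on the simplex. -/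
def simplexMeasure (T e : ℝ) : Measure (ℝ × ℝ) :=
  (volume.restrict (simplex T)).withDensity fun p => ENNReal.ofReal ((p.2 - p.1) ^ (-e))

theorem measurable_weight (e : ℝ) :
    Measurable fun p : ℝ × ℝ => ENNReal.ofReal ((p.2 - p.1) ^ (-e)) := by fun_prop

theorem lintegral_simplexMeasure (T e : ℝ) (f : ℝ × ℝ → ℝ≥0∞) :
    ∫⁻ p, f p ∂simplexMeasure T e =
      ∫⁻ p in simplex T, ENNReal.ofReal ((p.2 - p.1) ^ (-e)) * f p :=
  lintegral_withDensity_eq_lintegral_mul_non_measurable _ (measurable_weight e)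
    (Eventually.of_forall fun _ => ENNReal.ofReal_lt_top) f

instance (T e : ℝ) : SFinite (simplexMeasure T e) := by
  unfold simplexMeasure; infer_instance

theorem ae_ne_diag : ∀ᵐ p : ℝ × ℝ, p.1 ≠ p.2 := by
  have h : (volume : Measure (ℝ × ℝ)) {p | p.1 = p.2} = 0 := by
    have hm : MeasurableSet {p : ℝ × ℝ | p.1 = p.2} :=
      (isClosed_eq continuous_fst continuous_snd).measurableSet
    rw [Measure.volume_eq_prod, Measure.measure_prod_null hm]
    refine Eventually.of_forall fun x => ?_
    have : Prod.mk x ⁻¹' {p : ℝ × ℝ | p.1 = p.2} = {x} := by ext; simp [eq_comm]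
    simp [this]
  rw [ae_iff]
  simpa using h

theorem ae_simplexMeasure {T e : ℝ} {p : ℝ × ℝ → Prop}
    (h : ∀ x y, 0 ≤ x → x < y → y ≤ T → p (x, y)) : ∀ᵐ q ∂simplexMeasure T e, p q := by
  refine (withDensity_absolutelyContinuous _ _).ae_le ?_
  filter_upwards [ae_restrict_mem (measurableSet_simplex T), ae_restrict_of_ae ae_ne_diag]
    with q hq hne
  exact h q.1 q.2 hq.1 (lt_of_le_of_ne hq.2.1 hne) hq.2.2

variable {V : Type*} [NormedAddCommGroup V]

theorem ofReal_norm_rpow_div (v : V) {m d : ℝ} (e : ℝ) (hm : 0 ≤ m) (hd : 0 ≤ d) :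
    ENNReal.ofReal (‖v‖ ^ m / d ^ e) = ENNReal.ofReal (d ^ (-e)) * ‖v‖ₑ ^ m := by
  rw [div_eq_mul_inv, ← Real.rpow_neg hd, ENNReal.ofReal_mul (by positivity), mul_comm,
    ← ENNReal.ofReal_rpow_of_nonneg (norm_nonneg v) hm, ofReal_norm]

theorem besovNorm_eq {m : ℝ} (hm : 0 ≤ m) (α : ℝ) (A : ℝ → ℝ → V) :
    besovNorm α m A = eLpNorm' (fun p => A p.1 p.2) m (simplexMeasure 1 (1 + m * α)) := by
  rw [besovNorm, eLpNorm'_eq_lintegral_enorm, lintegral_simplexMeasure]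
  congr 1
  refine setLIntegral_congr_fun (measurableSet_simplex 1) fun p hp => ?_
  exact ofReal_norm_rpow_div _ _ hm (sub_nonneg.2 hp.2.1)

theorem pathBesovNorm_eq {m : ℝ} (hm : 0 ≤ m) (T β : ℝ) (f : ℝ → V) :
    pathBesovNorm T β m f =
      ‖f 0‖ₑ + eLpNorm' (fun p => f p.2 - f p.1) m (simplexMeasure T (1 + m * β)) := by
  rw [pathBesovNorm, eLpNorm'_eq_lintegral_enorm, lintegral_simplexMeasure]
  congr 2
  refine setLIntegral_congr_fun (measurableSet_simplex T) fun p hp => ?_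
  rw [mul_comm m]
  exact ofReal_norm_rpow_div _ _ hm (sub_nonneg.2 hp.2.1)

/-- The norm of a sheet is a Besov norm in time for the distance of spatial slices; the moment
estimate and the chaining argument both work in this form. -/
theorem sheetBesovNorm_eq {m : ℝ} (hm : 0 < m) (T β α : ℝ) (G : ℝ → ℝ → ℝ → V) :
    sheetBesovNorm T β α m G =
      eLpNorm' (fun q => besovNorm α m fun x y => G q.2 x y - G q.1 x y) m
        (simplexMeasure T (1 + m * β)) := by
  rw [sheetBesovNorm, eLpNorm'_eq_lintegral_enorm, lintegral_simplexMeasure]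
  congr 1
  refine setLIntegral_congr_fun (measurableSet_simplex T) fun q hq => ?_
  simp only [enorm_eq_self, besovNorm]
  rw [← ENNReal.rpow_mul, one_div_mul_cancel hm.ne', ENNReal.rpow_one,
    ← lintegral_const_mul' _ _ ENNReal.ofReal_ne_top]
  refine setLIntegral_congr_fun (measurableSet_simplex 1) fun p hp => ?_
  rw [← ENNReal.ofReal_mul (Real.rpow_nonneg (sub_nonneg.2 hq.2.1) _), mul_comm m β, mul_comm m α,
    Real.rpow_neg (sub_nonneg.2 hq.2.1), div_mul_eq_div_div]
  congr 1
  field_simp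

/-- In the coordinates (x, y - x) the density is u^{κ-1}, integrable at zero. -/
theorem simplexMeasure_univ_lt_top {κ : ℝ} (hκ : 0 < κ) (T : ℝ) :
    simplexMeasure T (1 - κ) univ < ⊤ := by
  rcases lt_or_ge T 0 with hT | hT
  · have : simplex T = ∅ := by
      ext p; refine iff_of_false (fun h => ?_) id
      linarith [h.1, h.2.1, h.2.2]
    simp [simplexMeasure, this]
  set g : ℝ → ℝ≥0∞ := (Icc 0 T).indicator fun u => ENNReal.ofReal (u ^ (κ - 1)) with hg
  have hgm : Measurable g := Measurable.indicator (by fun_prop) measurableSet_Icc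
  have hgi : ∫⁻ u, g u < ⊤ := by
    have h := (intervalIntegral.intervalIntegrable_rpow' (a := 0) (b := T) (r := κ - 1)
      (by linarith)).1
    rw [hg, lintegral_indicator measurableSet_Icc, setLIntegral_congr Ioc_ae_eq_Icc.symm]
    exact h.lintegral_lt_top
  have hle : simplexMeasure T (1 - κ) univ ≤
      ∫⁻ p : ℝ × ℝ, (Icc 0 T).indicator (fun _ => 1) p.1 * g (p.2 - p.1) := by
    rw [← lintegral_one, lintegral_simplexMeasure, ← lintegral_indicator (measurableSet_simplex T)]
    refine lintegral_mono (indicator_le fun p hp => ?_)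
    have h1 : p.1 ∈ Icc 0 T := ⟨hp.1, hp.2.1.trans hp.2.2⟩
    have h2 : p.2 - p.1 ∈ Icc 0 T := ⟨sub_nonneg.2 hp.2.1, by linarith [hp.1, hp.2.2]⟩
    simp [hg, h1, h2, -mem_Icc]
  refine hle.trans_lt ?_
  rw [Measure.volume_eq_prod, lintegral_prod _ (by
    refine Measurable.aemeasurable ?_
    exact ((measurable_const.indicator measurableSet_Icc).comp measurable_fst).mul
      (hgm.comp (measurable_snd.sub measurable_fst)))]
  have h1 : ∀ s : ℝ, ∫⁻ t, (Icc 0 T).indicator (fun _ => 1) s * g (t - s) =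
      (Icc 0 T).indicator (fun _ => 1) s * ∫⁻ u, g u := fun s => by
    rw [lintegral_const_mul _ (f := fun t => g (t - s)) (hgm.comp (measurable_id.sub_const s)),
      lintegral_sub_right_eq_self g s]
  simp only [h1]
  rw [lintegral_mul_const _ (measurable_const.indicator measurableSet_Icc),
    lintegral_indicator measurableSet_Icc]
  simp only [lintegral_const, Measure.restrict_apply MeasurableSet.univ, univ_inter, one_mul,
    Real.volume_Icc]
  exact ENNReal.mul_lt_top ENNReal.ofReal_lt_top hgi

/-- The weighted `L^q` norm of a function of order `|y - x| ^ b`, as an `L^q` norm for a finite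
measure. -/
theorem eLpNorm'_simplexMeasure_eq {T b β q : ℝ} (hq : 0 < q) (F : ℝ × ℝ → ℝ≥0∞) :
    eLpNorm' F q (simplexMeasure T (1 + q * β)) =
      eLpNorm' (fun p => F p * ENNReal.ofReal ((p.2 - p.1) ^ (-b))) q
        (simplexMeasure T (1 - q * (b - β))) := by
  simp only [eLpNorm'_eq_lintegral_enorm, lintegral_simplexMeasure, enorm_eq_self]
  congr 1
  refine lintegral_congr_ae ?_
  filter_upwards [ae_restrict_mem (measurableSet_simplex T), ae_restrict_of_ae ae_ne_diag]
    with p hp hne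
  have hd : 0 < p.2 - p.1 := sub_pos.2 (lt_of_le_of_ne hp.2.1 hne)
  rw [ENNReal.mul_rpow_of_nonneg _ _ hq.le, ENNReal.ofReal_rpow_of_nonneg (by positivity) hq.le,
    ← Real.rpow_mul hd.le, mul_comm (F p ^ q), ← mul_assoc, ← ENNReal.ofReal_mul (by positivity),
    ← Real.rpow_add hd]
  congr 3
  ring

/-- Moments of a weighted norm of a random function. -/
theorem eLpNorm'_simplex_le {Ω : Type*} [MeasurableSpace Ω] {P : Measure Ω} [SFinite P]
    {T b β q r : ℝ} (hq : 0 < q) (hqr : q ≤ r) {F : Ω → ℝ × ℝ → ℝ≥0∞}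
    (hF : Measurable (Function.uncurry F)) {K : ℝ≥0∞}
    (hK : ∀ s t, 0 ≤ s → s < t → t ≤ T →
      eLpNorm' (fun ω => F ω (s, t)) r P ≤ K * ENNReal.ofReal ((t - s) ^ b)) :
    eLpNorm' (fun ω => eLpNorm' (F ω) q (simplexMeasure T (1 + q * β))) r P ≤
      K * simplexMeasure T (1 - q * (b - β)) univ ^ (1 / q) := by
  have hr : 0 < r := hq.trans_le hqr
  set ν := simplexMeasure T (1 - q * (b - β)) with hν
  set H : Ω → ℝ × ℝ → ℝ≥0∞ := fun ω p => F ω p * ENNReal.ofReal ((p.2 - p.1) ^ (-b)) with hH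
  have hHm : Measurable (Function.uncurry H) :=
    hF.mul ((measurable_weight b).comp measurable_snd)
  -- Dividing F by (t-s)^b moves the weight into a measure that is finite when b > β, so Hölder's
  -- inequality applies from q up to r.
  have h1 : ∀ ω, eLpNorm' (F ω) q (simplexMeasure T (1 + q * β)) ≤
      eLpNorm' (H ω) r ν * ν univ ^ (1 / q - 1 / r) := fun ω => by
    rw [eLpNorm'_simplexMeasure_eq (b := b) hq]
    exact eLpNorm'_le_eLpNorm'_mul_rpow_measure_univ hq hqr
      (hHm.comp measurable_prodMk_left).aestronglyMeasurable
  -- The two exponents now coincide, so Fubini reduces the claim to the pointwise bound.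
  have h2 : eLpNorm' (fun ω => eLpNorm' (H ω) r ν) r P ≤ K * ν univ ^ (1 / r) := by
    simp only [eLpNorm'_eq_lintegral_enorm, enorm_eq_self, ← ENNReal.rpow_mul,
      one_div_mul_cancel hr.ne', ENNReal.rpow_one]
    rw [lintegral_lintegral_swap (hHm.pow_const r).aemeasurable]
    have h3 : ∫⁻ p, ∫⁻ ω, H ω p ^ r ∂P ∂ν ≤ ∫⁻ _, K ^ r ∂ν := by
      refine lintegral_mono_ae (ae_simplexMeasure fun s t hs hst ht => ?_)
      have hd : 0 < t - s := sub_pos.2 hst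
      have h4 := hK s t hs hst ht
      simp only [hH]
      have h5 : ∫⁻ ω, (F ω (s, t) * ENNReal.ofReal ((t - s) ^ (-b))) ^ r ∂P =
          (eLpNorm' (fun ω => F ω (s, t)) r P * ENNReal.ofReal ((t - s) ^ (-b))) ^ r := by
        simp only [ENNReal.mul_rpow_of_nonneg _ _ hr.le]
        rw [lintegral_mul_const' _ _ (ENNReal.rpow_ne_top_of_nonneg hr.le ENNReal.ofReal_ne_top),
          eLpNorm'_eq_lintegral_enorm, ← ENNReal.rpow_mul, one_div_mul_cancel hr.ne',
          ENNReal.rpow_one]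
        simp only [enorm_eq_self]
      rw [h5]
      gcongr
      calc _ ≤ K * ENNReal.ofReal ((t - s) ^ b) * ENNReal.ofReal ((t - s) ^ (-b)) := by gcongr
        _ = K := by
          rw [mul_assoc, ← ENNReal.ofReal_mul (by positivity), ← Real.rpow_add hd]
          simp
    calc _ ≤ (∫⁻ _, K ^ r ∂ν) ^ (1 / r) := by gcongr
      _ = K * ν univ ^ (1 / r) := by
        rw [lintegral_const, ENNReal.mul_rpow_of_nonneg _ _ (by positivity), ← ENNReal.rpow_mul,
          mul_one_div_cancel hr.ne', ENNReal.rpow_one]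
  have hc0 : (0 : ℝ) ≤ 1 / q - 1 / r := sub_nonneg.2 (one_div_le_one_div_of_le hq hqr)
  calc eLpNorm' (fun ω => eLpNorm' (F ω) q (simplexMeasure T (1 + q * β))) r P
      ≤ eLpNorm' (fun ω => eLpNorm' (H ω) r ν * ν univ ^ (1 / q - 1 / r)) r P :=
        eLpNorm'_mono_enorm_ae hr.le (Eventually.of_forall h1)
    _ = eLpNorm' (fun ω => eLpNorm' (H ω) r ν) r P * ν univ ^ (1 / q - 1 / r) := by
        simp only [eLpNorm'_eq_lintegral_enorm, enorm_eq_self,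
          ENNReal.mul_rpow_of_nonneg _ _ hr.le]
        rw [lintegral_mul_const]
        · rw [ENNReal.mul_rpow_of_nonneg _ _ (by positivity), ← ENNReal.rpow_mul (ν univ ^ _),
            mul_one_div_cancel hr.ne', ENNReal.rpow_one]
        · refine Measurable.pow_const ?_ _
          exact (Measurable.pow_const (hHm.pow_const r).lintegral_prod_right' _)
    _ ≤ K * ν univ ^ (1 / r) * ν univ ^ (1 / q - 1 / r) := by gcongr
    _ = K * ν univ ^ (1 / q) := by
        rw [mul_assoc, ← ENNReal.rpow_add_of_nonneg _ _ (by positivity) hc0]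
        congr 2; ring

end Weighted

/-! ### A chaining estimate for pseudo-metrics -/

section Chaining

/-- A pseudo-metric on the line, with the triangle inequality and continuity on `[0,T]` only. -/
structure IsBesovMetric (T : ℝ) (ρ : ℝ → ℝ → ℝ≥0∞) : Prop where
  measurable : Measurable (Function.uncurry ρ)
  symm : ∀ s t, ρ s t = ρ t s
  self : ∀ t, ρ t t = 0
  triangle : ∀ s ∈ Icc 0 T, ∀ t ∈ Icc 0 T, ∀ u ∈ Icc 0 T, ρ s u ≤ ρ s t + ρ t u
  continuous : ∀ t ∈ Icc 0 T, Tendsto (ρ t) (𝓝[Icc 0 T] t) (𝓝 0)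

variable {T q γ : ℝ} {ρ : ℝ → ℝ → ℝ≥0∞}

theorem lintegral_lintegral_le_of_symm (hρ : IsBesovMetric T ρ) {J : Set ℝ}
    (hJ : MeasurableSet J) : ∫⁻ u in J, ∫⁻ v in J, ρ u v ≤
      2 * ∫⁻ p in (J ×ˢ J) ∩ {p | p.1 ≤ p.2}, ρ p.1 p.2 := by
  have hm1 : MeasurableSet {p : ℝ × ℝ | p.1 ≤ p.2} := measurableSet_le measurable_fst measurable_snd
  have hm2 : MeasurableSet {p : ℝ × ℝ | p.2 ≤ p.1} := measurableSet_le measurable_snd measurable_fst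
  have hJJ := hJ.prod hJ
  have e1 : ∫⁻ u in J, ∫⁻ v in J, ρ u v = ∫⁻ p in J ×ˢ J, ρ p.1 p.2 := by
    rw [Measure.volume_eq_prod, ← Measure.prod_restrict]
    exact (lintegral_prod _ hρ.measurable.aemeasurable).symm
  have e2 : ∫⁻ p in (J ×ˢ J) ∩ {p | p.2 ≤ p.1}, ρ p.1 p.2 =
      ∫⁻ p in (J ×ˢ J) ∩ {p | p.1 ≤ p.2}, ρ p.1 p.2 := by
    have hsw : MeasurePreserving (Prod.swap : ℝ × ℝ → ℝ × ℝ) volume volume :=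
      Measure.measurePreserving_swap
    refine Eq.trans ?_ (hsw.setLIntegral_comp_preimage (hJJ.inter hm1) hρ.measurable)
    have : Prod.swap ⁻¹' ((J ×ˢ J) ∩ {p : ℝ × ℝ | p.1 ≤ p.2}) = (J ×ˢ J) ∩ {p | p.2 ≤ p.1} := by
      ext p; simp [and_comm]
    rw [this]
    exact lintegral_congr fun p => hρ.symm _ _
  have hcov : J ×ˢ J ⊆ ((J ×ˢ J) ∩ {p | p.1 ≤ p.2}) ∪ ((J ×ˢ J) ∩ {p | p.2 ≤ p.1}) := fun p hp =>
    (le_total p.1 p.2).imp (fun h => ⟨hp, h⟩) fun h => ⟨hp, h⟩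
  rw [e1, two_mul]
  calc _ ≤ _ := lintegral_mono_set hcov
    _ ≤ _ := lintegral_union_le _ _ _
    _ = _ := by rw [e2]

/-- Hölder on the triangle gives the exponent 2(1 - 1/q); bounding |v-u| by b-a in the Besov weight
gives 1/q + γ. The factor 2 comes from the two triangles of the square. -/
theorem lintegral_lintegral_interval_le (hρ : IsBesovMetric T ρ) (hq : 1 ≤ q) (hγ : 0 < γ)
    {a b : ℝ} (ha : 0 ≤ a) (hab : a < b) (hb : b ≤ T) :
    ∫⁻ u in Icc a b, ∫⁻ v in Icc a b, ρ u v ≤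
      2 * eLpNorm' (fun p => ρ p.1 p.2) q (simplexMeasure T (1 + q * γ)) *
        ENNReal.ofReal ((b - a) ^ (2 + (γ - 1 / q))) := by
  have hq0 : 0 < q := by linarith
  have hl : 0 < b - a := sub_pos.2 hab
  refine (lintegral_lintegral_le_of_symm hρ measurableSet_Icc).trans ?_
  rw [mul_assoc]
  gcongr
  set S : Set (ℝ × ℝ) := (Icc a b ×ˢ Icc a b) ∩ {p | p.1 ≤ p.2} with hS
  have hSm : MeasurableSet S := (measurableSet_Icc.prod measurableSet_Icc).inter
    (measurableSet_le measurable_fst measurable_snd)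
  have h1 : ∫⁻ p in S, ρ p.1 p.2 ≤ eLpNorm' (fun p => ρ p.1 p.2) q (volume.restrict S) *
      (volume.restrict S) univ ^ (1 / 1 - 1 / q) := by
    have := eLpNorm'_le_eLpNorm'_mul_rpow_measure_univ (μ := volume.restrict S) one_pos hq
      hρ.measurable.aestronglyMeasurable
    simpa [eLpNorm'_eq_lintegral_enorm] using! this
  have h2 : (volume.restrict S) univ ≤ ENNReal.ofReal ((b - a) ^ 2) := by
    rw [Measure.restrict_apply_univ]
    refine (measure_mono inter_subset_left).trans ?_
    rw [Measure.volume_eq_prod, Measure.prod_prod, Real.volume_Icc,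
      ← ENNReal.ofReal_mul hl.le, sq]
  have h3 : eLpNorm' (fun p => ρ p.1 p.2) q (volume.restrict S) ≤
      eLpNorm' (fun p => ρ p.1 p.2) q (simplexMeasure T (1 + q * γ)) *
        ENNReal.ofReal ((b - a) ^ (1 / q + γ)) := by
    have h4 : ∫⁻ p in S, ρ p.1 p.2 ^ q ≤ ENNReal.ofReal ((b - a) ^ (1 + q * γ)) *
        ∫⁻ p in simplex T, ENNReal.ofReal ((p.2 - p.1) ^ (-(1 + q * γ))) * ρ p.1 p.2 ^ q := by
      rw [← lintegral_const_mul' _ _ ENNReal.ofReal_ne_top]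
      refine (setLIntegral_mono' hSm fun p hp => ?_).trans (lintegral_mono_set fun p hp =>
        ⟨ha.trans hp.1.1.1, hp.2, hp.1.2.2.trans hb⟩)
      rcases eq_or_lt_of_le (show p.1 ≤ p.2 from hp.2) with h | h
      · rw [h, hρ.self, ENNReal.zero_rpow_of_pos hq0]
        exact zero_le
      have hd : 0 < p.2 - p.1 := sub_pos.2 h
      rw [← mul_assoc, ← ENNReal.ofReal_mul (by positivity)]
      refine le_mul_of_one_le_left' ?_
      rw [ENNReal.one_le_ofReal, Real.rpow_neg hd.le, ← div_eq_mul_inv, one_le_div (by positivity)]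
      exact Real.rpow_le_rpow hd.le (by linarith [hp.1.2.2, hp.1.1.1]) (by positivity)
    simp only [eLpNorm'_eq_lintegral_enorm, enorm_eq_self, lintegral_simplexMeasure]
    refine (ENNReal.rpow_le_rpow h4 (by positivity)).trans (le_of_eq ?_)
    rw [ENNReal.mul_rpow_of_nonneg _ _ (by positivity), mul_comm,
      ENNReal.ofReal_rpow_of_nonneg (by positivity) (by positivity), ← Real.rpow_mul hl.le]
    congr 3
    field_simp
  have hc0 : (0 : ℝ) ≤ 1 / 1 - 1 / q := by
    rw [div_one, sub_nonneg]; exact (div_le_one hq0).2 hq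
  refine h1.trans ((mul_le_mul' h3 (ENNReal.rpow_le_rpow h2 hc0)).trans (le_of_eq ?_))
  rw [ENNReal.ofReal_rpow_of_nonneg (by positivity) hc0, mul_assoc,
    ← ENNReal.ofReal_mul (by positivity), ← Real.rpow_natCast, ← Real.rpow_mul hl.le,
    ← Real.rpow_add hl]
  congr 3
  push_cast
  ring

/-- The interval of length `2⁻ⁿ T` in `[0,T]` that divides at `t` like `[0,T]`. -/
def chainIcc (T t : ℝ) (n : ℕ) : Set ℝ := Icc (t - t / 2 ^ n) (t + (T - t) / 2 ^ n)

/-- The mean of `ρ t` over `chainIcc T t n`. -/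
def chainMean (T : ℝ) (ρ : ℝ → ℝ → ℝ≥0∞) (t : ℝ) (n : ℕ) : ℝ≥0∞ :=
  (ENNReal.ofReal (T / 2 ^ n))⁻¹ * ∫⁻ u in chainIcc T t n, ρ t u

theorem volume_chainIcc (T t : ℝ) (n : ℕ) :
    volume (chainIcc T t n) = ENNReal.ofReal (T / 2 ^ n) := by
  rw [chainIcc, Real.volume_Icc]; congr 1; ring

theorem chainIcc_subset {t : ℝ} (ht : t ∈ Icc 0 T) (n : ℕ) : chainIcc T t n ⊆ Icc 0 T := by
  have h1 : t / 2 ^ n ≤ t := div_le_self ht.1 (one_le_pow₀ one_le_two)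
  have h2 : (T - t) / 2 ^ n ≤ T - t := div_le_self (sub_nonneg.2 ht.2) (one_le_pow₀ one_le_two)
  exact Icc_subset_Icc (by linarith) (by linarith)

theorem chainIcc_succ_subset {t : ℝ} (ht : t ∈ Icc 0 T) (n : ℕ) :
    chainIcc T t (n + 1) ⊆ chainIcc T t n := by
  have h : ∀ c : ℝ, 0 ≤ c → c / 2 ^ (n + 1) ≤ c / 2 ^ n := fun c hc =>
    div_le_div_of_nonneg_left hc (by positivity) (pow_le_pow_right₀ one_le_two n.le_succ)
  exact Icc_subset_Icc (by linarith [h t ht.1]) (by linarith [h (T - t) (sub_nonneg.2 ht.2)])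

/-- Average the triangle inequality ρ(t,u) ≤ ρ(t,v) + ρ(v,u) over the interval of length l for `u`
and its half-length successor for `v`. The error is the double integral over the large square
divided by l·l/2. -/
theorem chainMean_le_succ (hT : 0 < T) (hρ : IsBesovMetric T ρ) (hq : 1 ≤ q) (hγ : 0 < γ) {t : ℝ}
    (ht : t ∈ Icc 0 T) (n : ℕ) :
    chainMean T ρ t n ≤ chainMean T ρ t (n + 1) +
      4 * eLpNorm' (fun p => ρ p.1 p.2) q (simplexMeasure T (1 + q * γ)) *
        ENNReal.ofReal ((T / 2 ^ n) ^ (γ - 1 / q)) := by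
  set B := eLpNorm' (fun p => ρ p.1 p.2) q (simplexMeasure T (1 + q * γ))
  have hl : ∀ n : ℕ, 0 < T / 2 ^ n := fun n => by positivity
  set I := chainIcc T t n
  set I' := chainIcc T t (n + 1)
  have hmt : Measurable (ρ t) := hρ.measurable.comp measurable_prodMk_left
  have key : ENNReal.ofReal (T / 2 ^ (n + 1)) * ∫⁻ u in I, ρ t u ≤
      ENNReal.ofReal (T / 2 ^ n) * (∫⁻ v in I', ρ t v) + ∫⁻ u in I, ∫⁻ v in I, ρ u v := by
    calc ENNReal.ofReal (T / 2 ^ (n + 1)) * ∫⁻ u in I, ρ t u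
        = ∫⁻ u in I, ∫⁻ _ in I', ρ t u := by
          simp only [lintegral_const, Measure.restrict_apply MeasurableSet.univ, univ_inter]
          rw [lintegral_mul_const _ hmt, volume_chainIcc, mul_comm]
      _ ≤ ∫⁻ u in I, ∫⁻ v in I', (ρ t v + ρ u v) := by
          refine setLIntegral_mono' measurableSet_Icc fun u hu =>
            setLIntegral_mono' measurableSet_Icc fun v hv => ?_
          rw [hρ.symm u v]
          exact hρ.triangle _ ht _ (chainIcc_subset ht _ hv) _ (chainIcc_subset ht _ hu)
      _ = ∫⁻ u in I, ((∫⁻ v in I', ρ t v) + ∫⁻ v in I', ρ u v) := by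
          refine lintegral_congr fun u => lintegral_add_left hmt _
      _ = ENNReal.ofReal (T / 2 ^ n) * (∫⁻ v in I', ρ t v) + ∫⁻ u in I, ∫⁻ v in I', ρ u v := by
          rw [lintegral_add_left measurable_const, lintegral_const,
            Measure.restrict_apply MeasurableSet.univ, univ_inter, volume_chainIcc, mul_comm]
      _ ≤ _ := by
          gcongr
          exact chainIcc_succ_subset ht n
  have hI : ∫⁻ u in I, ∫⁻ v in I, ρ u v ≤
      2 * B * ENNReal.ofReal ((T / 2 ^ n) ^ (2 + (γ - 1 / q))) := by
    have hsub := chainIcc_subset ht n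
    have hlen : t + (T - t) / 2 ^ n - (t - t / 2 ^ n) = T / 2 ^ n := by ring
    have hlt : t - t / 2 ^ n < t + (T - t) / 2 ^ n := by linarith [hl n]
    have := lintegral_lintegral_interval_le (a := t - t / 2 ^ n) (b := t + (T - t) / 2 ^ n)
      hρ hq hγ (hsub (left_mem_Icc.2 hlt.le)).1 hlt (hsub (right_mem_Icc.2 hlt.le)).2
    rwa [hlen] at this
  set l := T / 2 ^ n with hl_def
  have hl' : T / 2 ^ (n + 1) = l / 2 := by rw [hl_def, pow_succ]; field_simp
  have h0 : 0 < l := hl n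
  have hne : ENNReal.ofReal l ≠ 0 := (ENNReal.ofReal_pos.2 h0).ne'
  have hne' : ENNReal.ofReal (l / 2) ≠ 0 := (ENNReal.ofReal_pos.2 (half_pos h0)).ne'
  have htop : ENNReal.ofReal l ≠ ⊤ := ENNReal.ofReal_ne_top
  have htop' : ENNReal.ofReal (l / 2) ≠ ⊤ := ENNReal.ofReal_ne_top
  rw [hl'] at key
  have e1 : (ENNReal.ofReal l)⁻¹ = ENNReal.ofReal l⁻¹ := (ENNReal.ofReal_inv_of_pos h0).symm
  have e2 : (ENNReal.ofReal (l / 2))⁻¹ = ENNReal.ofReal (l / 2)⁻¹ :=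
    (ENNReal.ofReal_inv_of_pos (half_pos h0)).symm
  calc chainMean T ρ t n
      = (ENNReal.ofReal l)⁻¹ * (ENNReal.ofReal (l / 2))⁻¹ *
          (ENNReal.ofReal (l / 2) * ∫⁻ u in I, ρ t u) := by
        rw [mul_assoc, ← mul_assoc (ENNReal.ofReal (l / 2))⁻¹, ENNReal.inv_mul_cancel hne' htop',
          one_mul]
        rfl
    _ ≤ (ENNReal.ofReal l)⁻¹ * (ENNReal.ofReal (l / 2))⁻¹ *
          (ENNReal.ofReal l * (∫⁻ v in I', ρ t v) +
            2 * B * ENNReal.ofReal (l ^ (2 + (γ - 1 / q)))) := by gcongr; exact key.trans (add_le_add_right hI _)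
    _ = (ENNReal.ofReal (l / 2))⁻¹ * (∫⁻ v in I', ρ t v) +
          2 * B * (ENNReal.ofReal l⁻¹ * ENNReal.ofReal (l / 2)⁻¹ *
            ENNReal.ofReal (l ^ (2 + (γ - 1 / q)))) := by
        rw [mul_add, ← e1, ← e2]
        congr 1
        · rw [mul_comm (ENNReal.ofReal l)⁻¹, mul_assoc, ← mul_assoc (ENNReal.ofReal l)⁻¹,
            ENNReal.inv_mul_cancel hne htop, one_mul]
        · ring
    _ = chainMean T ρ t (n + 1) + 4 * B * ENNReal.ofReal (l ^ (γ - 1 / q)) := by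
        rw [← ENNReal.ofReal_mul (by positivity), ← ENNReal.ofReal_mul (by positivity),
          Real.rpow_add h0, chainMean, hl']
        refine congrArg₂ _ rfl ?_
        have : l⁻¹ * (l / 2)⁻¹ * (l ^ (2 : ℝ) * l ^ (γ - 1 / q)) = 2 * l ^ (γ - 1 / q) := by
          rw [Real.rpow_two]; field_simp
        rw [this, ENNReal.ofReal_mul (by norm_num), ENNReal.ofReal_ofNat]
        ring

theorem tendsto_chainMean (hT : 0 < T) (hρ : IsBesovMetric T ρ) {t : ℝ} (ht : t ∈ Icc 0 T) :
    Tendsto (chainMean T ρ t) atTop (𝓝 0) := by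
  rw [ENNReal.tendsto_nhds_zero]
  intro ε hε
  have h1 := (ENNReal.tendsto_nhds_zero.1 (hρ.continuous t ht)) ε hε
  obtain ⟨δ, hδ, h2⟩ := Metric.mem_nhdsWithin_iff.1 h1
  have h3 : Tendsto (fun n : ℕ => T * (1 / 2) ^ n) atTop (𝓝 0) := by
    simpa using (tendsto_pow_atTop_nhds_zero_of_lt_one (by norm_num : (0 : ℝ) ≤ 1 / 2)
      (by norm_num)).const_mul T
  filter_upwards [h3.eventually (gt_mem_nhds hδ)] with n hn
  have hn' : T / 2 ^ n < δ := by rwa [one_div, inv_pow, ← div_eq_mul_inv] at hn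
  have h4 : ∫⁻ u in chainIcc T t n, ρ t u ≤ ∫⁻ _ in chainIcc T t n, ε := by
    refine setLIntegral_mono' measurableSet_Icc fun u hu => h2 ⟨?_, chainIcc_subset ht n hu⟩
    rw [Metric.mem_ball, Real.dist_eq, abs_lt]
    have e : T / 2 ^ n = t / 2 ^ n + (T - t) / 2 ^ n := by ring
    have p1 : 0 ≤ t / 2 ^ n := div_nonneg ht.1 (by positivity)
    have p2 : 0 ≤ (T - t) / 2 ^ n := div_nonneg (sub_nonneg.2 ht.2) (by positivity)
    constructor <;> linarith [hu.1, hu.2]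
  rw [setLIntegral_const, volume_chainIcc] at h4
  have hl : 0 < T / 2 ^ n := by positivity
  calc chainMean T ρ t n ≤ (ENNReal.ofReal (T / 2 ^ n))⁻¹ * (ε * ENNReal.ofReal (T / 2 ^ n)) := by
        unfold chainMean; gcongr
    _ = ε := by
        rw [mul_comm ε, ← mul_assoc, ENNReal.inv_mul_cancel (ENNReal.ofReal_pos.2 hl).ne'
          ENNReal.ofReal_ne_top, one_mul]

/-- The means over intervals shrinking to t tend to zero by continuity on the diagonal, and their
successive differences are geometric because γ > 1/q. At stage 0 the intervals of s and t are both
[0,T], so the two chains are joined by a single triangle inequality. Allowing a pseudo-metric lets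
the estimate serve both paths in space and families of slices in time. -/
theorem exists_besovMetric_le (hT : 0 < T) (hq : 1 ≤ q) (hγ : 1 < q * γ) :
    ∃ C : ℝ≥0∞, C ≠ ⊤ ∧ ∀ ρ, IsBesovMetric T ρ → ∀ s ∈ Icc 0 T, ∀ t ∈ Icc 0 T,
      ρ s t ≤ C * eLpNorm' (fun p => ρ p.1 p.2) q (simplexMeasure T (1 + q * γ)) := by
  have hq0 : 0 < q := by linarith
  have hγ' : 0 < γ - 1 / q := by
    rw [sub_pos, div_lt_iff₀ hq0]; linarith
  have hγ0 : 0 < γ := hγ'.trans_le (sub_le_self _ (by positivity))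
  set C' : ℝ≥0∞ := ∑' n : ℕ, ENNReal.ofReal ((T / 2 ^ n) ^ (γ - 1 / q)) with hC'
  have hC'top : C' ≠ ⊤ := by
    have h : ∀ n : ℕ, (T / 2 ^ n) ^ (γ - 1 / q) =
        T ^ (γ - 1 / q) * ((2 ^ (γ - 1 / q))⁻¹) ^ n := fun n => by
      rw [Real.div_rpow hT.le (by positivity), ← Real.rpow_natCast_mul (by norm_num), mul_comm,
        Real.rpow_mul_natCast (by norm_num), inv_pow]; rfl
    have hs : Summable fun n : ℕ => (T / 2 ^ n) ^ (γ - 1 / q) := by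
      simp only [h]
      refine (summable_geometric_of_lt_one (by positivity) ?_).mul_left _
      exact inv_lt_one_of_one_lt₀ (Real.one_lt_rpow one_lt_two hγ')
    exact hs.tsum_ofReal_ne_top
  refine ⟨8 * C', ENNReal.mul_ne_top (by norm_num) hC'top, fun ρ hρ s hs t ht => ?_⟩
  set B := eLpNorm' (fun p => ρ p.1 p.2) q (simplexMeasure T (1 + q * γ))
  have h0 : ∀ t ∈ Icc 0 T, chainMean T ρ t 0 ≤ 4 * B * C' := by
    intro t ht
    have h1 : ∀ n : ℕ, chainMean T ρ t 0 ≤ chainMean T ρ t n + 4 * B *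
        ∑ i ∈ Finset.range n, ENNReal.ofReal ((T / 2 ^ i) ^ (γ - 1 / q)) := by
      intro n
      induction n with
      | zero => simp
      | succ n ih =>
        rw [Finset.sum_range_succ, mul_add]
        refine ih.trans ?_
        rw [add_comm (4 * B * _), ← add_assoc]
        gcongr
        exact chainMean_le_succ hT hρ hq hγ0 ht n
    have h2 : ∀ n : ℕ, chainMean T ρ t 0 ≤ chainMean T ρ t n + 4 * B * C' := fun n =>
      (h1 n).trans (by gcongr; exact ENNReal.sum_le_tsum _)
    have h3 := (tendsto_chainMean hT hρ ht).add_const (4 * B * C')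
    rw [zero_add] at h3
    exact ge_of_tendsto' h3 h2
  have hI : ∀ t, chainIcc T t 0 = Icc 0 T := fun t => by simp [chainIcc]
  have hTne : ENNReal.ofReal T ≠ 0 := (ENNReal.ofReal_pos.2 hT).ne'
  have h1 : ENNReal.ofReal T * ρ s t ≤ ∫⁻ u in Icc 0 T, (ρ s u + ρ t u) := by
    calc ENNReal.ofReal T * ρ s t = ∫⁻ _ in Icc 0 T, ρ s t := by
          rw [setLIntegral_const, Real.volume_Icc, sub_zero, mul_comm]
      _ ≤ _ := setLIntegral_mono' measurableSet_Icc fun u hu => by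
          rw [hρ.symm t u]; exact hρ.triangle s hs u hu t ht
  rw [lintegral_add_left (f := fun u => ρ s u) (hρ.measurable.comp measurable_prodMk_left)] at h1
  have h2 : ρ s t ≤ chainMean T ρ s 0 + chainMean T ρ t 0 := by
    have : ρ s t = (ENNReal.ofReal T)⁻¹ * (ENNReal.ofReal T * ρ s t) := by
      rw [← mul_assoc, ENNReal.inv_mul_cancel hTne ENNReal.ofReal_ne_top, one_mul]
    rw [this]
    simp only [chainMean, hI, pow_zero, div_one]
    rw [← mul_add]
    gcongr
  refine h2.trans ((add_le_add (h0 s hs) (h0 t ht)).trans (le_of_eq ?_))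
  ring

end Chaining

/-! ### Properties of the Besov norms -/

section BesovNorm

theorem eLpNorm'_mono_ennreal {X : Type*} [MeasurableSpace X] {μ : Measure X} {f g : X → ℝ≥0∞}
    {q : ℝ} (hq : 0 ≤ q) (h : ∀ᵐ x ∂μ, f x ≤ g x) : eLpNorm' f q μ ≤ eLpNorm' g q μ :=
  eLpNorm'_mono_enorm_ae hq h

/-- Fatou's lemma, the source of the lower semicontinuity of all the Besov norms under pointwise
convergence. -/
theorem eLpNorm'_le_of_le_liminf {X : Type*} [MeasurableSpace X] {μ : Measure X}
    {f : ℕ → X → ℝ≥0∞} {g : X → ℝ≥0∞} {q : ℝ} (hq : 0 < q) (hf : ∀ n, Measurable (f n))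
    (hg : ∀ᵐ x ∂μ, g x ≤ liminf (fun n => f n x) atTop) {c : ℝ≥0∞}
    (hc : ∀ᶠ n in atTop, eLpNorm' (f n) q μ ≤ c) : eLpNorm' g q μ ≤ c := by
  have h : ∫⁻ x, g x ^ q ∂μ ≤ c ^ q := by
    calc ∫⁻ x, g x ^ q ∂μ ≤ ∫⁻ x, liminf (fun n => f n x ^ q) atTop ∂μ := by
          refine lintegral_mono_ae (hg.mono fun x hx => ?_)
          refine (ENNReal.rpow_le_rpow hx hq.le).trans (le_of_eq ?_)
          exact ((ENNReal.orderIsoRpow q hq).liminf_apply (u := fun n => f n x))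
      _ ≤ liminf (fun n => ∫⁻ x, f n x ^ q ∂μ) atTop :=
          lintegral_liminf_le fun n => (hf n).pow_const q
      _ ≤ c ^ q := by
          refine liminf_le_of_frequently_le' (hc.frequently.mono fun n hn => ?_)
          have := ENNReal.rpow_le_rpow hn hq.le
          rwa [eLpNorm'_eq_lintegral_enorm, ← ENNReal.rpow_mul, one_div_mul_cancel hq.ne',
            ENNReal.rpow_one] at this
  have h2 := ENNReal.rpow_le_rpow h (show (0 : ℝ) ≤ 1 / q by positivity)
  rwa [← ENNReal.rpow_mul, mul_one_div_cancel hq.ne', ENNReal.rpow_one] at h2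

variable {V : Type*} [NormedAddCommGroup V]

theorem besovNorm_congr {α m : ℝ} {A B : ℝ → ℝ → V}
    (h : ∀ p ∈ simplex 1, ‖A p.1 p.2‖ = ‖B p.1 p.2‖) : besovNorm α m A = besovNorm α m B := by
  unfold besovNorm
  congr 1
  exact setLIntegral_congr_fun (measurableSet_simplex 1) fun p hp => by simp only [h p hp]

theorem sheetBesovNorm_congr {T β α m : ℝ} {G H : ℝ → ℝ → ℝ → V}
    (h : ∀ t ∈ Icc 0 T, ∀ p ∈ simplex 1, G t p.1 p.2 = H t p.1 p.2) :
    sheetBesovNorm T β α m G = sheetBesovNorm T β α m H := by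
  unfold sheetBesovNorm
  congr 1
  refine setLIntegral_congr_fun (measurableSet_simplex T) fun q hq =>
    setLIntegral_congr_fun (measurableSet_simplex 1) fun p hp => ?_
  simp only [h q.1 ⟨hq.1, hq.2.1.trans hq.2.2⟩ p hp, h q.2 ⟨hq.1.trans hq.2.1, hq.2.2⟩ p hp]

theorem besovNorm_sub_comm {α m : ℝ} (A B : ℝ → ℝ → V) :
    besovNorm α m (fun x y => A x y - B x y) = besovNorm α m (fun x y => B x y - A x y) :=
  besovNorm_congr fun _ _ => norm_sub_rev _ _

theorem besovNorm_of_eq_zero {α m : ℝ} (hm : 0 < m) {A : ℝ → ℝ → V}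
    (h : ∀ p ∈ simplex 1, A p.1 p.2 = 0) : besovNorm α m A = 0 := by
  have : besovNorm α m A = besovNorm α m (fun _ _ => (0 : V)) :=
    besovNorm_congr fun p hp => by rw [h p hp]
  rw [this, besovNorm_eq hm.le]
  exact eLpNorm'_zero hm

theorem besovNorm_mono_exponent {α α' m : ℝ} (hm : 0 ≤ m) (h : α ≤ α') (A : ℝ → ℝ → V) :
    besovNorm α m A ≤ besovNorm α' m A := by
  unfold besovNorm
  gcongr ?_ ^ _
  refine lintegral_mono_ae ?_
  filter_upwards [ae_restrict_mem (measurableSet_simplex 1), ae_restrict_of_ae ae_ne_diag]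
    with p hp hne
  have hd : 0 < p.2 - p.1 := sub_pos.2 (lt_of_le_of_ne hp.2.1 hne)
  refine ENNReal.ofReal_le_ofReal (div_le_div_of_nonneg_left (by positivity) (by positivity) ?_)
  refine Real.rpow_le_rpow_of_exponent_ge hd (by linarith [hp.1, hp.2.2]) ?_
  gcongr

/-- The norm of `fun x y => y - x`. -/
def besovConst (α m : ℝ) : ℝ≥0∞ := simplexMeasure 1 (1 - m * (1 - α)) univ ^ (1 / m)

theorem besovConst_ne_top {α m : ℝ} (hm : 0 < m) (hα : α < 1) : besovConst α m ≠ ⊤ :=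
  ENNReal.rpow_ne_top_of_nonneg (by positivity)
    (simplexMeasure_univ_lt_top (mul_pos hm (sub_pos.2 hα)) 1).ne

theorem besovNorm_le_of_le {α m : ℝ} (hm : 0 < m) {A : ℝ → ℝ → V} {c : ℝ}
    (h : ∀ p ∈ simplex 1, ‖A p.1 p.2‖ ≤ c * (p.2 - p.1)) :
    besovNorm α m A ≤ ENNReal.ofReal c * besovConst α m := by
  have e : besovNorm α m A =
      eLpNorm' (fun p : ℝ × ℝ => ‖A p.1 p.2‖ₑ) m (simplexMeasure 1 (1 + m * α)) := by
    rw [besovNorm_eq hm.le]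
    exact (eLpNorm'_enorm).symm
  rw [e, eLpNorm'_simplexMeasure_eq (b := 1) hm, besovConst]
  set ν := simplexMeasure 1 (1 - m * (1 - α))
  have h1 : eLpNorm' (fun p : ℝ × ℝ => ‖A p.1 p.2‖ₑ * ENNReal.ofReal ((p.2 - p.1) ^ (-1 : ℝ))) m ν ≤
      eLpNorm' (fun _ : ℝ × ℝ => ENNReal.ofReal c) m ν := by
    refine eLpNorm'_mono_ennreal hm.le (ae_simplexMeasure fun x y hx hxy hy => ?_)
    have hd : 0 < y - x := sub_pos.2 hxy
    have := h (x, y) ⟨hx, hxy.le, hy⟩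
    rw [← ofReal_norm, ← ENNReal.ofReal_mul (norm_nonneg _), Real.rpow_neg_one, ← div_eq_mul_inv]
    exact ENNReal.ofReal_le_ofReal ((div_le_iff₀ hd).2 this)
  refine h1.trans (le_of_eq ?_)
  rw [eLpNorm'_const _ hm, enorm_eq_self]

variable [MeasurableSpace V] [BorelSpace V] [SecondCountableTopology V]

theorem besovNorm_add_le {α m : ℝ} (hm : 1 ≤ m) {A B : ℝ → ℝ → V}
    (hA : Measurable fun p : ℝ × ℝ => A p.1 p.2) (hB : Measurable fun p : ℝ × ℝ => B p.1 p.2) :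
    besovNorm α m (fun x y => A x y + B x y) ≤ besovNorm α m A + besovNorm α m B := by
  have h0 : 0 ≤ m := by linarith
  rw [besovNorm_eq h0, besovNorm_eq h0, besovNorm_eq h0]
  exact eLpNorm'_add_le hA.aestronglyMeasurable hB.aestronglyMeasurable hm

theorem besovNorm_triangle {α m : ℝ} (hm : 1 ≤ m) {A B C : ℝ → ℝ → V}
    (hA : Measurable fun p : ℝ × ℝ => A p.1 p.2) (hB : Measurable fun p : ℝ × ℝ => B p.1 p.2)
    (hC : Measurable fun p : ℝ × ℝ => C p.1 p.2) :
    besovNorm α m (fun x y => A x y - C x y) ≤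
      besovNorm α m (fun x y => A x y - B x y) + besovNorm α m (fun x y => B x y - C x y) := by
  have := besovNorm_add_le (α := α) (A := fun x y => A x y - B x y)
    (B := fun x y => B x y - C x y) hm (hA.sub hB) (hB.sub hC)
  simpa using! this

omit [SecondCountableTopology V] in
theorem besovNorm_le_of_tendsto {α m : ℝ} (hm : 0 < m) {A : ℕ → ℝ → ℝ → V} {B : ℝ → ℝ → V}
    (hA : ∀ n, Measurable fun p : ℝ × ℝ => A n p.1 p.2)
    (h : ∀ p ∈ simplex 1, Tendsto (fun n => A n p.1 p.2) atTop (𝓝 (B p.1 p.2))) {c : ℝ≥0∞}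
    (hc : ∀ᶠ n in atTop, besovNorm α m (A n) ≤ c) : besovNorm α m B ≤ c := by
  rw [besovNorm_eq hm.le, ← eLpNorm'_enorm]
  refine eLpNorm'_le_of_le_liminf (f := fun n (p : ℝ × ℝ) => ‖A n p.1 p.2‖ₑ) hm
    (fun n => (hA n).enorm) (ae_simplexMeasure fun x y hx hxy hy => ?_) (hc.mono fun n hn => ?_)
  · exact ((h (x, y) ⟨hx, hxy.le, hy⟩).enorm.liminf_eq).ge
  · rwa [eLpNorm'_enorm (f := fun p : ℝ × ℝ => A n p.1 p.2), ← besovNorm_eq hm.le]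

omit [SecondCountableTopology V] in
theorem measurable_besovNorm {X : Type*} [MeasurableSpace X] {α m : ℝ} (hm : 0 ≤ m)
    {A : X → ℝ → ℝ → V} (hA : Measurable fun p : X × ℝ × ℝ => A p.1 p.2.1 p.2.2) :
    Measurable fun x => besovNorm α m (A x) := by
  have h : ∀ x, besovNorm α m (A x) =
      (∫⁻ p, ‖A x p.1 p.2‖ₑ ^ m ∂simplexMeasure 1 (1 + m * α)) ^ (1 / m) := fun x => by
    rw [besovNorm_eq hm, eLpNorm'_eq_lintegral_enorm]
  simp only [h]
  exact ((hA.enorm.pow_const m).lintegral_prod_right').pow_const _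

theorem measurable_sheetBesovNorm {X : Type*} [MeasurableSpace X] {T β α m : ℝ} (hm : 0 < m)
    {G : X → ℝ → ℝ → ℝ → V}
    (hG : Measurable fun p : X × ℝ × ℝ × ℝ => G p.1 p.2.1 p.2.2.1 p.2.2.2) :
    Measurable fun x => sheetBesovNorm T β α m (G x) := by
  simp only [sheetBesovNorm_eq hm, eLpNorm'_eq_lintegral_enorm, enorm_eq_self]
  have h : Measurable fun z : X × ℝ × ℝ =>
      besovNorm α m fun x y => G z.1 z.2.2 x y - G z.1 z.2.1 x y := by
    refine measurable_besovNorm hm.le ?_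
    have h1 : Measurable fun p : (X × ℝ × ℝ) × ℝ × ℝ => (p.1.1, p.1.2.2, p.2.1, p.2.2) := by
      fun_prop
    have h2 : Measurable fun p : (X × ℝ × ℝ) × ℝ × ℝ => (p.1.1, p.1.2.1, p.2.1, p.2.2) := by
      fun_prop
    exact (hG.comp h1).sub (hG.comp h2)
  exact ((h.pow_const m).lintegral_prod_right').pow_const _

end BesovNorm

/-! ### Sequences of sheets -/

section Sheet

variable {V : Type*} [NormedAddCommGroup V] [MeasurableSpace V]

/-- A measurable function of `(t,x,y)`, null at `t = 0`, whose slices are continuous in `t` for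
the Besov norm. -/
structure IsSheet (T α m : ℝ) (G : ℝ → ℝ → ℝ → V) : Prop where
  measurable : Measurable fun p : ℝ × ℝ × ℝ => G p.1 p.2.1 p.2.2
  zero : ∀ p ∈ simplex 1, G 0 p.1 p.2 = 0
  continuous : ∀ t ∈ Icc 0 T,
    Tendsto (fun s => besovNorm α m fun x y => G s x y - G t x y) (𝓝[Icc 0 T] t) (𝓝 0)

variable [BorelSpace V] [SecondCountableTopology V] {T α β m : ℝ} {G H : ℝ → ℝ → ℝ → V}

theorem measurable_slice {V : Type*} [MeasurableSpace V] {G : ℝ → ℝ → ℝ → V}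
    (hG : Measurable fun p : ℝ × ℝ × ℝ => G p.1 p.2.1 p.2.2) (t : ℝ) :
    Measurable fun p : ℝ × ℝ => G t p.1 p.2 :=
  hG.comp (g := fun p : ℝ × ℝ × ℝ => G p.1 p.2.1 p.2.2) (f := fun p : ℝ × ℝ => (t, p))
    measurable_prodMk_left

theorem IsSheet.sub (hm : 1 ≤ m) (hG : IsSheet T α m G) (hH : IsSheet T α m H) :
    IsSheet T α m fun t x y => G t x y - H t x y where
  measurable := hG.measurable.sub hH.measurable
  zero p hp := by rw [hG.zero p hp, hH.zero p hp, sub_zero]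
  continuous t ht := by
    have h := (hG.continuous t ht).add (hH.continuous t ht)
    rw [add_zero] at h
    refine tendsto_of_tendsto_of_tendsto_of_le_of_le tendsto_const_nhds h (fun _ => zero_le)
      fun s => ?_
    have h1 := besovNorm_add_le (α := α) (A := fun x y => G s x y - G t x y)
      (B := fun x y => H t x y - H s x y) hm
      ((measurable_slice hG.measurable s).sub (measurable_slice hG.measurable t))
      ((measurable_slice hH.measurable t).sub (measurable_slice hH.measurable s))
    rw [besovNorm_sub_comm (H t) (H s)] at h1
    refine le_trans (le_of_eq ?_) h1
    refine besovNorm_congr fun p _ => ?_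
    congr 1; abel

theorem measurable_time_besovNorm (hm : 0 ≤ m)
    (hG : Measurable fun p : ℝ × ℝ × ℝ => G p.1 p.2.1 p.2.2) :
    Measurable fun q : ℝ × ℝ => besovNorm α m fun x y => G q.2 x y - G q.1 x y := by
  refine measurable_besovNorm hm ?_
  have h1 : Measurable fun p : (ℝ × ℝ) × ℝ × ℝ => (p.1.2, p.2.1, p.2.2) := by fun_prop
  have h2 : Measurable fun p : (ℝ × ℝ) × ℝ × ℝ => (p.1.1, p.2.1, p.2.2) := by fun_prop
  exact (hG.comp h1).sub (hG.comp h2)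

theorem IsSheet.isBesovMetric (hm : 1 ≤ m) (hG : IsSheet T α m G) :
    IsBesovMetric T fun s t => besovNorm α m fun x y => G t x y - G s x y where
  measurable := measurable_time_besovNorm (by linarith) hG.measurable
  symm s t := besovNorm_sub_comm _ _
  self t := besovNorm_of_eq_zero (by linarith) fun p _ => sub_self _
  triangle s _ t _ u _ := by
    rw [add_comm]
    exact besovNorm_triangle hm (measurable_slice hG.measurable u)
      (measurable_slice hG.measurable t) (measurable_slice hG.measurable s)
  continuous t ht := hG.continuous t ht

/-- Chaining in time between 0 and `t`: the sheet vanishes at time 0, so the distance of the two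
slices is the norm of the slice at `t`. -/
theorem exists_besovNorm_le_sheet (V : Type*) [NormedAddCommGroup V] [MeasurableSpace V]
    [BorelSpace V] [SecondCountableTopology V] (hT : 0 < T) (hm : 1 ≤ m) (hβ : 1 < m * β) (α : ℝ) :
    ∃ C : ℝ≥0∞, C ≠ ⊤ ∧ ∀ G : ℝ → ℝ → ℝ → V, IsSheet T α m G → ∀ t ∈ Icc 0 T,
      besovNorm α m (G t) ≤ C * sheetBesovNorm T β α m G := by
  obtain ⟨C, hC, h⟩ := exists_besovMetric_le hT hm hβ
  refine ⟨C, hC, fun G hG t ht => ?_⟩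
  have h1 := h _ (hG.isBesovMetric hm) 0 ⟨le_rfl, hT.le⟩ t ht
  rw [sheetBesovNorm_eq (by linarith)]
  refine le_trans (le_of_eq ?_) h1
  exact besovNorm_congr fun p hp => by rw [hG.zero p hp, sub_zero]

theorem sheetBesovNorm_add_le (hm : 1 ≤ m)
    (hG : Measurable fun p : ℝ × ℝ × ℝ => G p.1 p.2.1 p.2.2)
    (hH : Measurable fun p : ℝ × ℝ × ℝ => H p.1 p.2.1 p.2.2) :
    sheetBesovNorm T β α m (fun t x y => G t x y + H t x y) ≤
      sheetBesovNorm T β α m G + sheetBesovNorm T β α m H := by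
  have h0 : 0 < m := by linarith
  rw [sheetBesovNorm_eq h0, sheetBesovNorm_eq h0, sheetBesovNorm_eq h0]
  have h1 := eLpNorm'_add_le
    (measurable_time_besovNorm (α := α) h0.le hG).aestronglyMeasurable
    (measurable_time_besovNorm (α := α) h0.le hH).aestronglyMeasurable hm
    (μ := simplexMeasure T (1 + m * β))
  refine le_trans (eLpNorm'_mono_ennreal h0.le (Eventually.of_forall fun q => ?_)) h1
  have h2 := besovNorm_add_le (α := α) (A := fun x y => G q.2 x y - G q.1 x y)
    (B := fun x y => H q.2 x y - H q.1 x y) hm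
    ((measurable_slice hG q.2).sub (measurable_slice hG q.1))
    ((measurable_slice hH q.2).sub (measurable_slice hH q.1))
  refine le_trans (le_of_eq (besovNorm_congr fun p _ => ?_)) h2
  congr 1; abel

omit [MeasurableSpace V] [BorelSpace V] [SecondCountableTopology V] in
theorem sheetBesovNorm_sub_comm (G H : ℝ → ℝ → ℝ → V) :
    sheetBesovNorm T β α m (fun t x y => G t x y - H t x y) =
      sheetBesovNorm T β α m (fun t x y => H t x y - G t x y) := by
  unfold sheetBesovNorm
  congr 1
  refine lintegral_congr fun q => lintegral_congr fun p => ?_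
  rw [show H q.2 p.1 p.2 - G q.2 p.1 p.2 - (H q.1 p.1 p.2 - G q.1 p.1 p.2) =
    -(G q.2 p.1 p.2 - H q.2 p.1 p.2 - (G q.1 p.1 p.2 - H q.1 p.1 p.2)) by abel, norm_neg]

theorem sheetBesovNorm_le_of_tendsto (hm : 0 < m) {G : ℕ → ℝ → ℝ → ℝ → V}
    (hG : ∀ n, Measurable fun p : ℝ × ℝ × ℝ => G n p.1 p.2.1 p.2.2)
    (h : ∀ t ∈ Icc 0 T, ∀ p ∈ simplex 1,
      Tendsto (fun n => G n t p.1 p.2) atTop (𝓝 (H t p.1 p.2))) {c : ℝ≥0∞}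
    (hc : ∀ᶠ n in atTop, sheetBesovNorm T β α m (G n) ≤ c) : sheetBesovNorm T β α m H ≤ c := by
  rw [sheetBesovNorm_eq hm]
  refine eLpNorm'_le_of_le_liminf
    (f := fun n (q : ℝ × ℝ) => besovNorm α m fun x y => G n q.2 x y - G n q.1 x y) hm
    (fun n => measurable_time_besovNorm hm.le (hG n))
    (ae_simplexMeasure fun s t hs hst ht => ?_) (hc.mono fun n hn => ?_)
  -- A number above the lower limit bounds the spatial norms along a subsequence, and Fatou in space
  -- along it bounds the norm of the limit.
  · refine le_of_forall_gt_imp_ge_of_dense fun c hc => ?_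
    have hfr := frequently_lt_of_liminf_lt (by isBoundedDefault) hc
    obtain ⟨φ, hφ, hφc⟩ := extraction_of_frequently_atTop hfr
    refine besovNorm_le_of_tendsto hm
      (A := fun n x y => G (φ n) t x y - G (φ n) s x y)
      (fun n => (measurable_slice (hG _) t).sub (measurable_slice (hG _) s)) (fun p hp => ?_)
      (Eventually.of_forall fun n => (hφc n).le)
    exact ((h t ⟨hs.trans hst.le, ht⟩ p hp).comp hφ.tendsto_atTop).sub
      ((h s ⟨hs, hst.le.trans ht⟩ p hp).comp hφ.tendsto_atTop)
  · rwa [← sheetBesovNorm_eq hm]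

/-- A sequence of sheets with summable increments, and its pointwise limit. -/
structure IsSheetLimit (T β α m : ℝ) (G : ℕ → ℝ → ℝ → ℝ → V) (H : ℝ → ℝ → ℝ → V) : Prop where
  sheet : ∀ k, IsSheet T α m (G k)
  finite : ∀ k, sheetBesovNorm T β α m (G k) ≠ ⊤
  summable : ∑' k, sheetBesovNorm T β α m (fun t x y => G (k + 1) t x y - G k t x y) ≠ ⊤
  measurable : Measurable fun p : ℝ × ℝ × ℝ => H p.1 p.2.1 p.2.2
  tendsto : ∀ t ∈ Icc 0 T, ∀ p ∈ simplex 1,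
    Tendsto (fun n => G n t p.1 p.2) atTop (𝓝 (H t p.1 p.2))

namespace IsSheetLimit

variable {G : ℕ → ℝ → ℝ → ℝ → V}

theorem sheet_sub_le (hm : 1 ≤ m) (hG : ∀ k, IsSheet T α m (G k)) (k n : ℕ) :
    sheetBesovNorm T β α m (fun t x y => G (k + n) t x y - G k t x y) ≤
      ∑' j, sheetBesovNorm T β α m (fun t x y => G (k + j + 1) t x y - G (k + j) t x y) := by
  refine le_trans ?_ (ENNReal.sum_le_tsum (Finset.range n))
  induction n with
  | zero =>
    have : sheetBesovNorm T β α m (fun t x y => G (k + 0) t x y - G k t x y) = 0 := by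
      rw [sheetBesovNorm_eq (by linarith)]
      have : ∀ q : ℝ × ℝ, besovNorm α m (fun x y => (G (k + 0) q.2 x y - G k q.2 x y)
          - (G (k + 0) q.1 x y - G k q.1 x y)) = 0 := fun q =>
        besovNorm_of_eq_zero (by linarith) fun p _ => by simp
      simp only [this]
      exact eLpNorm'_zero (by linarith)
    rw [this]; exact zero_le
  | succ n ih =>
    rw [Finset.sum_range_succ]
    have h := sheetBesovNorm_add_le (T := T) (β := β) (α := α)
      (G := fun t x y => G (k + n) t x y - G k t x y)
      (H := fun t x y => G (k + n + 1) t x y - G (k + n) t x y) hm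
      ((hG _).measurable.sub (hG _).measurable) ((hG _).measurable.sub (hG _).measurable)
    refine le_trans (le_of_eq ?_) (h.trans (add_le_add_left ih _))
    congr 1
    ext t x y
    rw [← add_assoc]; abel

/-- Telescoping bounds G_{k+n} - G_k by the tail of the series; Fatou lets `n` tend to infinity, so
Besov convergence to the pointwise limit needs no completeness of the space. -/
theorem sheet_le (hm : 1 ≤ m) (h : IsSheetLimit T β α m G H) (k : ℕ) :
    sheetBesovNorm T β α m (fun t x y => G k t x y - H t x y) ≤
      ∑' j, sheetBesovNorm T β α m (fun t x y => G (k + j + 1) t x y - G (k + j) t x y) := by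
  rw [sheetBesovNorm_sub_comm]
  refine sheetBesovNorm_le_of_tendsto (G := fun n t x y => G (k + n) t x y - G k t x y)
    (by linarith) (fun n => (h.sheet _).measurable.sub (h.sheet _).measurable) (fun t ht p hp => ?_)
    (Eventually.of_forall fun n => sheet_sub_le hm h.sheet k n)
  have : Tendsto (fun n => k + n) atTop atTop :=
    tendsto_atTop_mono (fun n => Nat.le_add_left n k) tendsto_id
  exact ((h.tendsto t ht p hp).comp this).sub_const _

theorem tendsto_tail {f : ℕ → ℝ≥0∞} (h : ∑' k, f k ≠ ⊤) :
    Tendsto (fun k => ∑' j, f (k + j)) atTop (𝓝 0) := by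
  have := ENNReal.tendsto_sum_nat_add f h
  simpa only [add_comm] using this

theorem tendsto_sheet (hm : 1 ≤ m) (h : IsSheetLimit T β α m G H) :
    Tendsto (fun k => sheetBesovNorm T β α m (fun t x y => G k t x y - H t x y)) atTop (𝓝 0) :=
  tendsto_of_tendsto_of_tendsto_of_le_of_le tendsto_const_nhds
    (tendsto_tail h.summable) (fun _ => zero_le) fun k => h.sheet_le hm k

theorem sheet_ne_top (hm : 1 ≤ m) (h : IsSheetLimit T β α m G H) :
    sheetBesovNorm T β α m H ≠ ⊤ := by
  have h1 := h.sheet_le hm 0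
  rw [sheetBesovNorm_sub_comm] at h1
  have h2 := sheetBesovNorm_add_le (T := T) (β := β) (α := α)
    (G := fun t x y => H t x y - G 0 t x y) (H := G 0) hm
    (h.measurable.sub (h.sheet 0).measurable) (h.sheet 0).measurable
  simp only [sub_add_cancel] at h2
  refine ne_top_of_le_ne_top (ENNReal.add_ne_top.2 ⟨?_, h.finite 0⟩) (h2.trans (add_le_add_left h1 _))
  simpa using h.summable

/-- Uniform convergence of the slices. -/
theorem exists_slice_le (hT : 0 < T) (hm : 1 ≤ m) (hβ : 1 < m * β) (h : IsSheetLimit T β α m G H) :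
    ∃ ε : ℕ → ℝ≥0∞, Tendsto ε atTop (𝓝 0) ∧ (∀ k, ε k ≠ ⊤) ∧ ∀ k, ∀ t ∈ Icc 0 T,
      besovNorm α m (fun x y => G k t x y - H t x y) ≤ ε k := by
  obtain ⟨C, hC, hC'⟩ := exists_besovNorm_le_sheet V hT hm hβ α
  set R : ℕ → ℝ≥0∞ := fun k =>
    ∑' j, sheetBesovNorm T β α m (fun t x y => G (k + j + 1) t x y - G (k + j) t x y) with hR
  refine ⟨fun k => C * R k, ?_, fun k => ENNReal.mul_ne_top hC ?_, fun k t ht => ?_⟩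
  · have := ENNReal.Tendsto.const_mul (tendsto_tail h.summable) (Or.inr hC)
    simpa using this
  · refine ne_top_of_le_ne_top h.summable ?_
    exact ENNReal.tsum_comp_le_tsum_of_injective (add_right_injective k) _
  · rw [besovNorm_sub_comm]
    refine besovNorm_le_of_tendsto (A := fun n x y => G (k + n) t x y - G k t x y) (by linarith)
      (fun n => (measurable_slice (h.sheet _).measurable t).sub
        (measurable_slice (h.sheet _).measurable t)) (fun p hp => ?_)
      (Eventually.of_forall fun n => ?_)
    · have : Tendsto (fun n => k + n) atTop atTop :=
    tendsto_atTop_mono (fun n => Nat.le_add_left n k) tendsto_id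
      exact ((h.tendsto t ht p hp).comp this).sub_const _
    · refine (hC' _ ((h.sheet (k + n)).sub hm (h.sheet k)) t ht).trans ?_
      exact mul_le_mul_right (sheet_sub_le hm h.sheet k n) C

theorem slice_ne_top (hT : 0 < T) (hm : 1 ≤ m) (hβ : 1 < m * β) (h : IsSheetLimit T β α m G H)
    {t : ℝ} (ht : t ∈ Icc 0 T) : (∀ k, besovNorm α m (G k t) ≠ ⊤) ∧ besovNorm α m (H t) ≠ ⊤ := by
  obtain ⟨C, hC, hC'⟩ := exists_besovNorm_le_sheet V hT hm hβ α
  have h1 : ∀ k, besovNorm α m (G k t) ≠ ⊤ := fun k =>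
    ne_top_of_le_ne_top (ENNReal.mul_ne_top hC (h.finite k)) (hC' _ (h.sheet k) t ht)
  refine ⟨h1, ?_⟩
  obtain ⟨ε, -, hε, hε'⟩ := h.exists_slice_le hT hm hβ
  have h2 := besovNorm_add_le (α := α) (A := fun x y => H t x y - G 0 t x y) (B := G 0 t) hm
    ((measurable_slice h.measurable t).sub (measurable_slice (h.sheet 0).measurable t))
    (measurable_slice (h.sheet 0).measurable t)
  simp only [sub_add_cancel] at h2
  refine ne_top_of_le_ne_top (ENNReal.add_ne_top.2 ⟨hε 0, h1 0⟩) (h2.trans (add_le_add_left ?_ _))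
  rw [besovNorm_sub_comm]
  exact hε' 0 t ht

/-- Continuity in time passes to the limit because the slices converge uniformly in `t`. -/
theorem continuous_slice (hT : 0 < T) (hm : 1 ≤ m) (hβ : 1 < m * β) (h : IsSheetLimit T β α m G H)
    {t : ℝ} (ht : t ∈ Icc 0 T) :
    Tendsto (fun s => besovNorm α m fun x y => H s x y - H t x y) (𝓝[Icc 0 T] t) (𝓝 0) := by
  obtain ⟨ε, hε, -, hε'⟩ := h.exists_slice_le hT hm hβ
  rw [ENNReal.tendsto_nhds_zero]
  intro δ hδ
  have hδ3 : 0 < δ / 3 := ENNReal.div_pos hδ.ne' (by norm_num)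
  obtain ⟨k, hk⟩ := ((ENNReal.tendsto_nhds_zero.1 hε) (δ / 3) hδ3).exists
  filter_upwards [(ENNReal.tendsto_nhds_zero.1 ((h.sheet k).continuous t ht)) (δ / 3) hδ3,
    self_mem_nhdsWithin] with s hs hsT
  have m1 := measurable_slice h.measurable
  have m2 := measurable_slice (h.sheet k).measurable
  have h1 := besovNorm_triangle (α := α) hm (m1 s) (m2 s) (m1 t)
  have h2 := besovNorm_triangle (α := α) hm (m2 s) (m2 t) (m1 t)
  rw [besovNorm_sub_comm (H s) (G k s)] at h1
  calc _ ≤ _ := h1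
    _ ≤ δ / 3 + (δ / 3 + δ / 3) := add_le_add ((hε' k s hsT).trans hk)
        (h2.trans (add_le_add hs ((hε' k t ht).trans hk)))
    _ = δ := by rw [← add_assoc, ENNReal.add_thirds]

end IsSheetLimit

end Sheet

/-! ### Uniform estimates in space -/

section Space

variable {d : ℕ}

theorem norm_tensor (a b : EuclideanSpace ℝ (Fin d)) : ‖tensor a b‖ = ‖a‖ * ‖b‖ := by
  rw [EuclideanSpace.norm_eq, EuclideanSpace.norm_eq, EuclideanSpace.norm_eq,
    ← Real.sqrt_mul (by positivity), Finset.sum_mul_sum, ← Finset.sum_product']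
  congr 1
  refine Finset.sum_congr rfl fun p _ => ?_
  simp [tensor, mul_pow]

theorem enorm_tensor (a b : EuclideanSpace ℝ (Fin d)) : ‖tensor a b‖ₑ = ‖a‖ₑ * ‖b‖ₑ := by
  rw [← ofReal_norm, ← ofReal_norm, ← ofReal_norm, norm_tensor, ENNReal.ofReal_mul (norm_nonneg _)]

theorem tensor_sub_left (a a' b : EuclideanSpace ℝ (Fin d)) :
    tensor (a - a') b = tensor a b - tensor a' b := by
  ext p; simp [tensor, sub_mul]

theorem tensor_sub_right (a b b' : EuclideanSpace ℝ (Fin d)) :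
    tensor a (b - b') = tensor a b - tensor a b' := by
  ext p; simp [tensor, mul_sub]

theorem tensor_add_left (a a' b : EuclideanSpace ℝ (Fin d)) :
    tensor (a + a') b = tensor a b + tensor a' b := by
  ext p; simp [tensor, add_mul]

theorem tensor_add_right (a b b' : EuclideanSpace ℝ (Fin d)) :
    tensor a (b + b') = tensor a b + tensor a b' := by
  ext p; simp [tensor, mul_add]

theorem continuous_tensor :
    Continuous fun q : EuclideanSpace ℝ (Fin d) × EuclideanSpace ℝ (Fin d) => tensor q.1 q.2 := by
  unfold tensor; fun_prop

section Additive

variable {q γ : ℝ}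

theorem besovNorm_le_mul {V V' : Type*} [NormedAddCommGroup V] [NormedAddCommGroup V'] {α m : ℝ} (hm : 0 < m) {c : ℝ≥0∞}
    (hc : c ≠ ⊤) {F : ℝ → ℝ → V} {A : ℝ → ℝ → V'}
    (h : ∀ p ∈ simplex 1, ‖F p.1 p.2‖ₑ ≤ c * ‖A p.1 p.2‖ₑ) :
    besovNorm α m F ≤ c * besovNorm α m A := by
  rw [besovNorm_eq hm.le, besovNorm_eq hm.le]
  set μ := simplexMeasure 1 (1 + m * α)
  have h1 : ∫⁻ p, ‖F p.1 p.2‖ₑ ^ m ∂μ ≤ c ^ m * ∫⁻ p, ‖A p.1 p.2‖ₑ ^ m ∂μ := by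
    rw [← lintegral_const_mul' _ _ (ENNReal.rpow_ne_top_of_nonneg hm.le hc)]
    refine lintegral_mono_ae (ae_simplexMeasure fun x y hx hxy hy => ?_)
    rw [← ENNReal.mul_rpow_of_nonneg _ _ hm.le]
    exact ENNReal.rpow_le_rpow (h (x, y) ⟨hx, hxy.le, hy⟩) hm.le
  rw [eLpNorm'_eq_lintegral_enorm, eLpNorm'_eq_lintegral_enorm]
  refine (ENNReal.rpow_le_rpow h1 (by positivity)).trans (le_of_eq ?_)
  rw [ENNReal.mul_rpow_of_nonneg _ _ (by positivity), ← ENNReal.rpow_mul,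
    mul_one_div_cancel hm.ne', ENNReal.rpow_one]

/-- An additive two-parameter function is the increment of the path y ↦ D 0 y, to which the chaining
estimate applies. -/
theorem exists_enorm_le_besovNorm (hq : 1 ≤ q) (hγ : 1 < q * γ) :
    ∃ C : ℝ≥0∞, C ≠ ⊤ ∧ ∀ {V : Type} [NormedAddCommGroup V] [MeasurableSpace V] [BorelSpace V]
      [SecondCountableTopology V] (D : ℝ → ℝ → V), (Measurable fun p : ℝ × ℝ => D p.1 p.2) →
      ContinuousOn (fun p : ℝ × ℝ => D p.1 p.2) (simplex 1) →
      (∀ x z y, 0 ≤ x → x ≤ z → z ≤ y → y ≤ 1 → D x y = D x z + D z y) →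
      ∀ p ∈ simplex 1, ‖D p.1 p.2‖ₑ ≤ C * besovNorm γ q D := by
  obtain ⟨C, hC, h⟩ := exists_besovMetric_le one_pos hq hγ
  refine ⟨C, hC, fun {V} _ _ _ _ D hm hc hadd p hp => ?_⟩
  have hB : Measurable (D 0) := hm.comp (g := fun p : ℝ × ℝ => D p.1 p.2) measurable_prodMk_left
  have hBc : ContinuousOn (D 0) (Icc 0 1) :=
    hc.comp (g := fun p : ℝ × ℝ => D p.1 p.2) (f := fun y => ((0 : ℝ), y)) (by fun_prop)
      fun y hy => ⟨le_rfl, hy.1, hy.2⟩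
  have hD : ∀ p ∈ simplex 1, D p.1 p.2 = D 0 p.2 - D 0 p.1 := fun p hp => by
    rw [hadd 0 p.1 p.2 le_rfl hp.1 hp.2.1 hp.2.2]; abel
  have hρ : IsBesovMetric 1 fun x y => ‖D 0 y - D 0 x‖ₑ :=
    { measurable := ((hB.comp measurable_snd).sub (hB.comp measurable_fst)).enorm
      symm := fun s t => by rw [← neg_sub, enorm_neg]
      self := fun t => by simp
      triangle := fun s _ t _ u _ => by
        have e : D 0 u - D 0 s = (D 0 t - D 0 s) + (D 0 u - D 0 t) := by abel
        rw [e]; exact enorm_add_le _ _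
      continuous := fun t ht => by
        have := ((hBc t ht).sub_const (D 0 t)).enorm
        simpa [ContinuousWithinAt] using! this }
  have h1 := h _ hρ p.1 ⟨hp.1, hp.2.1.trans hp.2.2⟩ p.2 ⟨hp.1.trans hp.2.1, hp.2.2⟩
  rw [hD p hp]
  refine h1.trans (le_of_eq ?_)
  congr 1
  rw [besovNorm_congr (B := fun x y => D 0 y - D 0 x) fun p hp => by rw [hD p hp],
    besovNorm_eq (by linarith)]
  exact eLpNorm'_enorm

end Additive

/-- Chen's relations. -/
structure IsChen (A₁ : ℝ → ℝ → EuclideanSpace ℝ (Fin d))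
    (A₂ : ℝ → ℝ → EuclideanSpace ℝ (Fin d × Fin d)) : Prop where
  measurable_fst : Measurable fun p : ℝ × ℝ => A₁ p.1 p.2
  measurable_snd : Measurable fun p : ℝ × ℝ => A₂ p.1 p.2
  continuous_fst : ContinuousOn (fun p : ℝ × ℝ => A₁ p.1 p.2) (simplex 1)
  continuous_snd : ContinuousOn (fun p : ℝ × ℝ => A₂ p.1 p.2) (simplex 1)
  fst_add : ∀ x z y, 0 ≤ x → x ≤ z → z ≤ y → y ≤ 1 → A₁ x y = A₁ x z + A₁ z y
  snd_add : ∀ x z y, 0 ≤ x → x ≤ z → z ≤ y → y ≤ 1 →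
    A₂ x y = A₂ x z + A₂ z y + tensor (A₁ x z) (A₁ z y)

/-- Second levels converge uniformly if both levels are summable in Besov norms. -/
theorem exists_edist_snd_le {q γ : ℝ} (hq : 1 ≤ q) (hγ : 1 < q * γ)
    {A₁ : ℕ → ℝ → ℝ → EuclideanSpace ℝ (Fin d)}
    {A₂ : ℕ → ℝ → ℝ → EuclideanSpace ℝ (Fin d × Fin d)} (hA : ∀ k, IsChen (A₁ k) (A₂ k))
    (h0 : besovNorm γ q (A₁ 0) ≠ ⊤)
    (h1 : ∑' k, besovNorm γ q (fun x y => A₁ (k + 1) x y - A₁ k x y) ≠ ⊤)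
    (h2 : ∑' k, besovNorm γ q (fun x y => A₂ (k + 1) x y - A₂ k x y) ≠ ⊤) :
    ∃ e : ℕ → ℝ≥0∞, ∑' k, e k ≠ ⊤ ∧ ∀ k, ∀ p ∈ simplex 1,
      edist (A₂ k p.1 p.2) (A₂ (k + 1) p.1 p.2) ≤ e k := by
  obtain ⟨C, hC, hC'⟩ := exists_enorm_le_besovNorm hq hγ
  have hq0 : 0 < q := by linarith
  set n : ℕ → ℝ≥0∞ := fun k => besovNorm γ q (A₁ k) with hn
  set s₁ : ℕ → ℝ≥0∞ := fun k => besovNorm γ q (fun x y => A₁ (k + 1) x y - A₁ k x y) with hs₁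
  set s₂ : ℕ → ℝ≥0∞ := fun k => besovNorm γ q (fun x y => A₂ (k + 1) x y - A₂ k x y) with hs₂
  set N : ℝ≥0∞ := n 0 + ∑' k, s₁ k with hN
  have hNtop : N ≠ ⊤ := ENNReal.add_ne_top.2 ⟨h0, h1⟩
  have hnN : ∀ k, n k ≤ N := by
    have : ∀ k, n k ≤ n 0 + ∑ j ∈ Finset.range k, s₁ j := by
      intro k
      induction k with
      | zero => simp
      | succ k ih =>
        have h := besovNorm_add_le (α := γ) (A := A₁ k)
          (B := fun x y => A₁ (k + 1) x y - A₁ k x y) hq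
          (hA k).measurable_fst ((hA (k + 1)).measurable_fst.sub (hA k).measurable_fst)
        simp only [add_sub_cancel] at h
        rw [Finset.sum_range_succ, ← add_assoc]
        exact h.trans (add_le_add_left ih _)
    exact fun k => (this k).trans (add_le_add_right (ENNReal.sum_le_tsum _) _)
  have hs₁top : ∀ k, s₁ k ≠ ⊤ := ENNReal.ne_top_of_tsum_ne_top h1
  have hA1 : ∀ k, ∀ p ∈ simplex 1, ‖A₁ k p.1 p.2‖ₑ ≤ C * N := fun k p hp =>
    (hC' (A₁ k) (hA k).measurable_fst (hA k).continuous_fst (hA k).fst_add p hp).trans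
      (mul_le_mul_right (hnN k) _)
  have hD1 : ∀ k, ∀ p ∈ simplex 1, ‖A₁ (k + 1) p.1 p.2 - A₁ k p.1 p.2‖ₑ ≤ C * s₁ k := fun k p hp =>
    hC' (fun x y => A₁ (k + 1) x y - A₁ k x y)
      ((hA (k + 1)).measurable_fst.sub (hA k).measurable_fst)
      ((hA (k + 1)).continuous_fst.sub (hA k).continuous_fst)
      (fun x z y hx hz hy hy1 => by
        rw [(hA (k + 1)).fst_add x z y hx hz hy hy1, (hA k).fst_add x z y hx hz hy hy1]; abel) p hp
  -- By Chen's identity A₂(x,y) + Z(x,y) = A₂(0,y) - A₂(0,x). The second level becomes additive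
  -- after this correction, so the sup estimate for additive functions applies to it.
  let Z : ℕ → ℝ → ℝ → EuclideanSpace ℝ (Fin d × Fin d) := fun k x y => tensor (A₁ k 0 x) (A₁ k x y)
  have hmt : ∀ {f g : ℝ × ℝ → EuclideanSpace ℝ (Fin d)}, Measurable f → Measurable g →
      Measurable fun p => tensor (f p) (g p) := fun hf hg =>
    continuous_tensor.measurable.comp (hf.prodMk hg)
  have hm0 : ∀ k, Measurable fun p : ℝ × ℝ => A₁ k 0 p.1 := fun k =>
    (hA k).measurable_fst.comp (measurable_const.prodMk measurable_fst)
  have hZm : ∀ k, Measurable fun p : ℝ × ℝ => Z k p.1 p.2 := fun k =>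
    hmt (hm0 k) (hA k).measurable_fst
  have hZc : ∀ k, ContinuousOn (fun p : ℝ × ℝ => Z k p.1 p.2) (simplex 1) := fun k => by
    have h1 : ContinuousOn (fun p : ℝ × ℝ => A₁ k 0 p.1) (simplex 1) :=
      (hA k).continuous_fst.comp (g := fun p : ℝ × ℝ => A₁ k p.1 p.2)
        (f := fun p : ℝ × ℝ => ((0 : ℝ), p.1)) (by fun_prop)
        fun p hp => ⟨le_rfl, hp.1, hp.2.1.trans hp.2.2⟩
    exact continuous_tensor.comp_continuousOn (h1.prodMk (hA k).continuous_fst)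
  have hZdec : ∀ k, ∀ x y, Z (k + 1) x y - Z k x y =
      tensor (A₁ (k + 1) 0 x - A₁ k 0 x) (A₁ (k + 1) x y) +
        tensor (A₁ k 0 x) (A₁ (k + 1) x y - A₁ k x y) := fun k x y => by
    simp only [Z, tensor_sub_left, tensor_sub_right]; abel
  have hmem : ∀ p ∈ simplex 1, ((0 : ℝ), p.1) ∈ simplex 1 := fun p hp =>
    ⟨le_rfl, hp.1, hp.2.1.trans hp.2.2⟩
  have hZ : ∀ k, ∀ p ∈ simplex 1, ‖Z (k + 1) p.1 p.2 - Z k p.1 p.2‖ₑ ≤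
      C * s₁ k * (C * N) + C * N * (C * s₁ k) := fun k p hp => by
    rw [hZdec]
    refine (enorm_add_le _ _).trans ?_
    rw [enorm_tensor, enorm_tensor]
    have z1 : ‖A₁ (k + 1) 0 p.1 - A₁ k 0 p.1‖ₑ ≤ C * s₁ k := hD1 k (0, p.1) (hmem p hp)
    have z2 : ‖A₁ k 0 p.1‖ₑ ≤ C * N := hA1 k (0, p.1) (hmem p hp)
    exact add_le_add (mul_le_mul' z1 (hA1 (k + 1) p hp)) (mul_le_mul' z2 (hD1 k p hp))
  -- The corrections are tensors of first levels: one factor is bounded uniformly by chaining and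
  -- the other kept in Besov norm.
  have hZb : ∀ k, besovNorm γ q (fun x y => Z (k + 1) x y - Z k x y) ≤
      C * s₁ k * N + C * N * s₁ k := fun k => by
    simp only [hZdec]
    have m1 : Measurable fun p : ℝ × ℝ =>
        tensor (A₁ (k + 1) 0 p.1 - A₁ k 0 p.1) (A₁ (k + 1) p.1 p.2) :=
      hmt ((hm0 (k + 1)).sub (hm0 k)) (hA (k + 1)).measurable_fst
    have m2 : Measurable fun p : ℝ × ℝ =>
        tensor (A₁ k 0 p.1) (A₁ (k + 1) p.1 p.2 - A₁ k p.1 p.2) :=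
      hmt (hm0 k) ((hA (k + 1)).measurable_fst.sub (hA k).measurable_fst)
    have b0 := besovNorm_add_le (α := γ) hq
      (A := fun x y => tensor (A₁ (k + 1) 0 x - A₁ k 0 x) (A₁ (k + 1) x y))
      (B := fun x y => tensor (A₁ k 0 x) (A₁ (k + 1) x y - A₁ k x y)) m1 m2
    have b1 : besovNorm γ q (fun x y => tensor (A₁ (k + 1) 0 x - A₁ k 0 x) (A₁ (k + 1) x y)) ≤
        C * s₁ k * n (k + 1) := by
      refine besovNorm_le_mul hq0 (ENNReal.mul_ne_top hC (hs₁top k)) fun p hp => ?_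
      rw [enorm_tensor]
      have z1 : ‖A₁ (k + 1) 0 p.1 - A₁ k 0 p.1‖ₑ ≤ C * s₁ k := hD1 k (0, p.1) (hmem p hp)
      exact mul_le_mul_left z1 _
    have b2 : besovNorm γ q (fun x y => tensor (A₁ k 0 x) (A₁ (k + 1) x y - A₁ k x y)) ≤
        C * N * s₁ k := by
      refine besovNorm_le_mul hq0 (ENNReal.mul_ne_top hC hNtop) fun p hp => ?_
      rw [enorm_tensor]
      have z2 : ‖A₁ k 0 p.1‖ₑ ≤ C * N := hA1 k (0, p.1) (hmem p hp)
      exact mul_le_mul_left z2 _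
    exact b0.trans (add_le_add (b1.trans (mul_le_mul_right (hnN _) _)) b2)
  set e : ℕ → ℝ≥0∞ := fun k => C * (s₂ k + (C * s₁ k * N + C * N * s₁ k)) +
    (C * s₁ k * (C * N) + C * N * (C * s₁ k)) with he
  refine ⟨e, ?_, fun k p hp => ?_⟩
  · have he' : ∀ k, e k = C * s₂ k + (C * C * N * 4) * s₁ k := fun k => by simp only [he]; ring
    simp only [he']
    rw [ENNReal.tsum_add, ENNReal.tsum_mul_left, ENNReal.tsum_mul_left]
    exact ENNReal.add_ne_top.2 ⟨ENNReal.mul_ne_top hC h2, ENNReal.mul_ne_top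
      (ENNReal.mul_ne_top (ENNReal.mul_ne_top (ENNReal.mul_ne_top hC hC) hNtop) (by norm_num)) h1⟩
  let D : ℝ → ℝ → EuclideanSpace ℝ (Fin d × Fin d) := fun x y =>
    (A₂ (k + 1) x y - A₂ k x y) + (Z (k + 1) x y - Z k x y)
  have hadd : ∀ k x z y, 0 ≤ x → x ≤ z → z ≤ y → y ≤ 1 →
      A₂ k x y + Z k x y = (A₂ k x z + Z k x z) + (A₂ k z y + Z k z y) :=
    fun k x z y hx hz hy hy1 => by
    simp only [Z]
    rw [(hA k).snd_add x z y hx hz hy hy1, (hA k).fst_add x z y hx hz hy hy1,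
      (hA k).fst_add 0 x z le_rfl hx hz (hy.trans hy1), tensor_add_right, tensor_add_left]
    abel
  have hm2 := (hA (k + 1)).measurable_snd.sub (hA k).measurable_snd
  have hmZ := (hZm (k + 1)).sub (hZm k)
  have hD := hC' D (hm2.add hmZ)
    (((hA (k + 1)).continuous_snd.sub (hA k).continuous_snd).add ((hZc (k + 1)).sub (hZc k)))
    (fun x z y hx hz hy hy1 => by
      have e1 := hadd (k + 1) x z y hx hz hy hy1
      have e2 := hadd k x z y hx hz hy hy1
      have e3 : ∀ x y, D x y = (A₂ (k + 1) x y + Z (k + 1) x y) - (A₂ k x y + Z k x y) :=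
        fun x y => by simp only [D]; abel
      rw [e3, e3, e3, e1, e2]; abel) p hp
  have hDb : besovNorm γ q D ≤ s₂ k + (C * s₁ k * N + C * N * s₁ k) :=
    (besovNorm_add_le hq (A := fun x y => A₂ (k + 1) x y - A₂ k x y)
      (B := fun x y => Z (k + 1) x y - Z k x y) hm2 hmZ).trans (add_le_add_right (hZb k) _)
  have e1 : A₂ (k + 1) p.1 p.2 - A₂ k p.1 p.2 = D p.1 p.2 - (Z (k + 1) p.1 p.2 - Z k p.1 p.2) := by
    simp only [D]; abel
  rw [edist_comm, edist_eq_enorm_sub, e1]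
  refine enorm_sub_le.trans (add_le_add (hD.trans (mul_le_mul_right hDb _)) (hZ k p hp))

end Space

/-! ### Lifts of dyadic polygons -/

section PolygonalLift

variable {d : ℕ}

theorem norm_le_sum_norm_apply {ι : Type*} [Fintype ι] (v : EuclideanSpace ℝ ι) :
    ‖v‖ ≤ ∑ i, ‖v i‖ := by
  rw [EuclideanSpace.norm_eq]
  exact Real.sqrt_le_iff.2 ⟨Finset.sum_nonneg fun _ _ => norm_nonneg _,
    Finset.sum_sq_le_sq_sum_of_nonneg fun _ _ => norm_nonneg _⟩

theorem lift_polygonal_snd_eq (k : ℕ) (f : ℝ → EuclideanSpace ℝ (Fin d)) (x y : ℝ) :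
    (lift (polygonal k f)).snd x y =
      WithLp.toLp 2 fun p : Fin d × Fin d => area k (fun z => f z p.1) (fun z => f z p.2) x y := by
  ext p; exact lift_polygonal_snd k f x y p

theorem lift_polygonal_fst_eq (k : ℕ) (f : ℝ → EuclideanSpace ℝ (Fin d)) (x y : ℝ) :
    (lift (polygonal k f)).fst x y = poly k f y - poly k f x := rfl

theorem measurable_lift_polygonal_fst {A : Type*} [MeasurableSpace A]
    {f : A → ℝ → EuclideanSpace ℝ (Fin d)} (hf : ∀ z, Measurable fun a => f a z) (k : ℕ) :
    Measurable fun a : A × ℝ × ℝ => (lift (polygonal k (f a.1))).fst a.2.1 a.2.2 := by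
  have h := measurable_poly hf k
  exact (h.comp (measurable_fst.prodMk (measurable_snd.comp measurable_snd))).sub
    (h.comp (measurable_fst.prodMk (measurable_fst.comp measurable_snd)))

theorem measurable_lift_polygonal_snd {A : Type*} [MeasurableSpace A]
    {f : A → ℝ → EuclideanSpace ℝ (Fin d)} (hf : ∀ z, Measurable fun a => f a z) (k : ℕ) :
    Measurable fun a : A × ℝ × ℝ => (lift (polygonal k (f a.1))).snd a.2.1 a.2.2 := by
  simp only [lift_polygonal_snd_eq]
  refine (WithLp.measurable_toLp 2 _).comp (measurable_pi_lambda _ fun p => ?_)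
  have hi : ∀ (i : Fin d) z, Measurable fun a => f a z i := fun i z =>
    (EuclideanSpace.proj i : EuclideanSpace ℝ (Fin d) →L[ℝ] ℝ).continuous.measurable.comp (hf z)
  exact measurable_area (f := fun a z => f a z p.1) (g := fun a z => f a z p.2) (hi p.1) (hi p.2) k

theorem lipschitzOnWith_polygonal (k : ℕ) (f : ℝ → EuclideanSpace ℝ (Fin d)) :
    ∃ K, LipschitzOnWith K (polygonal k f) (Icc 0 1) := by
  obtain ⟨B, hB0, hB⟩ := exists_bound_dyadicIncr k f
  refine ⟨Real.toNNReal (B * 2 ^ k), LipschitzOnWith.of_dist_le_mul fun x hx y hy => ?_⟩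
  rw [Real.coe_toNNReal _ (by positivity), dist_eq_norm, Real.dist_eq]
  exact norm_poly_sub_le k f hB hy hx

theorem lift_polygonal_congr {k : ℕ} {f g : ℝ → EuclideanSpace ℝ (Fin d)}
    (h : ∀ x ∈ Icc (0 : ℝ) 1, f x = g x) {p : ℝ × ℝ} (hp : p ∈ simplex 1) :
    (lift (polygonal k f)).init = (lift (polygonal k g)).init ∧
    (lift (polygonal k f)).fst p.1 p.2 = (lift (polygonal k g)).fst p.1 p.2 ∧
    (lift (polygonal k f)).snd p.1 p.2 = (lift (polygonal k g)).snd p.1 p.2 := by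
  have hd : ∀ c : ℕ, c ≤ 2 ^ k → f (c / 2 ^ k) = g (c / 2 ^ k) := fun c hc => h _ (dyadic_mem hc)
  refine ⟨?_, ?_, ?_⟩
  · have : poly k f 0 = poly k g 0 := poly_congr hd ⟨le_rfl, zero_le_one⟩
    exact this
  · rw [lift_polygonal_fst_eq, lift_polygonal_fst_eq,
      poly_congr hd ⟨hp.1.trans hp.2.1, hp.2.2⟩, poly_congr hd ⟨hp.1, hp.2.1.trans hp.2.2⟩]
  · rw [lift_polygonal_snd_eq, lift_polygonal_snd_eq]
    congr 1
    ext q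
    exact area_congr (fun c hc => by rw [hd c hc]) (fun c hc => by rw [hd c hc]) hp.1 hp.2.1 hp.2.2

theorem isChen_lift_polygonal (k : ℕ) (f : ℝ → EuclideanSpace ℝ (Fin d)) :
    IsChen (lift (polygonal k f)).fst (lift (polygonal k f)).snd where
  measurable_fst := by
    have h := measurable_lift_polygonal_fst (A := Unit) (f := fun _ => f)
      (fun _ => measurable_const) k
    exact h.comp (g := fun a : Unit × ℝ × ℝ => (lift (polygonal k f)).fst a.2.1 a.2.2)
      (f := fun p : ℝ × ℝ => ((), p)) measurable_prodMk_left
  measurable_snd := by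
    have h := measurable_lift_polygonal_snd (A := Unit) (f := fun _ => f)
      (fun _ => measurable_const) k
    exact h.comp (g := fun a : Unit × ℝ × ℝ => (lift (polygonal k f)).snd a.2.1 a.2.2)
      (f := fun p : ℝ × ℝ => ((), p)) measurable_prodMk_left
  continuous_fst := by
    have h := continuousOn_poly k f
    exact (h.comp continuousOn_snd fun p hp => ⟨hp.1.trans hp.2.1, hp.2.2⟩).sub
      (h.comp continuousOn_fst fun p hp => ⟨hp.1, hp.2.1.trans hp.2.2⟩)
  continuous_snd := by
    simp only [lift_polygonal_snd_eq]
    refine (PiLp.continuous_toLp 2 _).comp_continuousOn (continuousOn_pi.2 fun q => ?_)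
    set g := fun z => f z q.1
    set h := fun z => f z q.2
    have hg := continuousOn_poly k g
    have hh := continuousOn_poly k h
    have hfst : ∀ p ∈ simplex 1, p.1 ∈ Icc (0 : ℝ) 1 := fun p hp => ⟨hp.1, hp.2.1.trans hp.2.2⟩
    have hsnd : ∀ p ∈ simplex 1, p.2 ∈ Icc (0 : ℝ) 1 := fun p hp => ⟨hp.1.trans hp.2.1, hp.2.2⟩
    have h0 : ContinuousOn (fun y => area k g h 0 y) (Icc 0 1) := by
      have hi := (intervalIntegrable_cross hg k h le_rfl zero_le_one le_rfl (poly k g 0)).1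
      have := intervalIntegral.continuousOn_primitive_interval (μ := volume) (a := (0 : ℝ)) (b := 1)
        (f := fun u => (poly k g u - poly k g 0) * polySlope k h u) (by
          rw [uIcc_of_le zero_le_one]
          exact (integrableOn_Icc_iff_integrableOn_Ioc (by simp)).2 hi)
      rwa [uIcc_of_le zero_le_one] at this
    -- By Chen's identity, joint continuity follows from that of the one-parameter primitive started
    -- at 0.
    have hc : ContinuousOn (fun p : ℝ × ℝ => area k g h 0 p.2 - area k g h 0 p.1
        - (poly k g p.1 - poly k g 0) * (poly k h p.2 - poly k h p.1)) (simplex 1) :=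
      ((h0.comp continuousOn_snd hsnd).sub (h0.comp continuousOn_fst hfst)).sub
        (((hg.comp continuousOn_fst hfst).sub continuousOn_const).mul
          ((hh.comp continuousOn_snd hsnd).sub (hh.comp continuousOn_fst hfst)))
    refine hc.congr fun p hp => ?_
    simp only
    rw [area_chen k g h le_rfl hp.1 hp.2.1 hp.2.2]
    ring
  fst_add x z y _ _ _ _ := by simp only [lift_polygonal_fst_eq]; abel
  snd_add x z y hx hxz hzy hy := by
    ext q
    have hproj : ∀ (i : Fin d) (u : ℝ), poly k f u i = poly k (fun z => f z i) u := fun i u => by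
      simp [poly]
    simp only [lift_polygonal_snd_eq, lift_polygonal_fst_eq, tensor, PiLp.add_apply, PiLp.sub_apply,
      hproj]
    exact area_chen k _ _ hx hxz hzy hy

/-- A seminorm that controls the dyadic interpolation of level `k`. -/
def dyadicNorm {V : Type*} [NormedAddCommGroup V] (k : ℕ) (f : ℝ → V) : ℝ :=
  ∑ c ∈ Finset.range (2 ^ k), ‖dyadicIncr k f c‖

theorem dyadicNorm_nonneg {V : Type*} [NormedAddCommGroup V] (k : ℕ) (f : ℝ → V) :
    0 ≤ dyadicNorm k f := Finset.sum_nonneg fun _ _ => norm_nonneg _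

theorem norm_dyadicIncr_le {V : Type*} [NormedAddCommGroup V] (k : ℕ) (f : ℝ → V) :
    ∀ c < 2 ^ k, ‖dyadicIncr k f c‖ ≤ dyadicNorm k f := fun _ hc =>
  Finset.single_le_sum (f := fun c => ‖dyadicIncr k f c‖)
    (fun _ _ => norm_nonneg _) (Finset.mem_range.2 hc)

theorem norm_poly_sub_le_dyadicNorm {V : Type*} [NormedAddCommGroup V] [NormedSpace ℝ V] (k : ℕ)
    (f : ℝ → V) {p : ℝ × ℝ} (hp : p ∈ simplex 1) :
    ‖poly k f p.2 - poly k f p.1‖ ≤ dyadicNorm k f * 2 ^ k * (p.2 - p.1) := by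
  have := norm_poly_sub_le k f (norm_dyadicIncr_le k f) ⟨hp.1, hp.2.1.trans hp.2.2⟩
    ⟨hp.1.trans hp.2.1, hp.2.2⟩
  rwa [abs_of_nonneg (sub_nonneg.2 hp.2.1)] at this

theorem abs_area_le (k : ℕ) (f g : ℝ → ℝ) {p : ℝ × ℝ} (hp : p ∈ simplex 1) :
    |area k f g p.1 p.2| ≤ dyadicNorm k f * dyadicNorm k g * 4 ^ k * (p.2 - p.1) := by
  have h : ∀ u ∈ Icc p.1 p.2, |poly k f u - poly k f p.1| ≤ dyadicNorm k f * 2 ^ k := fun u hu => by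
    have h1 := norm_poly_sub_le_dyadicNorm k f (p := (p.1, u)) ⟨hp.1, hu.1, hu.2.trans hp.2.2⟩
    refine h1.trans (mul_le_of_le_one_right ?_ ?_)
    · exact mul_nonneg (dyadicNorm_nonneg k f) (by positivity)
    · have := hp.1; have := hu.2; have := hp.2.2
      simp only; linarith
  refine (abs_cross_le h (norm_dyadicIncr_le k g) hp.1 hp.2.1 hp.2.2).trans (le_of_eq ?_)
  rw [show (4 : ℝ) = 2 * 2 by norm_num, mul_pow]
  ring

theorem abs_area_sub_le (k : ℕ) (f g f' g' : ℝ → ℝ) {p : ℝ × ℝ} (hp : p ∈ simplex 1) :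
    |area k f g p.1 p.2 - area k f' g' p.1 p.2| ≤
      (dyadicNorm k (fun z => f z - f' z) * dyadicNorm k g +
        dyadicNorm k f' * dyadicNorm k (fun z => g z - g' z)) * 4 ^ k * (p.2 - p.1) := by
  have e : area k f g p.1 p.2 - area k f' g' p.1 p.2 =
      area k (fun z => f z - f' z) g p.1 p.2 + area k f' (fun z => g z - g' z) p.1 p.2 := by
    have h1 : area k (fun z => f z - f' z) g p.1 p.2 =
        area k f g p.1 p.2 - area k f' g p.1 p.2 := by
      have := cross_sub_left (continuousOn_poly k f) (continuousOn_poly k f') k g hp.1 hp.2.1 hp.2.2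
      rw [area, show poly k (fun z => f z - f' z) = fun u => poly k f u - poly k f' u from
        funext fun u => poly_sub k f f' u]
      exact this
    have h2 : area k f' (fun z => g z - g' z) p.1 p.2 =
        area k f' g p.1 p.2 - area k f' g' p.1 p.2 := by
      have hc := continuousOn_poly k f'
      rw [area, area, area, cross, cross, cross, ← intervalIntegral.integral_sub
        (intervalIntegrable_cross hc k g hp.1 hp.2.1 hp.2.2 _)
        (intervalIntegrable_cross hc k g' hp.1 hp.2.1 hp.2.2 _)]
      congr 1; ext u; rw [polySlope_sub]; ring
    rw [h1, h2]; ring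
  rw [e]
  refine (abs_add_le _ _).trans ((add_le_add (abs_area_le k _ g hp) (abs_area_le k f' _ hp)).trans
    (le_of_eq (by ring)))

theorem continuous_dyadicNorm {X V : Type*} [TopologicalSpace X] [NormedAddCommGroup V] {k : ℕ}
    {f : X → ℝ → V} (hf : ∀ z, Continuous fun t => f t z) :
    Continuous fun t => dyadicNorm k (f t) := by
  unfold dyadicNorm dyadicIncr
  exact continuous_finsetSum _ fun c _ => ((hf _).sub (hf _)).norm

theorem dyadicNorm_sub_self {V : Type*} [NormedAddCommGroup V] (k : ℕ) (f : ℝ → V) :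
    dyadicNorm k (fun z => f z - f z) = 0 := by
  simp [dyadicNorm, dyadicIncr]

theorem tendsto_besovNorm_of_le {V : Type*} [NormedAddCommGroup V] {α m T : ℝ} (hm : 0 < m)
    (hα : α < 1) {G : ℝ → ℝ → ℝ → V} {t : ℝ} {c : ℝ → ℝ} (hc : Continuous c) (h0 : c t = 0)
    (h : ∀ s, ∀ p ∈ simplex 1, ‖G s p.1 p.2 - G t p.1 p.2‖ ≤ c s * (p.2 - p.1)) :
    Tendsto (fun s => besovNorm α m fun x y => G s x y - G t x y) (𝓝[Icc 0 T] t) (𝓝 0) := by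
  have h1 : Tendsto (fun s => ENNReal.ofReal (c s) * besovConst α m) (𝓝 t) (𝓝 0) := by
    have h2 := ENNReal.tendsto_ofReal (hc.tendsto t)
    have h3 := ENNReal.Tendsto.mul_const h2 (Or.inr (besovConst_ne_top hm hα))
    simpa [h0] using! h3
  exact tendsto_of_tendsto_of_tendsto_of_le_of_le tendsto_const_nhds
    (h1.mono_left nhdsWithin_le_nhds) (fun _ => zero_le) fun s => besovNorm_le_of_le hm (h s)

/-- At a fixed level the lift depends on finitely many values of the field and is Lipschitz in
space, so continuity of each φ(·,z) suffices. The bounds are not uniform in `k`, and need not be. -/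
theorem isSheet_lift_fst {φ : ℝ → ℝ → EuclideanSpace ℝ (Fin d)}
    (hφ : ∀ z, Continuous fun t => φ t z) (h0 : ∀ z, φ 0 z = 0) (k : ℕ) {T α m : ℝ} (hm : 0 < m)
    (hα : α < 1) : IsSheet T α m fun t => (lift (polygonal k (φ t))).fst where
  measurable := measurable_lift_polygonal_fst (fun z => (hφ z).measurable) k
  zero p _ := by simp [lift_polygonal_fst_eq, poly, h0]
  continuous t _ := by
    refine tendsto_besovNorm_of_le hm hα (c := fun s => dyadicNorm k (fun z => φ s z - φ t z) * 2 ^ k)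
      ((continuous_dyadicNorm fun z => (hφ z).sub continuous_const).mul continuous_const)
      (by rw [dyadicNorm_sub_self, zero_mul]) fun s p hp => ?_
    have := norm_poly_sub_le_dyadicNorm k (fun z => φ s z - φ t z) hp
    rw [poly_sub, poly_sub] at this
    rw [lift_polygonal_fst_eq, lift_polygonal_fst_eq]
    refine le_trans (le_of_eq ?_) this
    congr 1; abel

theorem isSheet_lift_snd {φ : ℝ → ℝ → EuclideanSpace ℝ (Fin d)}
    (hφ : ∀ z, Continuous fun t => φ t z) (h0 : ∀ z, φ 0 z = 0) (k : ℕ) {T α m : ℝ} (hm : 0 < m)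
    (hα : α < 1) : IsSheet T α m fun t => (lift (polygonal k (φ t))).snd where
  measurable := measurable_lift_polygonal_snd (fun z => (hφ z).measurable) k
  zero p _ := by
    ext q
    simp [lift_polygonal_snd_eq, area, cross, poly, h0]
  continuous t _ := by
    have hi : ∀ (i : Fin d) z, Continuous fun s => φ s z i := fun i z =>
      (EuclideanSpace.proj i : EuclideanSpace ℝ (Fin d) →L[ℝ] ℝ).continuous.comp (hφ z)
    refine tendsto_besovNorm_of_le hm hα (c := fun s => ∑ q : Fin d × Fin d,
      (dyadicNorm k (fun z => φ s z q.1 - φ t z q.1) * dyadicNorm k (fun z => φ s z q.2) +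
        dyadicNorm k (fun z => φ t z q.1) * dyadicNorm k (fun z => φ s z q.2 - φ t z q.2)) * 4 ^ k)
      ?_ ?_ fun s p hp => ?_
    · refine continuous_finsetSum _ fun q _ => Continuous.mul (Continuous.add (Continuous.mul
        (continuous_dyadicNorm fun z => (hi _ z).sub continuous_const)
        (continuous_dyadicNorm fun z => hi _ z)) (Continuous.mul continuous_const
        (continuous_dyadicNorm fun z => (hi _ z).sub continuous_const))) continuous_const
    · refine Finset.sum_eq_zero fun q _ => ?_
      rw [dyadicNorm_sub_self, dyadicNorm_sub_self]; ring
    · refine (norm_le_sum_norm_apply _).trans ?_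
      rw [Finset.sum_mul]
      refine Finset.sum_le_sum fun q _ => ?_
      rw [lift_polygonal_snd_eq, lift_polygonal_snd_eq]
      exact abs_area_sub_le k _ _ _ _ hp

end PolygonalLift

/-! ### Moments of the levels of the dyadic lifts -/

section LevelMoments

variable {Ω : Type*} [MeasurableSpace Ω] {P : Measure Ω} {T : ℝ} {d : ℕ}
  {W : Fin d → (ℝ × ℝ → ℝ) → Ω → ℝ} {φ : ℝ → ℝ → Ω → EuclideanSpace ℝ (Fin d)}

/-- A modification of the stochastic convolution that is continuous and null at time `0`
everywhere. -/
structure IsRegularField (T : ℝ) (W : Fin d → (ℝ × ℝ → ℝ) → Ω → ℝ)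
    (φ : ℝ → ℝ → Ω → EuclideanSpace ℝ (Fin d)) (P : Measure Ω) : Prop where
  measurable : ∀ t z, Measurable (φ t z)
  continuous : ∀ ω, Continuous fun q : ℝ × ℝ => φ q.1 q.2 ω
  zero : ∀ z ω, φ 0 z ω = 0
  modification : ∀ t ∈ Icc (0 : ℝ) T, ∀ x ∈ Icc (0 : ℝ) 1, ∀ i,
    (fun ω => φ t x ω i) =ᵐ[P] heatField (W i) t x

theorem eLpNorm'_le_sum {ι : Type*} [Fintype ι] {v : Ω → EuclideanSpace ℝ ι} (hv : Measurable v)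
    {r : ℝ} (hr : 1 ≤ r) : eLpNorm' v r P ≤ ∑ i, eLpNorm' (fun ω => v ω i) r P := by
  have h1 : eLpNorm' v r P ≤ eLpNorm' (∑ i, fun ω => ‖v ω i‖) r P :=
    eLpNorm'_mono_ae (by linarith) (Eventually.of_forall fun ω => by
      rw [Finset.sum_apply, Real.norm_of_nonneg (Finset.sum_nonneg fun _ _ => norm_nonneg _)]
      exact norm_le_sum_norm_apply _)
  have hm : ∀ i, Measurable fun ω => v ω i := fun i =>
    (EuclideanSpace.proj i : EuclideanSpace ℝ ι →L[ℝ] ℝ).continuous.measurable.comp hv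
  refine h1.trans ((eLpNorm'_sum_le (fun i _ => (hm i).norm.aestronglyMeasurable) hr).trans
    (Finset.sum_le_sum fun i _ => le_of_eq ?_))
  exact eLpNorm'_norm

/-- The field equals the stochastic convolution only almost surely at each point. A polygon of level
`k` uses finitely many points, so one null set suffices. -/
theorem ae_dyadic_eq (hφ : IsRegularField T W φ P) {t : ℝ} (ht : t ∈ Icc 0 T) (k : ℕ) (i : Fin d) :
    ∀ᵐ ω ∂P, ∀ c : ℕ, c ≤ 2 ^ k → φ t (c / 2 ^ k) ω i = heatField (W i) t (c / 2 ^ k) ω := by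
  rw [ae_all_iff]
  intro c
  by_cases hc : c ≤ 2 ^ k
  · filter_upwards [hφ.modification t ht _ (dyadic_mem hc) i] with ω hω _ using hω
  · exact Eventually.of_forall fun ω h => absurd h hc

theorem dyadicLift_fst_ae (hφ : IsRegularField T W φ P) {t : ℝ} (ht : t ∈ Icc 0 T) (k : ℕ)
    (i : Fin d) {x y : ℝ} (hx : 0 ≤ x) (hxy : x ≤ y) (hy : y ≤ 1) :
    (fun ω => (dyadicLift φ k ω t).fst x y i) =ᵐ[P]
      fun ω => heatPoly (W i) (k, t) y ω - heatPoly (W i) (k, t) x ω := by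
  filter_upwards [ae_dyadic_eq hφ ht k i] with ω hω
  have hproj : ∀ u, poly k (fun z => φ t z ω) u i = poly k (fun z => φ t z ω i) u := fun u => by
    simp [poly]
  rw [dyadicLift, lift_polygonal_fst_eq, PiLp.sub_apply, hproj, hproj,
    poly_congr (g := fun z => heatField (W i) t z ω) hω ⟨hx.trans hxy, hy⟩,
    poly_congr (g := fun z => heatField (W i) t z ω) hω ⟨hx, hxy.trans hy⟩]
  rfl

theorem dyadicLift_snd_ae (hφ : IsRegularField T W φ P) {t : ℝ} (ht : t ∈ Icc 0 T) (k : ℕ)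
    (q : Fin d × Fin d) {x y : ℝ} (hx : 0 ≤ x) (hxy : x ≤ y) (hy : y ≤ 1) :
    (fun ω => (dyadicLift φ k ω t).snd x y q) =ᵐ[P] heatArea (W q.1) (W q.2) (k, t) x y := by
  filter_upwards [ae_dyadic_eq hφ ht k q.1, ae_dyadic_eq hφ ht k q.2] with ω h1 h2
  rw [dyadicLift, lift_polygonal_snd]
  exact area_congr h1 h2 hx hxy hy

theorem measurable_dyadicLift (hφ : ∀ t z, Measurable (φ t z)) (k : ℕ) (t x y : ℝ) :
    (Measurable fun ω => (dyadicLift φ k ω t).fst x y) ∧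
      Measurable fun ω => (dyadicLift φ k ω t).snd x y := by
  have hp : Measurable fun ω : Ω => (ω, x, y) := measurable_id.prodMk measurable_const
  have h1 := (measurable_lift_polygonal_fst (f := fun ω z => φ t z ω) (hφ t) k).comp hp
  have h2 := (measurable_lift_polygonal_snd (f := fun ω z => φ t z ω) (hφ t) k).comp hp
  simp only [Function.comp_def] at h1 h2
  exact ⟨h1, h2⟩

/-- The constant in the moment bounds for both levels. -/
def momentConst (d : ℕ) (r : ℝ) : ℝ≥0∞ :=
  (d * d + d) * (36 * (gaussMoment r + gaussMoment r ^ 2 + gaussMoment (2 * r) ^ 2))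

theorem momentConst_ne_top (d : ℕ) {r : ℝ} (hr : 0 < r) : momentConst d r ≠ ⊤ := by
  have h1 := gaussMoment_ne_top hr
  have h2 := gaussMoment_ne_top (q := 2 * r) (by linarith)
  refine ENNReal.mul_ne_top ?_ (ENNReal.mul_ne_top (by norm_num) ?_)
  · exact ENNReal.add_ne_top.2 ⟨ENNReal.mul_ne_top (by simp) (by simp), by simp⟩
  · exact ENNReal.add_ne_top.2 ⟨ENNReal.add_ne_top.2 ⟨h1, ENNReal.pow_ne_top h1⟩,
      ENNReal.pow_ne_top h2⟩

variable [IsProbabilityMeasure P]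

theorem eLpNorm'_fst_sub_le (hW : IsSpaceTimeWhiteNoise T W P) (hφ : IsRegularField T W φ P)
    {k l : ℕ} {s t δ r : ℝ} (hs : s ∈ Icc 0 T) (ht : t ∈ Icc 0 T)
    (hδ : ∀ i, RmsClose P (W i) (k, t) (l, s) δ) (hr : 2 ≤ r) {x y : ℝ} (hx : 0 ≤ x) (hxy : x ≤ y)
    (hy : y ≤ 1) :
    eLpNorm' (fun ω => (dyadicLift φ k ω t).fst x y - (dyadicLift φ l ω s).fst x y) r P ≤
      momentConst d r * ENNReal.ofReal δ := by
  have hm := ((measurable_dyadicLift hφ.measurable k t x y).1.sub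
    (measurable_dyadicLift hφ.measurable l s x y).1)
  have h : ∀ i : Fin d, eLpNorm' (fun ω => ((dyadicLift φ k ω t).fst x y
      - (dyadicLift φ l ω s).fst x y) i) r P ≤ 2 * gaussMoment r * ENNReal.ofReal δ := fun i => by
    refine le_trans (le_of_eq (eLpNorm'_congr_ae ?_)) (eLpNorm'_heatPoly_diff_incr_le
      (hW.whiteNoise i) ht hs (hδ i) (by linarith) (x := x) (y := y) ⟨hx, hxy.trans hy⟩
      ⟨hx.trans hxy, hy⟩)
    filter_upwards [dyadicLift_fst_ae hφ ht k i hx hxy hy, dyadicLift_fst_ae hφ hs l i hx hxy hy]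
      with ω h1 h2
    rw [PiLp.sub_apply, h1, h2]; ring
  refine (eLpNorm'_le_sum hm (by linarith)).trans ((Finset.sum_le_sum fun i _ => h i).trans ?_)
  rw [Finset.sum_const, Finset.card_univ, Fintype.card_fin, nsmul_eq_mul, ← mul_assoc]
  gcongr
  unfold momentConst
  gcongr
  · exact le_add_self
  · norm_num
  · exact le_self_add.trans le_self_add

theorem eLpNorm'_fst_le (hW : IsSpaceTimeWhiteNoise T W P) (hφ : IsRegularField T W φ P)
    (k : ℕ) {t r : ℝ} (ht : t ∈ Icc 0 T) (hr : 2 ≤ r) {x y : ℝ} (hx : 0 ≤ x) (hxy : x ≤ y)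
    (hy : y ≤ 1) :
    eLpNorm' (fun ω => (dyadicLift φ k ω t).fst x y) r P ≤
      momentConst d r * ENNReal.ofReal √(y - x) := by
  have hm := (measurable_dyadicLift hφ.measurable k t x y).1
  have h : ∀ i : Fin d, eLpNorm' (fun ω => (dyadicLift φ k ω t).fst x y i) r P ≤
      36 * gaussMoment r * ENNReal.ofReal √(y - x) := fun i => by
    refine (le_of_eq (eLpNorm'_congr_ae (dyadicLift_fst_ae hφ ht k i hx hxy hy))).trans
      ((eLpNorm'_heatPoly_incr_le (hW.whiteNoise i) (a := (k, t)) ht (by linarith) hx ⟨hxy, le_rfl⟩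
        hy).trans ?_)
    rw [ENNReal.ofReal_mul (by norm_num), ENNReal.ofReal_ofNat, ← mul_assoc, mul_comm _ (6 : ℝ≥0∞)]
    gcongr
    norm_num
  refine (eLpNorm'_le_sum hm (by linarith)).trans ((Finset.sum_le_sum fun i _ => h i).trans ?_)
  rw [Finset.sum_const, Finset.card_univ, Fintype.card_fin, nsmul_eq_mul, ← mul_assoc]
  gcongr
  unfold momentConst
  gcongr
  · exact le_add_self
  · exact le_self_add.trans le_self_add

omit [IsProbabilityMeasure P] in
theorem indepFun_noisePath (hW : IsSpaceTimeWhiteNoise T W P) {i j : Fin d} (h : i ≠ j) :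
    IndepFun (noisePath T (W i)) (noisePath T (W j)) P := hW.independent.indepFun h

/-- Entrywise: off-diagonal entries use the independence of two noises, diagonal entries the
half-square formula. Levels and times may both differ, so the same bound covers refinement of the
mesh and increments in time. -/
theorem eLpNorm'_snd_sub_le (hW : IsSpaceTimeWhiteNoise T W P) (hφ : IsRegularField T W φ P)
    {k l : ℕ} {s t δ r : ℝ} (hs : s ∈ Icc 0 T) (ht : t ∈ Icc 0 T)
    (hδ : ∀ i, RmsClose P (W i) (k, t) (l, s) δ) (hr : 2 ≤ r) {x y : ℝ} (hx : 0 ≤ x) (hxy : x ≤ y)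
    (hy : y ≤ 1) :
    eLpNorm' (fun ω => (dyadicLift φ k ω t).snd x y - (dyadicLift φ l ω s).snd x y) r P ≤
      momentConst d r * (ENNReal.ofReal √(y - x) * ENNReal.ofReal δ) := by
  have hm := ((measurable_dyadicLift hφ.measurable k t x y).2.sub
    (measurable_dyadicLift hφ.measurable l s x y).2)
  have h : ∀ q : Fin d × Fin d, eLpNorm' (fun ω => ((dyadicLift φ k ω t).snd x y
      - (dyadicLift φ l ω s).snd x y) q) r P ≤
      36 * (gaussMoment r + gaussMoment r ^ 2 + gaussMoment (2 * r) ^ 2) *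
        (ENNReal.ofReal √(y - x) * ENNReal.ofReal δ) := fun q => by
    have e : eLpNorm' (fun ω => ((dyadicLift φ k ω t).snd x y - (dyadicLift φ l ω s).snd x y) q) r P
        = eLpNorm' (fun ω => heatArea (W q.1) (W q.2) (k, t) x y ω
          - heatArea (W q.1) (W q.2) (l, s) x y ω) r P := by
      refine eLpNorm'_congr_ae ?_
      filter_upwards [dyadicLift_snd_ae hφ ht k q hx hxy hy, dyadicLift_snd_ae hφ hs l q hx hxy hy]
        with ω h1 h2
      rw [PiLp.sub_apply, h1, h2]
    rw [e]
    obtain ⟨i, j⟩ := q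
    rcases eq_or_ne i j with rfl | hij
    · refine (eLpNorm'_heatArea_sub_diag_le (hW.whiteNoise i) (a := (k, t)) (b := (l, s)) ht hs
        (hδ i) hx hxy hy hr).trans ?_
      gcongr
      · norm_num
      · exact le_add_self
    · refine (eLpNorm'_heatArea_sub_indep_le (hW.whiteNoise i) (hW.whiteNoise j)
        (indepFun_noisePath hW hij) (a := (k, t)) (b := (l, s)) ht hs
        (hδ i) (hδ j) hx hxy hy hr).trans ?_
      gcongr
      rw [mul_add, mul_add]
      gcongr
      · refine le_trans ?_ le_add_self
        gcongr; norm_num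
      · norm_num
  refine (eLpNorm'_le_sum hm (by linarith)).trans ((Finset.sum_le_sum fun i _ => h i).trans ?_)
  rw [Finset.sum_const, Finset.card_univ, Fintype.card_prod, Fintype.card_fin, nsmul_eq_mul,
    ← mul_assoc]
  gcongr
  unfold momentConst
  gcongr
  push_cast
  exact le_self_add

theorem eLpNorm'_snd_le (hW : IsSpaceTimeWhiteNoise T W P) (hφ : IsRegularField T W φ P)
    (k : ℕ) {t r : ℝ} (ht : t ∈ Icc 0 T) (hr : 2 ≤ r) {x y : ℝ} (hx : 0 ≤ x) (hxy : x ≤ y)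
    (hy : y ≤ 1) :
    eLpNorm' (fun ω => (dyadicLift φ k ω t).snd x y) r P ≤
      momentConst d r * (ENNReal.ofReal √(y - x) * ENNReal.ofReal √(y - x)) := by
  have hm := (measurable_dyadicLift hφ.measurable k t x y).2
  have h : ∀ q : Fin d × Fin d, eLpNorm' (fun ω => (dyadicLift φ k ω t).snd x y q) r P ≤
      36 * (gaussMoment r + gaussMoment r ^ 2 + gaussMoment (2 * r) ^ 2) *
        (ENNReal.ofReal √(y - x) * ENNReal.ofReal √(y - x)) := fun q => by
    rw [eLpNorm'_congr_ae (dyadicLift_snd_ae hφ ht k q hx hxy hy)]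
    obtain ⟨i, j⟩ := q
    rcases eq_or_ne i j with rfl | hij
    · refine (eLpNorm'_heatArea_diag_le (hW.whiteNoise i) (a := (k, t)) ht hx hxy hy hr).trans ?_
      rw [mul_assoc (36 * _)]
      gcongr
      exact le_add_self
    · refine (eLpNorm'_heatArea_indep_le (hW.whiteNoise i) (hW.whiteNoise j)
        (indepFun_noisePath hW hij) (a := (k, t)) ht hx hxy hy hr).trans ?_
      rw [mul_assoc (12 * _)]
      gcongr
      · norm_num
      · exact le_add_self.trans le_self_add
  refine (eLpNorm'_le_sum hm (by linarith)).trans ((Finset.sum_le_sum fun i _ => h i).trans ?_)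
  rw [Finset.sum_const, Finset.card_univ, Fintype.card_prod, Fintype.card_fin, nsmul_eq_mul,
    ← mul_assoc]
  gcongr
  unfold momentConst
  gcongr
  push_cast
  exact le_self_add

omit [IsProbabilityMeasure P] in
theorem rmsClose_succ {W : (ℝ × ℝ → ℝ) → Ω → ℝ} (hW : IsWhiteNoise (spaceTimeMeasure T) W P)
    {t : ℝ} (ht : t ∈ Icc 0 T) (k : ℕ) : RmsClose P W (k + 1, t) (k, t) (4 * √((2 : ℝ) ^ k)⁻¹) :=
  fun _ hu => rms_poly_succ_sub_le hW ht k hu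

end LevelMoments

/-! ### Interpolation between moment bounds, and moments of norms of random sheets -/

section Interpolation

/-- Write z = z^ε z^θ z^{1-ε-θ} and use a different bound for each factor. -/
theorem le_mul_of_le_interpolation {z K : ℝ≥0∞} {g u v w ε θ : ℝ} (hg : 0 ≤ g) (hu : 0 ≤ u)
    (hv : 0 ≤ v) (hw : 0 ≤ w) (hε : 0 ≤ ε) (hθ : 0 ≤ θ) (h1 : ε + θ ≤ 1)
    (hzu : z ≤ K * ENNReal.ofReal (g * u)) (hzv : z ≤ K * ENNReal.ofReal (g * v))
    (hzw : z ≤ K * ENNReal.ofReal (g * w)) :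
    z ≤ K * ENNReal.ofReal (g * (u ^ ε * v ^ θ * w ^ (1 - ε - θ))) := by
  have h2 : 0 ≤ 1 - ε - θ := by linarith
  have hsplit : ∀ a : ℝ≥0∞, a = a ^ ε * a ^ θ * a ^ (1 - ε - θ) := fun a => by
    rw [← ENNReal.rpow_add_of_nonneg _ _ hε hθ, ← ENNReal.rpow_add_of_nonneg _ _ (by linarith) h2]
    conv_lhs => rw [← ENNReal.rpow_one a]
    congr 1; ring
  rw [hsplit z, hsplit K, ENNReal.ofReal_mul hg, hsplit (ENNReal.ofReal g),
    ENNReal.ofReal_mul (by positivity), ENNReal.ofReal_mul (by positivity),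
    ← ENNReal.ofReal_rpow_of_nonneg hu hε, ← ENNReal.ofReal_rpow_of_nonneg hv hθ,
    ← ENNReal.ofReal_rpow_of_nonneg hw h2]
  rw [ENNReal.ofReal_mul hg] at hzu hzv hzw
  calc _ ≤ (K * (ENNReal.ofReal g * ENNReal.ofReal u)) ^ ε *
        (K * (ENNReal.ofReal g * ENNReal.ofReal v)) ^ θ *
        (K * (ENNReal.ofReal g * ENNReal.ofReal w)) ^ (1 - ε - θ) := by gcongr
    _ = _ := by
      simp only [ENNReal.mul_rpow_of_nonneg _ _ hε, ENNReal.mul_rpow_of_nonneg _ _ hθ,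
        ENNReal.mul_rpow_of_nonneg _ _ h2]
      ring

/-- Moments of the norm of a random sheet. -/
theorem eLpNorm'_sheetBesovNorm_le {Ω : Type*} [MeasurableSpace Ω] {P : Measure Ω} [SFinite P]
    {V : Type*} [NormedAddCommGroup V] [MeasurableSpace V] [BorelSpace V]
    [SecondCountableTopology V] {T a b α β q r : ℝ} (hq : 0 < q) (hqr : q ≤ r)
    {G : Ω → ℝ → ℝ → ℝ → V}
    (hG : Measurable fun p : Ω × ℝ × ℝ × ℝ => G p.1 p.2.1 p.2.2.1 p.2.2.2) {K : ℝ≥0∞}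
    (hK : ∀ s t, 0 ≤ s → s < t → t ≤ T → ∀ x y, 0 ≤ x → x < y → y ≤ 1 →
      eLpNorm' (fun ω => G ω t x y - G ω s x y) r P ≤
        K * ENNReal.ofReal ((t - s) ^ b) * ENNReal.ofReal ((y - x) ^ a)) :
    eLpNorm' (fun ω => sheetBesovNorm T β α q (G ω)) r P ≤
      K * (simplexMeasure 1 (1 - q * (a - α)) univ ^ (1 / q) *
        simplexMeasure T (1 - q * (b - β)) univ ^ (1 / q)) := by
  simp only [sheetBesovNorm_eq hq]
  rw [← mul_assoc]
  have hm : Measurable fun z : Ω × ℝ × ℝ =>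
      besovNorm α q fun x y => G z.1 z.2.2 x y - G z.1 z.2.1 x y := by
    refine measurable_besovNorm hq.le ?_
    have h1 : Measurable fun p : (Ω × ℝ × ℝ) × ℝ × ℝ => (p.1.1, p.1.2.2, p.2.1, p.2.2) := by
      fun_prop
    have h2 : Measurable fun p : (Ω × ℝ × ℝ) × ℝ × ℝ => (p.1.1, p.1.2.1, p.2.1, p.2.2) := by
      fun_prop
    exact (hG.comp h1).sub (hG.comp h2)
  -- The moment estimate is used twice, first in time with the spatial norm as the function, then in
  -- space for two fixed times.
  refine eLpNorm'_simplex_le hq hqr (b := b)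
    (F := fun ω p => besovNorm α q fun x y => G ω p.2 x y - G ω p.1 x y) hm
    fun s t hs hst ht => ?_
  have hF : ∀ ω, (besovNorm α q fun x y => G ω t x y - G ω s x y) =
      eLpNorm' (fun p : ℝ × ℝ => ‖G ω t p.1 p.2 - G ω s p.1 p.2‖ₑ) q
        (simplexMeasure 1 (1 + q * α)) := fun ω => by
    rw [besovNorm_eq hq.le, ← eLpNorm'_enorm]
  simp only [hF]
  rw [mul_right_comm]
  refine eLpNorm'_simplex_le hq hqr (b := a)
    (F := fun ω p => ‖G ω t p.1 p.2 - G ω s p.1 p.2‖ₑ) ?_ fun x y hx hxy hy => ?_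
  · have h1 : ∀ t : ℝ, Measurable fun p : Ω × ℝ × ℝ => (p.1, t, p.2.1, p.2.2) := fun t => by
      fun_prop
    exact ((hG.comp (h1 t)).sub (hG.comp (h1 s))).enorm
  · rw [eLpNorm'_enorm]
    exact hK s t hs hst ht x y hx hxy hy

end Interpolation

/-! ### Moments of the Besov norms of the dyadic lifts -/

section SheetMoments

variable {Ω : Type*} [MeasurableSpace Ω] {P : Measure Ω} {T : ℝ} {d : ℕ}
  {W : Fin d → (ℝ × ℝ → ℝ) → Ω → ℝ} {φ : ℝ → ℝ → Ω → EuclideanSpace ℝ (Fin d)}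

theorem IsRegularField.measurable_time (hφ : IsRegularField T W φ P) (z : ℝ) :
    Measurable fun a : Ω × ℝ => φ a.2 z a.1 := by
  have h := measurable_uncurry_of_continuous_of_measurable (u := fun t ω => φ t z ω)
    (fun ω => (hφ.continuous ω).comp (by fun_prop : Continuous fun t : ℝ => (t, z)))
    fun t => hφ.measurable t z
  exact h.comp measurable_swap

theorem IsRegularField.measurable_fst (hφ : IsRegularField T W φ P) (k : ℕ) :
    Measurable fun p : Ω × ℝ × ℝ × ℝ => (dyadicLift φ k p.1 p.2.1).fst p.2.2.1 p.2.2.2 := by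
  have h := (measurable_lift_polygonal_fst (f := fun (a : Ω × ℝ) z => φ a.2 z a.1)
    hφ.measurable_time k).comp (MeasurableEquiv.prodAssoc.symm.measurable)
  simp only [Function.comp_def] at h
  exact h

theorem IsRegularField.measurable_snd (hφ : IsRegularField T W φ P) (k : ℕ) :
    Measurable fun p : Ω × ℝ × ℝ × ℝ => (dyadicLift φ k p.1 p.2.1).snd p.2.2.1 p.2.2.2 := by
  have h := (measurable_lift_polygonal_snd (f := fun (a : Ω × ℝ) z => φ a.2 z a.1)
    hφ.measurable_time k).comp (MeasurableEquiv.prodAssoc.symm.measurable)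
  simp only [Function.comp_def] at h
  exact h

theorem exists_rmsClose_time (hW : IsSpaceTimeWhiteNoise T W P) : ∃ C, 0 ≤ C ∧ ∀ (i : Fin d),
    ∀ s ∈ Icc 0 T, ∀ t ∈ Icc 0 T, ∀ k : ℕ,
      RmsClose P (W i) (k, t) (k, s) (C * √√|t - s|) := by
  obtain ⟨C, hC, h⟩ := exists_rms_poly_time_le T
  exact ⟨C, hC, fun i s hs t ht k u hu => h (hW.whiteNoise i) s hs t ht k u hu⟩

theorem ae_lt_top_of_eLpNorm' {X : Type*} [MeasurableSpace X] {μ : Measure X} {f : X → ℝ≥0∞}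
    {q : ℝ} (hq : 0 < q) (hf : Measurable f) (h : eLpNorm' f q μ < ⊤) : ∀ᵐ x ∂μ, f x < ⊤ := by
  have h1 : ∫⁻ x, f x ^ q ∂μ ≠ ⊤ := by
    intro h2
    rw [eLpNorm'_eq_lintegral_enorm] at h
    simp only [enorm_eq_self, h2] at h
    rw [ENNReal.top_rpow_of_pos (by positivity)] at h
    exact lt_irrefl _ h
  filter_upwards [ae_lt_top (hf.pow_const q) h1] with x hx
  exact (ENNReal.rpow_lt_top_iff_of_pos hq).1 hx

/-- Moments of the Besov norms of a sequence of random sheets, from pointwise moments. -/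
theorem exists_level_moments [IsProbabilityMeasure P] (hW : IsSpaceTimeWhiteNoise T W P)
    {V : Type*} [NormedAddCommGroup V] [MeasurableSpace V] [BorelSpace V]
    [SecondCountableTopology V] {L : ℕ → Ω → ℝ → ℝ → ℝ → V}
    (hL : ∀ k, Measurable fun p : Ω × ℝ × ℝ × ℝ => L k p.1 p.2.1 p.2.2.1 p.2.2.2)
    {c : ℝ} {M : ℝ → ℝ≥0∞} (hM : ∀ r, 2 ≤ r → M r ≠ ⊤)
    (h₁ : ∀ r, 2 ≤ r → ∀ k, ∀ t ∈ Icc 0 T, ∀ x y, 0 ≤ x → x < y → y ≤ 1 →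
      eLpNorm' (fun ω => L k ω t x y) r P ≤ M r * ENNReal.ofReal ((y - x) ^ c * √(y - x)))
    (h₂ : ∀ r, 2 ≤ r → ∀ k l, ∀ s ∈ Icc 0 T, ∀ t ∈ Icc 0 T, ∀ δ,
      (∀ i, RmsClose P (W i) (k, t) (l, s) δ) → ∀ x y, 0 ≤ x → x < y → y ≤ 1 →
      eLpNorm' (fun ω => L k ω t x y - L l ω s x y) r P ≤ M r * ENNReal.ofReal ((y - x) ^ c * δ))
    {q α β ε θ : ℝ} (hq : 0 < q) (hε : 0 < ε) (hθ : 0 ≤ θ) (hεθ : ε + θ ≤ 1) (hβ : β < θ / 4)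
    (hα : α < c + (1 - ε - θ) / 2) :
    ∃ η, 0 < η ∧ η < 1 ∧ ∀ r, 2 ≤ r → q ≤ r → ∃ K : ℝ≥0∞, K ≠ ⊤ ∧ ∀ k,
      eLpNorm' (fun ω => sheetBesovNorm T β α q (L k ω)) r P ≤ K ∧
      eLpNorm' (fun ω => sheetBesovNorm T β α q fun t x y => L (k + 1) ω t x y - L k ω t x y) r P ≤
        K * ENNReal.ofReal (η ^ k) := by
  obtain ⟨C, hC, hCr⟩ := exists_rmsClose_time hW
  have hs2 : 1 < √(2 : ℝ) := by rw [Real.lt_sqrt (by norm_num)]; norm_num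
  -- The rate 2^{-k/2} of the interpolation error enters with power ε, so η = 2^{-ε/2}; it does not
  -- depend on the moment `r`.
  refine ⟨(√(2 : ℝ))⁻¹ ^ ε, by positivity,
    Real.rpow_lt_one (by positivity) (inv_lt_one_of_one_lt₀ hs2) hε, fun r hr hqr => ?_⟩
  set η := (√(2 : ℝ))⁻¹ ^ ε with hη
  set a := c + (1 - ε - θ) / 2 with ha
  -- A common constant for all bounds on the double difference: 8 from the levels, 2C from time, 4
  -- from space.
  set κ : ℝ := 8 + 2 * C with hκ
  set B : ℝ≥0∞ := M r * ENNReal.ofReal κ with hB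
  set S : ℝ≥0∞ := simplexMeasure 1 (1 - q * (a - α)) univ ^ (1 / q) *
    simplexMeasure T (1 - q * (θ / 4 - β)) univ ^ (1 / q) with hS
  have hStop : S ≠ ⊤ := ENNReal.mul_ne_top
    (ENNReal.rpow_ne_top_of_nonneg (by positivity)
      (simplexMeasure_univ_lt_top (mul_pos hq (sub_pos.2 hα)) _).ne)
    (ENNReal.rpow_ne_top_of_nonneg (by positivity)
      (simplexMeasure_univ_lt_top (mul_pos hq (sub_pos.2 hβ)) _).ne)
  have hBtop : B ≠ ⊤ := ENNReal.mul_ne_top (hM r hr) ENNReal.ofReal_ne_top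
  have hr1 : 1 ≤ r := by linarith
  have hLm : ∀ k t x y, Measurable fun ω => L k ω t x y := fun k t x y =>
    (hL k).comp (by fun_prop : Measurable fun ω : Ω => (ω, t, x, y))
  have hscale : ∀ {z e : ℝ}, 0 ≤ e → e ≤ κ → M r * ENNReal.ofReal (e * z) ≤
      B * ENNReal.ofReal z := fun {z e} he hek => by
    rw [ENNReal.ofReal_mul he, hB, mul_assoc]
    gcongr
  have hexp : ∀ {s t x y : ℝ}, s < t → x < y → ∀ u : ℝ, (y - x) ^ c *
      (u ^ ε * √√(t - s) ^ θ * √(y - x) ^ (1 - ε - θ)) =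
      u ^ ε * ((t - s) ^ (θ / 4) * (y - x) ^ a) := fun {s t x y} hst hxy u => by
    have h1 : 0 < t - s := sub_pos.2 hst
    have h2 : 0 < y - x := sub_pos.2 hxy
    have e1 : √√(t - s) ^ θ = (t - s) ^ (θ / 4) := by
      rw [Real.sqrt_eq_rpow, Real.sqrt_eq_rpow, ← Real.rpow_mul h1.le, ← Real.rpow_mul h1.le]
      congr 1; ring
    have e2 : √(y - x) ^ (1 - ε - θ) = (y - x) ^ ((1 - ε - θ) / 2) := by
      rw [Real.sqrt_eq_rpow, ← Real.rpow_mul h2.le]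
      congr 1; ring
    rw [e1, e2, ha, Real.rpow_add h2]
    ring
  have htime : ∀ k, ∀ s t x y, 0 ≤ s → s < t → t ≤ T → 0 ≤ x → x < y → y ≤ 1 →
      eLpNorm' (fun ω => L k ω t x y - L k ω s x y) r P ≤
        M r * ENNReal.ofReal (C * ((y - x) ^ c * √√(t - s))) := by
    intro k s t x y hs hst ht hx hxy hy
    have hsT : s ∈ Icc 0 T := ⟨hs, hst.le.trans ht⟩
    have htT : t ∈ Icc 0 T := ⟨hs.trans hst.le, ht⟩
    have h := h₂ r hr k k s hsT t htT _ (fun i => hCr i s hsT t htT k) x y hx hxy hy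
    rw [abs_of_pos (sub_pos.2 hst)] at h
    refine h.trans (le_of_eq ?_)
    congr 2; ring
  have hspace : ∀ k, ∀ s t x y, 0 ≤ s → s < t → t ≤ T → 0 ≤ x → x < y → y ≤ 1 →
      eLpNorm' (fun ω => L k ω t x y - L k ω s x y) r P ≤
        M r * ENNReal.ofReal (2 * ((y - x) ^ c * √(y - x))) := by
    intro k s t x y hs hst ht hx hxy hy
    have hsT : s ∈ Icc 0 T := ⟨hs, hst.le.trans ht⟩
    have htT : t ∈ Icc 0 T := ⟨hs.trans hst.le, ht⟩
    refine (eLpNorm'_sub_le (hLm k t x y).aestronglyMeasurable (hLm k s x y).aestronglyMeasurable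
      hr1).trans ((add_le_add (h₁ r hr k t htT x y hx hxy hy)
        (h₁ r hr k s hsT x y hx hxy hy)).trans (le_of_eq ?_))
    rw [ENNReal.ofReal_mul (by norm_num : (0 : ℝ) ≤ 2), ENNReal.ofReal_ofNat]
    ring
  refine ⟨B * S, ENNReal.mul_ne_top hBtop hStop, fun k => ⟨?_, ?_⟩⟩
  · refine eLpNorm'_sheetBesovNorm_le hq hqr (hL k) fun s t hs hst ht x y hx hxy hy => ?_
    have h2 : 0 < y - x := sub_pos.2 hxy
    have hw1 : √(y - x) ≤ 1 := Real.sqrt_le_one.2 (by linarith)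
    have hw := (hspace k s t x y hs hst ht hx hxy hy).trans
      (hscale (by norm_num) (by linarith))
    have hv := (htime k s t x y hs hst ht hx hxy hy).trans (hscale hC (by linarith))
    -- For the norm of a single lift no decay in `k` is wanted. The bound by 1 replaces 2^{-k/2},
    -- which keeps the exponents equal to those of the difference.
    have hu : _ ≤ B * ENNReal.ofReal ((y - x) ^ c * 1) := hw.trans (by gcongr)
    have := le_mul_of_le_interpolation (by positivity) zero_le_one (Real.sqrt_nonneg _)
      (Real.sqrt_nonneg _) hε.le hθ hεθ hu hv hw
    rw [hexp hst hxy, Real.one_rpow, one_mul,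
      ENNReal.ofReal_mul (Real.rpow_nonneg (sub_pos.2 hst).le _), ← mul_assoc] at this
    exact this
  · have hD : Measurable fun p : Ω × ℝ × ℝ × ℝ =>
        L (k + 1) p.1 p.2.1 p.2.2.1 p.2.2.2 - L k p.1 p.2.1 p.2.2.1 p.2.2.2 := (hL _).sub (hL _)
    rw [mul_right_comm]
    refine eLpNorm'_sheetBesovNorm_le hq hqr
      (G := fun ω t x y => L (k + 1) ω t x y - L k ω t x y) hD
      fun s t hs hst ht x y hx hxy hy => ?_
    have hsT : s ∈ Icc 0 T := ⟨hs, hst.le.trans ht⟩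
    have htT : t ∈ Icc 0 T := ⟨hs.trans hst.le, ht⟩
    have m : ∀ k t, AEStronglyMeasurable (fun ω => L k ω t x y) P := fun k t =>
      (hLm k t x y).aestronglyMeasurable
    -- The difference in both level and time can be grouped by levels, by times, or estimated by
    -- sizes alone; the geometric mean of the three bounds is small in `k`, in t - s and in y - x at
    -- once.
    set z := eLpNorm' (fun ω => L (k + 1) ω t x y - L k ω t x y
      - (L (k + 1) ω s x y - L k ω s x y)) r P with hz
    have hz2 : z ≤ eLpNorm' (fun ω => L (k + 1) ω t x y - L (k + 1) ω s x y) r P +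
        eLpNorm' (fun ω => L k ω t x y - L k ω s x y) r P := by
      refine le_trans (le_of_eq ?_) (eLpNorm'_sub_le ((m (k + 1) t).sub (m (k + 1) s))
        ((m k t).sub (m k s)) hr1)
      refine congrArg (fun f => eLpNorm' f r P) (funext fun ω => ?_)
      abel
    have hdouble : ∀ {b : ℝ}, M r * ENNReal.ofReal b + M r * ENNReal.ofReal b =
        M r * ENNReal.ofReal (2 * b) := fun {b} => by
      rw [ENNReal.ofReal_mul (by norm_num : (0 : ℝ) ≤ 2), ENNReal.ofReal_ofNat]; ring
    have hv : z ≤ B * ENNReal.ofReal ((y - x) ^ c * √√(t - s)) := by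
      refine (hz2.trans (add_le_add (htime _ s t x y hs hst ht hx hxy hy)
        (htime _ s t x y hs hst ht hx hxy hy))).trans ?_
      rw [hdouble, ← mul_assoc]
      exact hscale (by positivity) (by linarith)
    have hw : z ≤ B * ENNReal.ofReal ((y - x) ^ c * √(y - x)) := by
      refine (hz2.trans (add_le_add (hspace _ s t x y hs hst ht hx hxy hy)
        (hspace _ s t x y hs hst ht hx hxy hy))).trans ?_
      rw [hdouble, ← mul_assoc]
      exact hscale (by norm_num) (by linarith)
    have hu : z ≤ B * ENNReal.ofReal ((y - x) ^ c * √((2 : ℝ) ^ k)⁻¹) := by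
      have hk : ∀ t ∈ Icc 0 T, eLpNorm' (fun ω => L (k + 1) ω t x y - L k ω t x y) r P ≤
          M r * ENNReal.ofReal ((y - x) ^ c * (4 * √((2 : ℝ) ^ k)⁻¹)) := fun t ht =>
        h₂ r hr (k + 1) k t ht t ht _ (fun i => rmsClose_succ (hW.whiteNoise i) ht k) x y hx hxy hy
      refine ((eLpNorm'_sub_le ((m (k + 1) t).sub (m k t)) ((m (k + 1) s).sub (m k s)) hr1).trans
        (add_le_add (hk t htT) (hk s hsT))).trans ?_
      rw [hdouble, show 2 * ((y - x) ^ c * (4 * √((2 : ℝ) ^ k)⁻¹)) =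
        8 * ((y - x) ^ c * √((2 : ℝ) ^ k)⁻¹) by ring]
      exact hscale (by norm_num) (by linarith)
    have := le_mul_of_le_interpolation (Real.rpow_nonneg (sub_pos.2 hxy).le _)
      (Real.sqrt_nonneg _) (Real.sqrt_nonneg _) (Real.sqrt_nonneg _) hε.le hθ hεθ hu hv hw
    have hηk : √((2 : ℝ) ^ k)⁻¹ ^ ε = η ^ k := by
      have : √((2 : ℝ) ^ k) = √2 ^ k := by
        rw [Real.sqrt_eq_iff_mul_self_eq (by positivity) (by positivity), ← mul_pow,
          Real.mul_self_sqrt (by norm_num)]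
      rw [hη, Real.rpow_pow_comm (by positivity), Real.sqrt_inv, this, inv_pow]
    rw [hexp hst hxy, hηk, ENNReal.ofReal_mul (by positivity),
      ENNReal.ofReal_mul (Real.rpow_nonneg (sub_pos.2 hst).le _), ← mul_assoc, ← mul_assoc] at this
    exact this

theorem exists_fst_moments [IsProbabilityMeasure P] (hW : IsSpaceTimeWhiteNoise T W P)
    (hφ : IsRegularField T W φ P) {q α β ε θ : ℝ} (hq : 0 < q) (hε : 0 < ε) (hθ : 0 ≤ θ)
    (hεθ : ε + θ ≤ 1) (hβ : β < θ / 4) (hα : α < (1 - ε - θ) / 2) :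
    ∃ η, 0 < η ∧ η < 1 ∧ ∀ r, 2 ≤ r → q ≤ r → ∃ K : ℝ≥0∞, K ≠ ⊤ ∧ ∀ k,
      eLpNorm' (fun ω => sheetBesovNorm T β α q fun t => (dyadicLift φ k ω t).fst) r P ≤ K ∧
      eLpNorm' (fun ω => sheetBesovNorm T β α q fun t x y =>
        (dyadicLift φ (k + 1) ω t).fst x y - (dyadicLift φ k ω t).fst x y) r P ≤
        K * ENNReal.ofReal (η ^ k) := by
  refine exists_level_moments hW (L := fun k ω t => (dyadicLift φ k ω t).fst) (c := 0)
    hφ.measurable_fst (fun r hr => momentConst_ne_top d (by linarith))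
    (fun r hr k t ht x y hx hxy hy => ?_) (fun r hr k l s hs t ht δ hδ x y hx hxy hy => ?_)
    hq hε hθ hεθ hβ (by linarith)
  · rw [Real.rpow_zero, one_mul]
    exact eLpNorm'_fst_le hW hφ k ht hr hx hxy.le hy
  · rw [Real.rpow_zero, one_mul]
    exact eLpNorm'_fst_sub_le hW hφ hs ht hδ hr hx hxy.le hy

theorem exists_snd_moments [IsProbabilityMeasure P] (hW : IsSpaceTimeWhiteNoise T W P)
    (hφ : IsRegularField T W φ P) {q α β ε θ : ℝ} (hq : 0 < q) (hε : 0 < ε) (hθ : 0 ≤ θ)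
    (hεθ : ε + θ ≤ 1) (hβ : β < θ / 4) (hα : α < 1 - (ε + θ) / 2) :
    ∃ η, 0 < η ∧ η < 1 ∧ ∀ r, 2 ≤ r → q ≤ r → ∃ K : ℝ≥0∞, K ≠ ⊤ ∧ ∀ k,
      eLpNorm' (fun ω => sheetBesovNorm T β α q fun t => (dyadicLift φ k ω t).snd) r P ≤ K ∧
      eLpNorm' (fun ω => sheetBesovNorm T β α q fun t x y =>
        (dyadicLift φ (k + 1) ω t).snd x y - (dyadicLift φ k ω t).snd x y) r P ≤
        K * ENNReal.ofReal (η ^ k) := by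
  refine exists_level_moments hW (L := fun k ω t => (dyadicLift φ k ω t).snd) (c := 1 / 2)
    hφ.measurable_snd (fun r hr => momentConst_ne_top d (by linarith))
    (fun r hr k t ht x y hx hxy hy => ?_) (fun r hr k l s hs t ht δ hδ x y hx hxy hy => ?_)
    hq hε hθ hεθ hβ (by linarith)
  · rw [← Real.sqrt_eq_rpow, ENNReal.ofReal_mul (Real.sqrt_nonneg _)]
    exact eLpNorm'_snd_le hW hφ k ht hr hx hxy.le hy
  · rw [← Real.sqrt_eq_rpow, ENNReal.ofReal_mul (Real.sqrt_nonneg _)]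
    exact eLpNorm'_snd_sub_le hW hφ hs ht hδ hr hx hxy.le hy

theorem init_moment [IsProbabilityMeasure P] (hW : IsSpaceTimeWhiteNoise T W P)
    (hφ : IsRegularField T W φ P) {q β : ℝ} (hq : 2 ≤ q) (hβ : β < 1 / 4) :
    ∀ᵐ ω ∂P, pathBesovNorm T β q (fun t => φ t 0 ω) ≠ ⊤ := by
  have hq0 : 0 < q := by linarith
  obtain ⟨C, hC, hCr⟩ := exists_rmsClose_time hW
  have hm : Measurable fun z : Ω × ℝ × ℝ => φ z.2.2 0 z.1 - φ z.2.1 0 z.1 :=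
    ((hφ.measurable_time 0).comp (by fun_prop : Measurable fun z : Ω × ℝ × ℝ => (z.1, z.2.2))).sub
      ((hφ.measurable_time 0).comp (by fun_prop : Measurable fun z : Ω × ℝ × ℝ => (z.1, z.2.1)))
  set F : Ω → ℝ × ℝ → ℝ≥0∞ := fun ω p => ‖φ p.2 0 ω - φ p.1 0 ω‖ₑ with hF
  have hFm : Measurable (Function.uncurry F) := hm.enorm
  have h0 : (0 : ℝ) ∈ Icc (0 : ℝ) 1 := ⟨le_rfl, zero_le_one⟩
  have h := eLpNorm'_simplex_le (P := P) (T := T) (b := 1 / 4) (β := β) hq0 le_rfl hFm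
    (K := d * (gaussMoment q * ENNReal.ofReal C)) fun s t hs hst ht => by
    have hsT : s ∈ Icc 0 T := ⟨hs, hst.le.trans ht⟩
    have htT : t ∈ Icc 0 T := ⟨hs.trans hst.le, ht⟩
    rw [hF, eLpNorm'_enorm]
    have hc : ∀ i : Fin d, eLpNorm' (fun ω => (φ t 0 ω - φ s 0 ω) i) q P ≤
        gaussMoment q * (ENNReal.ofReal C * ENNReal.ofReal ((t - s) ^ (1 / 4 : ℝ))) := fun i => by
      have e : √√|t - s| = (t - s) ^ (1 / 4 : ℝ) := by
        have h1 := sub_pos.2 hst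
        rw [abs_of_pos h1, Real.sqrt_eq_rpow, Real.sqrt_eq_rpow, ← Real.rpow_mul h1.le]
        norm_num
      rw [← ENNReal.ofReal_mul hC, ← e]
      -- At x = 0, a node of every level, interpolation changes nothing, so the time bound for level
      -- 0 is one for the field itself.
      have hr := hCr i s hsT t htT 0 0 h0
      have := eLpNorm'_le_of_rms_le (hW.whiteNoise i) (r := q) (Submodule.sub_mem _
        (heatPoly_mem (W := W i) (a := (0, t)) htT 0) (heatPoly_mem (W := W i) (a := (0, s)) hsT 0))
        hq0 hr
      refine (le_of_eq (eLpNorm'_congr_ae ?_)).trans this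
      filter_upwards [hφ.modification t htT 0 h0 i, hφ.modification s hsT 0 h0 i] with ω h1 h2
      rw [PiLp.sub_apply, h1, h2, Pi.sub_apply, heatPoly, heatPoly, poly_zero, poly_zero]
    refine (eLpNorm'_le_sum ((hφ.measurable t 0).sub (hφ.measurable s 0)) (by linarith)).trans
      ((Finset.sum_le_sum fun i _ => hc i).trans (le_of_eq ?_))
    rw [Finset.sum_const, Finset.card_univ, Fintype.card_fin, nsmul_eq_mul]
    ring
  have htop : eLpNorm' (fun ω => eLpNorm' (F ω) q (simplexMeasure T (1 + q * β))) q P < ⊤ := by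
    refine h.trans_lt (lt_top_iff_ne_top.2 (ENNReal.mul_ne_top (ENNReal.mul_ne_top (by simp)
      (ENNReal.mul_ne_top (gaussMoment_ne_top hq0) ENNReal.ofReal_ne_top)) ?_))
    exact ENNReal.rpow_ne_top_of_nonneg (by positivity)
      (simplexMeasure_univ_lt_top (mul_pos hq0 (sub_pos.2 hβ)) _).ne
  have hmF : Measurable fun ω => eLpNorm' (F ω) q (simplexMeasure T (1 + q * β)) := by
    simp only [eLpNorm'_eq_lintegral_enorm, enorm_eq_self]
    exact ((hFm.pow_const q).lintegral_prod_right').pow_const _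
  filter_upwards [ae_lt_top_of_eLpNorm' hq0 hmF htop] with ω hω
  rw [pathBesovNorm_eq hq0.le]
  refine ENNReal.add_ne_top.2 ⟨enorm_ne_top, ?_⟩
  rw [← eLpNorm'_enorm]
  exact hω.ne

end SheetMoments

/-! ### Regularisation of the solution -/

section Regularisation

variable {Ω : Type*} [MeasurableSpace Ω] {P : Measure Ω} {T : ℝ} {d : ℕ}
  {W : Fin d → (ℝ × ℝ → ℝ) → Ω → ℝ} {ψ : ℝ → ℝ → Ω → EuclideanSpace ℝ (Fin d)}

theorem heatField_zero_ae {W : (ℝ × ℝ → ℝ) → Ω → ℝ} (hT : 0 ≤ T)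
    (hW : IsWhiteNoise (spaceTimeMeasure T) W P) (x : ℝ) : heatField W 0 x =ᵐ[P] 0 := by
  have hf := memLp_mildKernel (T := T) (t := 0) ⟨le_rfl, hT⟩ x
  have h0 : ∀ᵐ z ∂spaceTimeMeasure T, mildKernel 0 x z = 0 := by
    filter_upwards [ae_restrict_mem (measurableSet_Icc.prod measurableSet_Icc)] with z hz
    simp [mildKernel, not_lt.2 hz.1.1]
  have h1 : ∫ ω, heatField W 0 x ω ^ 2 ∂P = 0 := by
    simp only [heatField, sq]
    rw [hW.covariance _ _ hf hf]
    exact integral_eq_zero_of_ae (h0.mono fun z hz => by simp [hz])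
  have hi := (hW.memLp (mem_noiseSpan hf)).integrable_sq
  have h2 := (integral_eq_zero_iff_of_nonneg (fun ω => sq_nonneg _) hi).1 h1
  filter_upwards [h2] with ω hω
  simpa using! hω

theorem eq_zero_of_rational {V : Type*} [NormedAddCommGroup V] {f : ℝ → V}
    (hf : ContinuousOn f (Icc 0 1))
    (h : ∀ n i : ℕ, i ≤ n → f (i / n) = 0) {x : ℝ} (hx : x ∈ Icc (0 : ℝ) 1) : f x = 0 := by
  have h1 : Tendsto (fun n : ℕ => (⌊x * n⌋₊ / n : ℝ)) atTop (𝓝 x) :=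
    (tendsto_nat_floor_mul_div_atTop hx.1).comp tendsto_natCast_atTop_atTop
  have hle : ∀ n : ℕ, ⌊x * n⌋₊ ≤ n := fun n =>
    Nat.floor_le_of_le (mul_le_of_le_one_left n.cast_nonneg hx.2)
  have h2 : ∀ n : ℕ, (⌊x * n⌋₊ / n : ℝ) ∈ Icc (0 : ℝ) 1 := fun n =>
    ⟨by positivity, div_le_one_of_le₀ (by exact_mod_cast hle n) n.cast_nonneg⟩
  have h3 := (hf x hx).tendsto.comp (tendsto_nhdsWithin_iff.2 ⟨h1, Eventually.of_forall h2⟩)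
  refine tendsto_nhds_unique h3 (tendsto_const_nhds.congr fun n => ?_)
  exact (h n _ (hle n)).symm

/-- On a measurable null set the field is replaced by zero; elsewhere it is continuous on the
rectangle and is extended to the plane by projection. This makes joint measurability and all
pathwise statements free of exceptional sets. -/
theorem exists_isRegularField [IsProbabilityMeasure P] (hT : 0 < T)
    (hW : IsSpaceTimeWhiteNoise T W P) (hψ : IsStochasticHeatSolution T W ψ P) :
    ∃ φ : ℝ → ℝ → Ω → EuclideanSpace ℝ (Fin d), IsRegularField T W φ P ∧
      ∀ᵐ ω ∂P, ∀ t ∈ Icc (0 : ℝ) T, ∀ x ∈ Icc (0 : ℝ) 1, ψ t x ω = φ t x ω := by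
  have hT0 : (0 : ℝ) ∈ Icc (0 : ℝ) T := ⟨le_rfl, hT.le⟩
  -- The initial value is known almost surely at each point only. Countably many rationals share a
  -- null set, and continuity gives the rest.
  have hz : ∀ᵐ ω ∂P, ∀ n i : ℕ, i ≤ n → ψ 0 (i / n) ω = 0 := by
    rw [ae_all_iff]; intro n
    rw [ae_all_iff]; intro i
    by_cases hi : i ≤ n
    · have hx : (i / n : ℝ) ∈ Icc (0 : ℝ) 1 :=
        ⟨by positivity, div_le_one_of_le₀ (by exact_mod_cast hi) n.cast_nonneg⟩
      have h : ∀ᵐ ω ∂P, ∀ j, ψ 0 (i / n) ω j = 0 := by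
        rw [ae_all_iff]; intro j
        filter_upwards [hψ.mild 0 hT0 _ hx j, heatField_zero_ae hT.le (hW.whiteNoise j) (i / n)]
          with ω h1 h2
        rw [h1]; exact h2
      filter_upwards [h] with ω hω _
      ext j; exact hω j
    · exact Eventually.of_forall fun ω h => absurd h hi
  obtain ⟨N, hsub, hN, hN0⟩ := exists_measurable_superset_of_null (ae_iff.1 (hψ.continuous.and hz))
  have hgood : ∀ ω, ω ∉ N → ContinuousOn (fun q : ℝ × ℝ => ψ q.1 q.2 ω) (Icc 0 T ×ˢ Icc 0 1) ∧
      ∀ n i : ℕ, i ≤ n → ψ 0 (i / n) ω = 0 := fun ω hω => by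
    by_contra h; exact hω (hsub h)
  have hae : ∀ᵐ ω ∂P, ω ∉ N := measure_eq_zero_iff_ae_notMem.1 hN0
  classical
  let φ : ℝ → ℝ → Ω → EuclideanSpace ℝ (Fin d) := fun t x ω =>
    if ω ∈ N then 0 else ψ (projIcc 0 T hT.le t) (projIcc 0 1 zero_le_one x) ω
  have heq : ∀ t ∈ Icc (0 : ℝ) T, ∀ x ∈ Icc (0 : ℝ) 1, ∀ ω, ω ∉ N → ψ t x ω = φ t x ω :=
    fun t ht x hx ω hω => by
    simp only [φ, if_neg hω, projIcc_of_mem _ ht, projIcc_of_mem _ hx]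
  refine ⟨φ, ⟨fun t z => ?_, fun ω => ?_, fun z ω => ?_, fun t ht x hx i => ?_⟩, ?_⟩
  · exact Measurable.ite hN measurable_const (hψ.measurable _ (projIcc 0 T hT.le t).2 _
      (projIcc 0 1 zero_le_one z).2)
  · by_cases hω : ω ∈ N
    · simp only [φ, if_pos hω]; exact continuous_const
    · simp only [φ, if_neg hω]
      have hc : Continuous fun q : ℝ × ℝ =>
          ((projIcc 0 T hT.le q.1 : ℝ), (projIcc 0 1 zero_le_one q.2 : ℝ)) :=
        ((continuous_subtype_val.comp continuous_projIcc).comp continuous_fst).prodMk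
          ((continuous_subtype_val.comp continuous_projIcc).comp continuous_snd)
      exact (hgood ω hω).1.comp_continuous hc fun q => ⟨Subtype.prop _, Subtype.prop _⟩
  · by_cases hω : ω ∈ N
    · simp only [φ, if_pos hω]
    · simp only [φ, if_neg hω, projIcc_of_mem _ hT0]
      have hc : ContinuousOn (fun y => ψ 0 y ω) (Icc 0 1) :=
        (hgood ω hω).1.comp (f := fun y => ((0 : ℝ), y)) (by fun_prop) fun y hy => ⟨hT0, hy⟩
      exact eq_zero_of_rational hc (hgood ω hω).2 (Subtype.prop _)
  · filter_upwards [hae, hψ.mild t ht x hx i] with ω h1 h2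
    rw [← heq t ht x hx ω h1, h2]; rfl
  · filter_upwards [hae] with ω hω t ht x hx using heq t ht x hx ω hω

theorem tendsto_poly {V : Type*} [NormedAddCommGroup V] [NormedSpace ℝ V] {f : ℝ → V}
    (hf : Continuous f) {x : ℝ} (hx : x ∈ Icc (0 : ℝ) 1) :
    Tendsto (fun k => poly k f x) atTop (𝓝 (f x)) := by
  rw [Metric.tendsto_atTop]
  intro ε hε
  obtain ⟨δ, hδ, h⟩ := Metric.continuousAt_iff.1 hf.continuousAt (ε / 2) (half_pos hε)
  have h2 : Tendsto (fun k : ℕ => ((2 : ℝ) ^ k)⁻¹) atTop (𝓝 0) :=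
    tendsto_inv_atTop_zero.comp (tendsto_pow_atTop_atTop_of_one_lt one_lt_two)
  obtain ⟨N, hN⟩ := eventually_atTop.1 (h2.eventually (gt_mem_nhds hδ))
  refine ⟨N, fun k hk => ?_⟩
  rw [dist_eq_norm]
  refine lt_of_le_of_lt (norm_poly_sub_self_le (r := ε / 2) hx fun z _ hzx => ?_) (half_lt_self hε)
  rw [← dist_eq_norm]
  exact (h (by rw [Real.dist_eq]; exact hzx.trans_lt (hN k hk))).le

/-- Minkowski's inequality for infinite sums, by Fatou from finite ones. Geometric decay of moments
thus yields both almost sure summability and convergence of tails in L^r. -/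
theorem eLpNorm'_tsum_le {S : ℕ → Ω → ℝ≥0∞} (hS : ∀ k, Measurable (S k)) {r : ℝ} (hr : 1 ≤ r)
    {c : ℕ → ℝ≥0∞} (h : ∀ k, eLpNorm' (S k) r P ≤ c k) :
    eLpNorm' (fun ω => ∑' k, S k ω) r P ≤ ∑' k, c k := by
  refine eLpNorm'_le_of_le_liminf (f := fun n ω => ∑ k ∈ Finset.range n, S k ω) (by linarith)
    (fun n => Finset.measurable_fun_sum _ fun k _ => hS k)
    (Eventually.of_forall fun ω => ENNReal.summable.hasSum.tendsto_sum_nat.liminf_eq.ge)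
    (Eventually.of_forall fun n => ?_)
  have h1 := eLpNorm'_sum_le (μ := P) (s := Finset.range n) (f := S) (q := r)
    (fun k _ => (hS k).aestronglyMeasurable) hr
  refine le_trans (le_of_eq ?_) (h1.trans ((Finset.sum_le_sum fun k _ => h k).trans
    (ENNReal.sum_le_tsum _)))
  congr 1; ext ω; rw [Finset.sum_apply]

theorem tsum_geometric_ne_top {K : ℝ≥0∞} (hK : K ≠ ⊤) {η : ℝ} (h0 : 0 < η) (h1 : η < 1) :
    ∑' k : ℕ, K * ENNReal.ofReal (η ^ k) ≠ ⊤ := by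
  rw [ENNReal.tsum_mul_left]
  exact ENNReal.mul_ne_top hK (summable_geometric_of_lt_one h0.le h1).tsum_ofReal_ne_top

theorem ae_tsum_ne_top {S : ℕ → Ω → ℝ≥0∞} (hS : ∀ k, Measurable (S k)) {r : ℝ} (hr : 1 ≤ r)
    {K : ℝ≥0∞} (hK : K ≠ ⊤) {η : ℝ} (h0 : 0 < η) (h1 : η < 1)
    (h : ∀ k, eLpNorm' (S k) r P ≤ K * ENNReal.ofReal (η ^ k)) :
    ∀ᵐ ω ∂P, ∑' k, S k ω ≠ ⊤ := by
  have h2 := (eLpNorm'_tsum_le hS hr h).trans_lt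
    (lt_top_iff_ne_top.2 (tsum_geometric_ne_top hK h0 h1))
  filter_upwards [ae_lt_top_of_eLpNorm' (by linarith) (Measurable.tsum hS) h2]
    with ω hω using hω.ne

end Regularisation

/-! ### Dependence on the values on the simplex only -/

section Congruence

variable {d : ℕ} {T α β m : ℝ}

/-- The triples `X` and `Y` agree on the simplex. -/
structure AgreeOn (X Y : RoughTriple d) : Prop where
  init : X.init = Y.init
  fst : ∀ p ∈ simplex 1, X.fst p.1 p.2 = Y.fst p.1 p.2
  snd : ∀ p ∈ simplex 1, X.snd p.1 p.2 = Y.snd p.1 p.2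

theorem IsBesovRoughPath.congr {X Y : RoughTriple d} (h : AgreeOn X Y)
    (hY : IsBesovRoughPath α m Y) : IsBesovRoughPath α m X where
  continuous_fst := hY.continuous_fst.congr h.fst
  continuous_snd := hY.continuous_snd.congr h.snd
  chen_fst x z y hx hz hy hy1 := by
    rw [h.fst (x, y) ⟨hx, hz.trans hy, hy1⟩, h.fst (x, z) ⟨hx, hz, hy.trans hy1⟩,
      h.fst (z, y) ⟨hx.trans hz, hy, hy1⟩]
    exact hY.chen_fst x z y hx hz hy hy1
  chen_snd x z y hx hz hy hy1 := by
    rw [h.fst (x, z) ⟨hx, hz, hy.trans hy1⟩, h.fst (z, y) ⟨hx.trans hz, hy, hy1⟩,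
      h.snd (x, y) ⟨hx, hz.trans hy, hy1⟩, h.snd (x, z) ⟨hx, hz, hy.trans hy1⟩,
      h.snd (z, y) ⟨hx.trans hz, hy, hy1⟩]
    exact hY.chen_snd x z y hx hz hy hy1
  fst_finite := by
    rw [besovNorm_congr (B := Y.fst) fun p hp => by rw [h.fst p hp]]; exact hY.fst_finite
  snd_finite := by
    rw [besovNorm_congr (B := Y.snd) fun p hp => by rw [h.snd p hp]]; exact hY.snd_finite

theorem besovDist_congr {X Y X' Y' : RoughTriple d} (h : AgreeOn X Y) (h' : AgreeOn X' Y') :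
    besovDist α m X X' = besovDist α m Y Y' := by
  unfold besovDist
  rw [h.init, h'.init,
    besovNorm_congr (A := fun x y => X.fst x y - X'.fst x y) (B := fun x y => Y.fst x y - Y'.fst x y)
      fun p hp => by rw [h.fst p hp, h'.fst p hp],
    besovNorm_congr (A := fun x y => X.snd x y - X'.snd x y) (B := fun x y => Y.snd x y - Y'.snd x y)
      fun p hp => by rw [h.snd p hp, h'.snd p hp]]

theorem AgreeOn.refl (X : RoughTriple d) : AgreeOn X X := ⟨rfl, fun _ _ => rfl, fun _ _ => rfl⟩

theorem pathBesovNorm_congr {V : Type*} [NormedAddCommGroup V] (hT : 0 ≤ T) {f g : ℝ → V}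
    (h : ∀ t ∈ Icc 0 T, f t = g t) : pathBesovNorm T β m f = pathBesovNorm T β m g := by
  unfold pathBesovNorm
  rw [h 0 ⟨le_rfl, hT⟩]
  congr 2
  refine setLIntegral_congr_fun (measurableSet_simplex T) fun p hp => ?_
  simp only [h p.1 ⟨hp.1, hp.2.1.trans hp.2.2⟩, h p.2 ⟨hp.1.trans hp.2.1, hp.2.2⟩]

theorem IsBesovPath.congr (hT : 0 ≤ T) {X Y : ℝ → RoughTriple d}
    (h : ∀ t ∈ Icc 0 T, AgreeOn (X t) (Y t)) (hY : IsBesovPath T β α m Y) :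
    IsBesovPath T β α m X where
  geometric t ht := by
    refine ⟨(hY.geometric t ht).isRough.congr (h t ht), fun ε hε => ?_⟩
    obtain ⟨a, ha, hd⟩ := (hY.geometric t ht).mem_closure ε hε
    exact ⟨a, ha, by rwa [besovDist_congr (h t ht) (AgreeOn.refl _)]⟩
  continuous t ht := by
    refine (hY.continuous t ht).congr' ?_
    filter_upwards [self_mem_nhdsWithin] with s hs
    exact (besovDist_congr (h s hs) (h t ht)).symm
  init_finite := by
    rw [pathBesovNorm_congr hT fun t ht => (h t ht).init]; exact hY.init_finite
  fst_finite := by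
    rw [sheetBesovNorm_congr (H := fun t => (Y t).fst) fun t ht p hp => (h t ht).fst p hp]
    exact hY.fst_finite
  snd_finite := by
    rw [sheetBesovNorm_congr (H := fun t => (Y t).snd) fun t ht p hp => (h t ht).snd p hp]
    exact hY.snd_finite

theorem besovPathDist_congr (hT : 0 ≤ T) {X Y Z : ℝ → RoughTriple d}
    (h : ∀ t ∈ Icc 0 T, AgreeOn (X t) (Y t)) :
    besovPathDist T β α m X Z = besovPathDist T β α m Y Z := by
  have h0 := h 0 ⟨le_rfl, hT⟩
  unfold besovPathDist
  rw [pathBesovNorm_congr (g := fun t => (Y t).init - (Z t).init) hT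
      fun t ht => by rw [(h t ht).init],
    besovNorm_congr (B := fun x y => (Y 0).fst x y - (Z 0).fst x y) fun p hp => by rw [h0.fst p hp],
    besovNorm_congr (B := fun x y => (Y 0).snd x y - (Z 0).snd x y) fun p hp => by rw [h0.snd p hp],
    sheetBesovNorm_congr (G := fun t x y => (X t).fst x y - (Z t).fst x y)
      (H := fun t x y => (Y t).fst x y - (Z t).fst x y) fun t ht p hp => by rw [(h t ht).fst p hp],
    sheetBesovNorm_congr (G := fun t x y => (X t).snd x y - (Z t).snd x y)
      (H := fun t x y => (Y t).snd x y - (Z t).snd x y) fun t ht p hp => by rw [(h t ht).snd p hp]]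

end Congruence

/-! ### Convergence of the dyadic lifts -/

section Convergence

variable {Ω : Type*} {T α β m : ℝ} {d : ℕ}
  {φ : ℝ → ℝ → Ω → EuclideanSpace ℝ (Fin d)}

/-- Summability of the Besov norms of the dyadic lifts of one realisation of the field. -/
structure IsSummableAt (T α β m : ℝ) (φ : ℝ → ℝ → Ω → EuclideanSpace ℝ (Fin d)) (ω : Ω) :
    Prop where
  init : pathBesovNorm T β m (fun t => φ t 0 ω) ≠ ⊤
  fst_finite : ∀ k, sheetBesovNorm T β α m (fun t => (dyadicLift φ k ω t).fst) ≠ ⊤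
  fst_summable : ∑' k, sheetBesovNorm T β α m (fun t x y =>
    (dyadicLift φ (k + 1) ω t).fst x y - (dyadicLift φ k ω t).fst x y) ≠ ⊤
  rough_finite : ∀ k, sheetBesovNorm T (2 * β) (1 / 6) (m / 2)
    (fun t => (dyadicLift φ k ω t).fst) ≠ ⊤
  rough_summable : ∑' k, sheetBesovNorm T (2 * β) (1 / 6) (m / 2) (fun t x y =>
    (dyadicLift φ (k + 1) ω t).fst x y - (dyadicLift φ k ω t).fst x y) ≠ ⊤
  snd_finite : ∀ k, sheetBesovNorm T (2 * β) (2 * α) (m / 2)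
    (fun t => (dyadicLift φ k ω t).snd) ≠ ⊤
  snd_summable : ∑' k, sheetBesovNorm T (2 * β) (2 * α) (m / 2) (fun t x y =>
    (dyadicLift φ (k + 1) ω t).snd x y - (dyadicLift φ k ω t).snd x y) ≠ ⊤

theorem isSheet_dyadicLift {ω : Ω} (hc : Continuous fun q : ℝ × ℝ => φ q.1 q.2 ω)
    (h0 : ∀ z, φ 0 z ω = 0) (k : ℕ) {T α m : ℝ} (hm : 0 < m) (hα : α < 1) :
    IsSheet T α m (fun t => (dyadicLift φ k ω t).fst) ∧
      IsSheet T α m (fun t => (dyadicLift φ k ω t).snd) := by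
  have h : ∀ z, Continuous fun t => φ t z ω := fun z =>
    hc.comp (by fun_prop : Continuous fun t : ℝ => (t, z))
  exact ⟨isSheet_lift_fst (φ := fun t z => φ t z ω) h h0 k hm hα,
    isSheet_lift_snd (φ := fun t z => φ t z ω) h h0 k hm hα⟩

/-- The second levels converge uniformly in space. -/
theorem exists_edist_dyadicLift_le (hT : 0 < T) (hα : 1 / 12 ≤ α) (hα' : α < 1 / 2) (hm : 12 < m)
    (hβm : 1 < m * β) {ω : Ω} (hc : Continuous fun q : ℝ × ℝ => φ q.1 q.2 ω)
    (h0 : ∀ z, φ 0 z ω = 0) (hω : IsSummableAt T α β m φ ω) {t : ℝ} (ht : t ∈ Icc 0 T) :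
    ∃ e : ℕ → ℝ≥0∞, ∑' k, e k ≠ ⊤ ∧ ∀ k, ∀ p ∈ simplex 1,
      edist ((dyadicLift φ k ω t).snd p.1 p.2) ((dyadicLift φ (k + 1) ω t).snd p.1 p.2) ≤ e k := by
  have hq : 1 ≤ m / 2 := by linarith
  have hq0 : 0 < m / 2 := by linarith
  have hβ' : 1 < m / 2 * (2 * β) := by linarith
  obtain ⟨C₁, hC₁, h₁⟩ := exists_besovNorm_le_sheet (EuclideanSpace ℝ (Fin d)) hT hq hβ' (1 / 6)
  obtain ⟨C₂, hC₂, h₂⟩ := exists_besovNorm_le_sheet (EuclideanSpace ℝ (Fin d × Fin d)) hT hq hβ'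
    (2 * α)
  have s₁ := fun k => (isSheet_dyadicLift hc h0 k (T := T) (α := 1 / 6) (m := m / 2) hq0
    (by norm_num)).1
  have s₂ := fun k => (isSheet_dyadicLift hc h0 k (T := T) (α := 2 * α) (m := m / 2) hq0
    (by linarith)).2
  -- The exponent 1/6 works with q = m/2: m > 12 gives q/6 > 1, and 1/6 ≤ 2α allows the second level
  -- to be measured in the weaker norm. Both levels must be controlled with the same q, hence the
  -- separate (2β, 1/6, m/2) bounds for the first level.
  refine exists_edist_snd_le (A₁ := fun k => (dyadicLift φ k ω t).fst)
    (A₂ := fun k => (dyadicLift φ k ω t).snd) hq (γ := 1 / 6) (by linarith)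
    (fun k => isChen_lift_polygonal k _) ?_ ?_ ?_
  · exact ne_top_of_le_ne_top (ENNReal.mul_ne_top hC₁ (hω.rough_finite 0)) (h₁ _ (s₁ 0) t ht)
  · refine ne_top_of_le_ne_top (ENNReal.mul_ne_top hC₁ hω.rough_summable) ?_
    rw [← ENNReal.tsum_mul_left]
    exact ENNReal.tsum_le_tsum fun k => h₁ _ ((s₁ (k + 1)).sub hq (s₁ k)) t ht
  · refine ne_top_of_le_ne_top (ENNReal.mul_ne_top hC₂ hω.snd_summable) ?_
    rw [← ENNReal.tsum_mul_left]
    exact ENNReal.tsum_le_tsum fun k => (besovNorm_mono_exponent hq0.le (by linarith) _).trans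
      (h₂ _ ((s₂ (k + 1)).sub hq (s₂ k)) t ht)

theorem exists_tendsto_of_edist_le {V : Type*} [PseudoEMetricSpace V] [CompleteSpace V] {f : ℕ → V}
    {e : ℕ → ℝ≥0∞} (he : ∑' k, e k ≠ ⊤) (h : ∀ k, edist (f k) (f (k + 1)) ≤ e k) :
    ∃ l, Tendsto f atTop (𝓝 l) :=
  cauchySeq_tendsto_of_complete (cauchySeq_of_edist_le_of_tsum_ne_top e h he)

/-- A uniformly summable sequence of continuous functions has a continuous limit. -/
theorem continuousOn_of_edist_le {X V : Type*} [TopologicalSpace X] [PseudoEMetricSpace V]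
    {S : Set X} {f : ℕ → X → V} {g : X → V} {e : ℕ → ℝ≥0∞} (he : ∑' k, e k ≠ ⊤)
    (h : ∀ k, ∀ p ∈ S, edist (f k p) (f (k + 1) p) ≤ e k)
    (hf : ∀ k, ContinuousOn (f k) S)
    (hg : ∀ p ∈ S, Tendsto (fun k => f k p) atTop (𝓝 (g p))) : ContinuousOn g S := by
  have hu : TendstoUniformlyOn f g atTop S := by
    rw [EMetric.tendstoUniformlyOn_iff]
    intro ε hε
    have h1 := ENNReal.tendsto_sum_nat_add e he
    filter_upwards [h1.eventually (gt_mem_nhds hε)] with n hn p hp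
    rw [edist_comm]
    refine lt_of_le_of_lt ?_ hn
    have := edist_le_tsum_of_edist_le_of_tendsto (f := fun k => f k p) e (fun k => h k p hp)
      (hg p hp) n
    simpa only [add_comm] using this
  exact hu.continuousOn (Frequently.of_forall hf)

/-- `Ψ` is the limit of the dyadic lifts of one realisation of the field. -/
structure IsLiftLimit (T : ℝ) (φ : ℝ → ℝ → Ω → EuclideanSpace ℝ (Fin d)) (ω : Ω)
    (X : ℝ → RoughTriple d) : Prop where
  init : ∀ t, (X t).init = φ t 0 ω
  fst : ∀ t x y, (X t).fst x y = φ t y ω - φ t x ω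
  measurable : Measurable fun p : ℝ × ℝ × ℝ => (X p.1).snd p.2.1 p.2.2
  tendsto : ∀ t ∈ Icc 0 T, ∀ p ∈ simplex 1,
    Tendsto (fun k => (dyadicLift φ k ω t).snd p.1 p.2) atTop (𝓝 ((X t).snd p.1 p.2))

theorem dyadicLift_init (k : ℕ) (ω : Ω) (t : ℝ) : (dyadicLift φ k ω t).init = φ t 0 ω := by
  have h : poly k (fun z => φ t z ω) 0 = φ t 0 ω := poly_zero k _
  exact h

section

variable {ω : Ω} {X : ℝ → RoughTriple d} (hT : 0 < T) (hα : 1 / 12 ≤ α) (hα' : α < 1 / 2)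
  (hm : 12 < m) (hβm : 1 < m * β) (hc : Continuous fun q : ℝ × ℝ => φ q.1 q.2 ω)
  (h0 : ∀ z, φ 0 z ω = 0) (hω : IsSummableAt T α β m φ ω) (hX : IsLiftLimit T φ ω X)

include hα' hm hc h0 hω hX

theorem isSheetLimit_fst : IsSheetLimit T β α m (fun k t => (dyadicLift φ k ω t).fst)
    (fun t => (X t).fst) where
  sheet k := (isSheet_dyadicLift hc h0 k (by linarith) (by linarith)).1
  finite := hω.fst_finite
  summable := hω.fst_summable
  measurable := by
    simp only [hX.fst]
    exact Continuous.measurable ((hc.comp (by fun_prop : Continuous fun p : ℝ × ℝ × ℝ =>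
      (p.1, p.2.2))).sub (hc.comp (by fun_prop : Continuous fun p : ℝ × ℝ × ℝ => (p.1, p.2.1))))
  tendsto t _ p hp := by
    have h : Continuous fun z => φ t z ω := hc.comp (by fun_prop : Continuous fun z : ℝ => (t, z))
    rw [hX.fst]
    exact (tendsto_poly h ⟨hp.1.trans hp.2.1, hp.2.2⟩).sub
      (tendsto_poly h ⟨hp.1, hp.2.1.trans hp.2.2⟩)

theorem isSheetLimit_snd : IsSheetLimit T (2 * β) (2 * α) (m / 2)
    (fun k t => (dyadicLift φ k ω t).snd) (fun t => (X t).snd) where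
  sheet k := (isSheet_dyadicLift hc h0 k (by linarith) (by linarith)).2
  finite := hω.snd_finite
  summable := hω.snd_summable
  measurable := hX.measurable
  tendsto := hX.tendsto

include hT hβm

theorem isBesovRoughPath_dyadicLift {t : ℝ} (ht : t ∈ Icc 0 T) (k : ℕ) :
    IsBesovRoughPath α m (dyadicLift φ k ω t) := by
  have hch := isChen_lift_polygonal k fun z => φ t z ω
  have h1 := ((isSheetLimit_fst hα' hm hc h0 hω hX).slice_ne_top hT (by linarith) hβm ht).1 k
  have h2 := ((isSheetLimit_snd hα' hm hc h0 hω hX).slice_ne_top hT (by linarith)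
    (by linarith) ht).1 k
  exact ⟨hch.continuous_fst, hch.continuous_snd, hch.fst_add, hch.snd_add, h1.lt_top, h2.lt_top⟩

theorem isBesovPath_dyadicLift (k : ℕ) : IsBesovPath T β α m (dyadicLift φ k ω) where
  geometric t ht := by
    refine ⟨isBesovRoughPath_dyadicLift hT hα' hm hβm hc h0 hω hX ht k, fun ε hε =>
      ⟨polygonal k fun z => φ t z ω, lipschitzOnWith_polygonal k _, ?_⟩⟩
    have : besovDist α m (dyadicLift φ k ω t) (lift (polygonal k fun z => φ t z ω)) = 0 := by
      unfold besovDist dyadicLift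
      rw [besovNorm_of_eq_zero (by linarith) fun p _ => sub_self _,
        besovNorm_of_eq_zero (by linarith) fun p _ => sub_self _]
      simp
    rwa [this]
  continuous t ht := by
    have h1 := ((isSheet_dyadicLift hc h0 k (T := T) (α := α) (m := m) (by linarith)
      (by linarith)).1).continuous t ht
    have h2 := ((isSheet_dyadicLift hc h0 k (T := T) (α := 2 * α) (m := m / 2) (by linarith)
      (by linarith)).2).continuous t ht
    have h3 : Tendsto (fun s => ‖(dyadicLift φ k ω s).init - (dyadicLift φ k ω t).init‖ₑ)
        (𝓝[Icc 0 T] t) (𝓝 0) := by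
      simp only [dyadicLift_init]
      have hc' : Continuous fun s => ‖φ s 0 ω - φ t 0 ω‖ₑ :=
        ((hc.comp (by fun_prop : Continuous fun s : ℝ => (s, (0 : ℝ)))).sub continuous_const).enorm
      have := hc'.tendsto t
      simp only [sub_self, enorm_zero] at this
      exact this.mono_left nhdsWithin_le_nhds
    have := (h3.add h1).add h2
    simpa only [add_zero] using! this
  init_finite := by
    simp only [dyadicLift_init]; exact hω.init.lt_top
  fst_finite := (hω.fst_finite k).lt_top
  snd_finite := (hω.snd_finite k).lt_top

theorem tendsto_besovDist {t : ℝ} (ht : t ∈ Icc 0 T) :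
    Tendsto (fun k => besovDist α m (X t) (dyadicLift φ k ω t)) atTop (𝓝 0) := by
  obtain ⟨ε₁, h1, -, h1'⟩ := (isSheetLimit_fst hα' hm hc h0 hω hX).exists_slice_le hT
    (by linarith) hβm
  obtain ⟨ε₂, h2, -, h2'⟩ := (isSheetLimit_snd hα' hm hc h0 hω hX).exists_slice_le hT
    (by linarith) (by linarith)
  have h3 := h1.add h2
  rw [add_zero] at h3
  refine tendsto_of_tendsto_of_tendsto_of_le_of_le tendsto_const_nhds h3 (fun _ => zero_le)
    fun k => ?_
  unfold besovDist
  rw [hX.init, dyadicLift_init, sub_self, enorm_zero, zero_add,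
    besovNorm_sub_comm (X t).fst, besovNorm_sub_comm (X t).snd]
  exact add_le_add (h1' k t ht) (h2' k t ht)

include hα

/-- Chen's identity and finiteness of the norms follow from pointwise convergence and Fatou;
continuity of the second level is where uniform convergence in space is needed. -/
theorem isBesovRoughPath_limit {t : ℝ} (ht : t ∈ Icc 0 T) : IsBesovRoughPath α m (X t) := by
  have h1 := ((isSheetLimit_fst hα' hm hc h0 hω hX).slice_ne_top hT (by linarith) hβm ht).2
  have h2 := ((isSheetLimit_snd hα' hm hc h0 hω hX).slice_ne_top hT (by linarith)
    (by linarith) ht).2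
  have hφ : Continuous fun z => φ t z ω := hc.comp (by fun_prop : Continuous fun z : ℝ => (t, z))
  have hch := fun k => isChen_lift_polygonal k fun z => φ t z ω
  have hlim := hX.tendsto t ht
  have hlim1 : ∀ p ∈ simplex 1,
      Tendsto (fun k => (dyadicLift φ k ω t).fst p.1 p.2) atTop (𝓝 ((X t).fst p.1 p.2)) :=
    (isSheetLimit_fst hα' hm hc h0 hω hX).tendsto t ht
  refine ⟨?_, ?_, fun x z y _ _ _ _ => ?_, fun x z y hx hz hy hy1 => ?_, h1.lt_top, h2.lt_top⟩
  · simp only [hX.fst]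
    exact ((hφ.comp continuous_snd).sub (hφ.comp continuous_fst)).continuousOn
  · obtain ⟨e, he, he'⟩ := exists_edist_dyadicLift_le hT hα hα' hm hβm hc h0 hω ht
    exact continuousOn_of_edist_le (f := fun k (p : ℝ × ℝ) => (dyadicLift φ k ω t).snd p.1 p.2) he
      he' (fun k => (hch k).continuous_snd) hlim
  · simp only [hX.fst]; abel
  · refine tendsto_nhds_unique (hlim (x, y) ⟨hx, hz.trans hy, hy1⟩) ?_
    have e1 := hlim (x, z) ⟨hx, hz, hy.trans hy1⟩
    have e2 := hlim (z, y) ⟨hx.trans hz, hy, hy1⟩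
    have e3 := (continuous_tensor.tendsto ((X t).fst x z, (X t).fst z y)).comp
      ((hlim1 (x, z) ⟨hx, hz, hy.trans hy1⟩).prodMk_nhds (hlim1 (z, y) ⟨hx.trans hz, hy, hy1⟩))
    exact ((e1.add e2).add e3).congr fun k => ((hch k).snd_add x z y hx hz hy hy1).symm

theorem isBesovPath_limit : IsBesovPath T β α m X where
  geometric t ht := by
    refine ⟨isBesovRoughPath_limit hT hα hα' hm hβm hc h0 hω hX ht, fun ε hε => ?_⟩
    obtain ⟨k, hk⟩ := ((tendsto_besovDist hT hα' hm hβm hc h0 hω hX ht).eventually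
      (gt_mem_nhds hε)).exists
    exact ⟨polygonal k fun z => φ t z ω, lipschitzOnWith_polygonal k _, hk⟩
  continuous t ht := by
    have h1 := (isSheetLimit_fst hα' hm hc h0 hω hX).continuous_slice hT (by linarith) hβm ht
    have h2 := (isSheetLimit_snd hα' hm hc h0 hω hX).continuous_slice hT (by linarith)
      (by linarith) ht
    have h3 : Tendsto (fun s => ‖(X s).init - (X t).init‖ₑ) (𝓝[Icc 0 T] t) (𝓝 0) := by
      simp only [hX.init]
      have hc' : Continuous fun s => ‖φ s 0 ω - φ t 0 ω‖ₑ :=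
        ((hc.comp (by fun_prop : Continuous fun s : ℝ => (s, (0 : ℝ)))).sub continuous_const).enorm
      have := hc'.tendsto t
      simp only [sub_self, enorm_zero] at this
      exact this.mono_left nhdsWithin_le_nhds
    have := (h3.add h1).add h2
    simpa only [add_zero] using! this
  init_finite := by simp only [hX.init]; exact hω.init.lt_top
  fst_finite := ((isSheetLimit_fst hα' hm hc h0 hω hX).sheet_ne_top (by linarith)).lt_top
  snd_finite := ((isSheetLimit_snd hα' hm hc h0 hω hX).sheet_ne_top (by linarith)).lt_top

omit hα in
theorem tendsto_besovPathDist :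
    Tendsto (fun k => besovPathDist T β α m (dyadicLift φ k ω) X) atTop (𝓝 0) := by
  have hT0 : (0 : ℝ) ∈ Icc 0 T := ⟨le_rfl, hT.le⟩
  have l1 := isSheetLimit_fst hα' hm hc h0 hω hX
  have l2 := isSheetLimit_snd hα' hm hc h0 hω hX
  obtain ⟨ε₁, h1, -, h1'⟩ := l1.exists_slice_le hT (by linarith) hβm
  obtain ⟨ε₂, h2, -, h2'⟩ := l2.exists_slice_le hT (by linarith) (by linarith)
  have h3 := (h1.add h2).add ((l1.tendsto_sheet (by linarith)).add (l2.tendsto_sheet (by linarith)))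
  simp only [add_zero] at h3
  refine tendsto_of_tendsto_of_tendsto_of_le_of_le tendsto_const_nhds h3 (fun _ => zero_le)
    fun k => ?_
  -- Zero is a dyadic point of every level, so the initial values agree exactly.
  have hinit : pathBesovNorm T β m (fun t => (dyadicLift φ k ω t).init - (X t).init) = 0 := by
    simp only [hX.init, dyadicLift_init, sub_self]
    rw [pathBesovNorm_eq (by linarith)]
    simp only [sub_self, enorm_zero, zero_add]
    exact eLpNorm'_zero (by linarith)
  unfold besovPathDist
  rw [hinit, zero_add]
  exact add_le_add_left (add_le_add (h1' k 0 hT0) (h2' k 0 hT0)) _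

end

end Convergence

/-! ### The limit of the dyadic lifts as a random variable -/

section Limit

variable {Ω : Type*} [MeasurableSpace Ω] {P : Measure Ω} [IsProbabilityMeasure P]
  {T α β m : ℝ} {d : ℕ} {W : Fin d → (ℝ × ℝ → ℝ) → Ω → ℝ}
  {φ : ℝ → ℝ → Ω → EuclideanSpace ℝ (Fin d)}

omit [IsProbabilityMeasure P] in
theorem IsRegularField.measurable_sheet_snd (hφ : IsRegularField T W φ P) {q : ℝ} (hq : 0 < q)
    (γ δ : ℝ) (k : ℕ) :
    (Measurable fun ω => sheetBesovNorm T γ δ q fun t => (dyadicLift φ k ω t).snd) ∧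
      Measurable fun ω => sheetBesovNorm T γ δ q fun t x y =>
        (dyadicLift φ (k + 1) ω t).snd x y - (dyadicLift φ k ω t).snd x y :=
  ⟨measurable_sheetBesovNorm hq (hφ.measurable_snd k),
    measurable_sheetBesovNorm hq ((hφ.measurable_snd (k + 1)).sub (hφ.measurable_snd k))⟩

omit [IsProbabilityMeasure P] in
theorem IsRegularField.measurable_sheet_fst (hφ : IsRegularField T W φ P) {q : ℝ} (hq : 0 < q)
    (γ δ : ℝ) (k : ℕ) :
    (Measurable fun ω => sheetBesovNorm T γ δ q fun t => (dyadicLift φ k ω t).fst) ∧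
      Measurable fun ω => sheetBesovNorm T γ δ q fun t x y =>
        (dyadicLift φ (k + 1) ω t).fst x y - (dyadicLift φ k ω t).fst x y :=
  ⟨measurable_sheetBesovNorm hq (hφ.measurable_fst k),
    measurable_sheetBesovNorm hq ((hφ.measurable_fst (k + 1)).sub (hφ.measurable_fst k))⟩

theorem exists_second_level_moments (hW : IsSpaceTimeWhiteNoise T W P)
    (hφ : IsRegularField T W φ P) (hα₁ : 1 / 3 < α) (hβ₁ : 0 < β) (hβ₂ : 4 * β < 1 - 2 * α)
    {q : ℝ} (hq : 0 < q) :
    ∃ η, 0 < η ∧ η < 1 ∧ ∀ r, 2 ≤ r → q ≤ r → ∃ K : ℝ≥0∞, K ≠ ⊤ ∧ ∀ k,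
      eLpNorm' (fun ω => sheetBesovNorm T (2 * β) (2 * α) q fun t => (dyadicLift φ k ω t).snd) r P
        ≤ K ∧
      eLpNorm' (fun ω => sheetBesovNorm T (2 * β) (2 * α) q fun t x y =>
        (dyadicLift φ (k + 1) ω t).snd x y - (dyadicLift φ k ω t).snd x y) r P ≤
        K * ENNReal.ofReal (η ^ k) :=
  -- With the gap g = 1 - 2α - 4β > 0, take ε = g/2 and θ = 8β + g/2. Then θ/4 exceeds 2β by g/8,
  -- and 1 - (ε+θ)/2 exceeds 2α by g/2. That ε + θ ≤ 1 uses α > 1/3.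
  exists_snd_moments hW hφ (ε := (1 - 2 * α - 4 * β) / 2)
    (θ := 8 * β + (1 - 2 * α - 4 * β) / 2) hq (by linarith) (by linarith) (by linarith)
    (by linarith) (by linarith)

omit [IsProbabilityMeasure P] in
theorem ae_finite_and_summable {S D : ℕ → Ω → ℝ≥0∞} (hS : ∀ k, Measurable (S k))
    (hD : ∀ k, Measurable (D k)) {r : ℝ} (hr : 1 ≤ r) {K : ℝ≥0∞} (hK : K ≠ ⊤) {η : ℝ} (h0 : 0 < η)
    (h1 : η < 1)
    (h : ∀ k, eLpNorm' (S k) r P ≤ K ∧ eLpNorm' (D k) r P ≤ K * ENNReal.ofReal (η ^ k)) :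
    ∀ᵐ ω ∂P, (∀ k, S k ω ≠ ⊤) ∧ ∑' k, D k ω ≠ ⊤ := by
  have hs : ∀ᵐ ω ∂P, ∀ k, S k ω ≠ ⊤ := ae_all_iff.2 fun k =>
    (ae_lt_top_of_eLpNorm' (by linarith) (hS k) ((h k).1.trans_lt hK.lt_top)).mono
      fun _ hω => hω.ne
  filter_upwards [hs, ae_tsum_ne_top hD hr hK h0 h1 fun k => (h k).2] with ω a b using ⟨a, b⟩

theorem ae_isSummableAt (hW : IsSpaceTimeWhiteNoise T W P) (hφ : IsRegularField T W φ P)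
    (hα₁ : 1 / 3 < α) (hβ₁ : 0 < β) (hβ₂ : 4 * β < 1 - 2 * α) (hm : 4 ≤ m) :
    ∀ᵐ ω ∂P, IsSummableAt T α β m φ ω := by
  have hm0 : 0 < m := by linarith
  have hq0 : 0 < m / 2 := by linarith
  have hm1 : 1 ≤ m := by linarith
  have hm2 : 2 ≤ m := by linarith
  have hq1 : m / 2 ≤ m := by linarith
  -- With the same gap g, the (β, α, m) norm of the first level uses ε = g/4 and θ = 4β + g/4, which
  -- leave g/16 in time and g/4 in space.
  obtain ⟨η₁, a₁, b₁, h₁⟩ := exists_fst_moments hW hφ (q := m) (α := α) (β := β)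
    (ε := (1 - 2 * α - 4 * β) / 4) (θ := 4 * β + (1 - 2 * α - 4 * β) / 4) hm0 (by linarith)
    (by linarith) (by linarith) (by linarith) (by linarith)
  -- Doubling the time exponent costs spatial regularity: here (1-ε-θ)/2 = α - 2β, which exceeds 1/6
  -- because α > 1/3 and 4β < 1 - 2α.
  obtain ⟨η₂, a₂, b₂, h₂⟩ := exists_fst_moments hW hφ (q := m / 2) (α := 1 / 6) (β := 2 * β)
    (ε := (1 - 2 * α - 4 * β) / 2) (θ := 8 * β + (1 - 2 * α - 4 * β) / 2) hq0 (by linarith)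
    (by linarith) (by linarith) (by linarith) (by linarith)
  obtain ⟨η₃, a₃, b₃, h₃⟩ := exists_second_level_moments hW hφ hα₁ hβ₁ hβ₂ hq0
  obtain ⟨K₁, k₁, h₁⟩ := h₁ m hm2 le_rfl
  obtain ⟨K₂, k₂, h₂⟩ := h₂ m hm2 hq1
  obtain ⟨K₃, k₃, h₃⟩ := h₃ m hm2 hq1
  filter_upwards [init_moment hW hφ (q := m) (β := β) hm2 (by linarith),
    ae_finite_and_summable (fun k => (hφ.measurable_sheet_fst hm0 β α k).1)
      (fun k => (hφ.measurable_sheet_fst hm0 β α k).2) hm1 k₁ a₁ b₁ h₁,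
    ae_finite_and_summable (fun k => (hφ.measurable_sheet_fst hq0 (2 * β) (1 / 6) k).1)
      (fun k => (hφ.measurable_sheet_fst hq0 (2 * β) (1 / 6) k).2) hm1 k₂ a₂ b₂ h₂,
    ae_finite_and_summable (fun k => (hφ.measurable_sheet_snd hq0 (2 * β) (2 * α) k).1)
      (fun k => (hφ.measurable_sheet_snd hq0 (2 * β) (2 * α) k).2) hm1 k₃ a₃ b₃ h₃]
    with ω e0 e1 e2 e3
  exact ⟨e0, e1.1, e1.2, e2.1, e2.2, e3.1, e3.2⟩

omit [IsProbabilityMeasure P] in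
/-- The almost sure limit of the dyadic lifts can be chosen jointly measurable. -/
theorem exists_limit (hT : 0 < T) (hφ : IsRegularField T W φ P) (hα : 1 / 12 ≤ α)
    (hα' : α < 1 / 2) (hm : 12 < m) (hβm : 1 < m * β)
    (h : ∀ᵐ ω ∂P, IsSummableAt T α β m φ ω) :
    ∃ Ψ : Ω → ℝ → RoughTriple d,
      (∀ ω t, (Ψ ω t).init = φ t 0 ω) ∧ (∀ ω t x y, (Ψ ω t).fst x y = φ t y ω - φ t x ω) ∧
      (Measurable fun p : Ω × ℝ × ℝ × ℝ => (Ψ p.1 p.2.1).snd p.2.2.1 p.2.2.2) ∧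
      ∀ᵐ ω ∂P, IsLiftLimit T φ ω (Ψ ω) := by
  obtain ⟨N, hN, hNm, hN0⟩ := exists_measurable_superset_of_null h
  have hsum : ∀ ω ∉ N, IsSummableAt T α β m φ ω := fun ω hω => by
    by_contra hc; exact hω (hN hc)
  -- Cutting off outside this measurable set makes the sequence converge everywhere, so its limit is
  -- jointly measurable.
  set D : Set (Ω × ℝ × ℝ × ℝ) := Nᶜ ×ˢ Icc 0 T ×ˢ simplex 1 with hD
  have hDm : MeasurableSet D := hNm.compl.prod (measurableSet_Icc.prod (measurableSet_simplex 1))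
  set F : ℕ → Ω × ℝ × ℝ × ℝ → EuclideanSpace ℝ (Fin d × Fin d) := fun k =>
    D.indicator fun p => (dyadicLift φ k p.1 p.2.1).snd p.2.2.1 p.2.2.2 with hF
  have hFm : ∀ k, Measurable (F k) := fun k => (hφ.measurable_snd k).indicator hDm
  have hlim : ∀ p, ∃ l, Tendsto (fun k => F k p) atTop (𝓝 l) := fun p => by
    by_cases hp : p ∈ D
    · obtain ⟨e, he, he'⟩ := exists_edist_dyadicLift_le hT hα hα' hm hβm (hφ.continuous p.1)
        (fun z => hφ.zero z p.1) (hsum _ hp.1) hp.2.1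
      obtain ⟨l, hl⟩ := exists_tendsto_of_edist_le he fun k => he' k p.2.2 hp.2.2
      refine ⟨l, hl.congr fun k => ?_⟩
      exact (indicator_of_mem hp fun p : Ω × ℝ × ℝ × ℝ =>
        (dyadicLift φ k p.1 p.2.1).snd p.2.2.1 p.2.2.2).symm
    · have h0 : ∀ k, F k p = 0 := fun k => indicator_of_notMem hp _
      exact ⟨0, by simp only [h0]; exact tendsto_const_nhds⟩
  choose L hL using hlim
  have hLm : Measurable L := measurable_of_tendsto_metrizable hFm (tendsto_pi_nhds.2 hL)
  refine ⟨fun ω t => ⟨φ t 0 ω, fun x y => φ t y ω - φ t x ω, fun x y => L (ω, t, x, y)⟩,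
    fun _ _ => rfl, fun _ _ _ _ => rfl, hLm, ?_⟩
  filter_upwards [measure_eq_zero_iff_ae_notMem.1 hN0] with ω hω
  refine ⟨fun _ => rfl, fun _ _ _ => rfl, hLm.comp measurable_prodMk_left, fun t ht p hp => ?_⟩
  refine (hL (ω, t, p)).congr fun k => ?_
  exact indicator_of_mem (show (ω, t, p) ∈ D from ⟨hω, ht, hp⟩) fun p : Ω × ℝ × ℝ × ℝ =>
    (dyadicLift φ k p.1 p.2.1).snd p.2.2.1 p.2.2.2

omit [IsProbabilityMeasure P] in
theorem lintegral_rpow_eq_eLpNorm' {f : Ω → ℝ≥0∞} {q : ℝ} :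
    (∫⁻ ω, f ω ^ q ∂P) ^ (1 / q) = eLpNorm' f q P := by
  rw [eLpNorm'_eq_lintegral_enorm]; simp only [enorm_eq_self]

omit [IsProbabilityMeasure P] in
theorem lintegral_rpow_lt_top {f : Ω → ℝ≥0∞} {q : ℝ} (hq : 0 < q) (h : eLpNorm' f q P ≠ ⊤) :
    ∫⁻ ω, f ω ^ q ∂P < ⊤ := by
  rw [← lintegral_rpow_eq_eLpNorm'] at h
  by_contra hc
  rw [not_lt_top_iff.1 hc] at h
  exact h (ENNReal.top_rpow_of_pos (by positivity))

omit [IsProbabilityMeasure P] in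
/-- Convergence in `Lᵖ` of the second levels. -/
theorem tendsto_eLpNorm'_snd (hφ : IsRegularField T W φ P) {q γ δ : ℝ} (hq : 1 ≤ q)
    {Ψ : Ω → ℝ → RoughTriple d}
    (hΨ : ∀ᵐ ω ∂P, IsSheetLimit T γ δ q (fun k t => (dyadicLift φ k ω t).snd)
      fun t => (Ψ ω t).snd)
    {r : ℝ} (hr : 1 ≤ r) {K : ℝ≥0∞} (hK : K ≠ ⊤) {η : ℝ} (h0 : 0 < η) (h1 : η < 1)
    (h : ∀ k, eLpNorm' (fun ω => sheetBesovNorm T γ δ q fun t x y =>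
        (dyadicLift φ (k + 1) ω t).snd x y - (dyadicLift φ k ω t).snd x y) r P ≤
        K * ENNReal.ofReal (η ^ k)) :
    Tendsto (fun k => eLpNorm' (fun ω => sheetBesovNorm T γ δ q fun t x y =>
      (dyadicLift φ k ω t).snd x y - (Ψ ω t).snd x y) r P) atTop (𝓝 0) := by
  refine tendsto_of_tendsto_of_tendsto_of_le_of_le tendsto_const_nhds
    (IsSheetLimit.tendsto_tail (tsum_geometric_ne_top hK h0 h1)) (fun _ => zero_le) fun k => ?_
  exact (eLpNorm'_mono_ennreal (by linarith) (hΨ.mono fun ω hω => hω.sheet_le hq k)).trans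
    (eLpNorm'_tsum_le (fun j => (hφ.measurable_sheet_snd (by linarith) γ δ (k + j)).2) hr
      fun j => h (k + j))

omit [MeasurableSpace Ω] in
theorem agreeOn_dyadicLift {ψ : ℝ → ℝ → Ω → EuclideanSpace ℝ (Fin d)} {ω : Ω} {t : ℝ}
    (h : ∀ x ∈ Icc (0 : ℝ) 1, ψ t x ω = φ t x ω) (k : ℕ) :
    AgreeOn (dyadicLift ψ k ω t) (dyadicLift φ k ω t) where
  init := (lift_polygonal_congr h (p := (0, 0)) ⟨le_rfl, le_rfl, zero_le_one⟩).1
  fst _ hp := (lift_polygonal_congr h hp).2.1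
  snd _ hp := (lift_polygonal_congr h hp).2.2

end Limit

end

end SpatialLift

theorem mainTheorem6 {Ω : Type*} [MeasurableSpace Ω] (P : Measure Ω) [IsProbabilityMeasure P]
    (T : ℝ) (hT : 0 < T) (d : ℕ)
    (W : Fin d → (ℝ × ℝ → ℝ) → Ω → ℝ) (hW : SpatialLift.IsSpaceTimeWhiteNoise T W P)
    (ψ : ℝ → ℝ → Ω → EuclideanSpace ℝ (Fin d))
    (hψ : SpatialLift.IsStochasticHeatSolution T W ψ P)
    (α β m : ℝ) (hα₁ : 1 / 3 < α) (hα₂ : α < 1 / 2) (hβ₁ : 0 < 4 * β) (hβ₂ : 4 * β < 1 - 2 * α)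
    (hm : 2 < m) (hαm : 1 / 3 < α - 1 / m) (hβm : 1 / m < β) :
    (∀ k : ℕ, 1 ≤ k → AEMeasurable (fun ω =>
      SpatialLift.sheetBesovNorm T (2 * β) (2 * α) (m / 2) (fun t x y =>
        (SpatialLift.dyadicLift ψ (k + 1) ω t).snd x y
          - (SpatialLift.dyadicLift ψ k ω t).snd x y)) P) ∧
    (∃ c η : ℝ, 0 < c ∧ 0 < η ∧ η < 1 ∧ ∀ k : ℕ, 1 ≤ k →
      (∫⁻ ω, (SpatialLift.sheetBesovNorm T (2 * β) (2 * α) (m / 2) (fun t x y =>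
        (SpatialLift.dyadicLift ψ (k + 1) ω t).snd x y
          - (SpatialLift.dyadicLift ψ k ω t).snd x y)) ^ (m / 2) ∂P) ^ (2 / m)
        ≤ ENNReal.ofReal (c * η ^ k)) ∧
    ∃ Ψ : Ω → ℝ → SpatialLift.RoughTriple d,
      -- `Ψ` is a random variable
      (∀ t ∈ Icc (0 : ℝ) T, Measurable (fun ω => (Ψ ω t).init) ∧
        ∀ p ∈ SpatialLift.simplex 1, Measurable (fun ω => (Ψ ω t).fst p.1 p.2) ∧
          Measurable (fun ω => (Ψ ω t).snd p.1 p.2)) ∧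
      -- almost sure convergence of the second levels
      (∀ᵐ ω ∂P, Tendsto (fun k : ℕ =>
        SpatialLift.sheetBesovNorm T (2 * β) (2 * α) (m / 2) (fun t x y =>
          (SpatialLift.dyadicLift ψ k ω t).snd x y - (Ψ ω t).snd x y)) atTop (𝓝 0)) ∧
      -- convergence of the second levels in every `Lᵖ`
      (∀ k : ℕ, 1 ≤ k →
        AEMeasurable (fun ω => SpatialLift.sheetBesovNorm T (2 * β) (2 * α) (m / 2)
          (fun t => (SpatialLift.dyadicLift ψ k ω t).snd)) P ∧
        AEMeasurable (fun ω => SpatialLift.sheetBesovNorm T (2 * β) (2 * α) (m / 2)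
          (fun t x y => (SpatialLift.dyadicLift ψ k ω t).snd x y - (Ψ ω t).snd x y)) P) ∧
      (∀ p : ℝ, 1 < p →
        (∀ k : ℕ, 1 ≤ k →
          ∫⁻ ω, (SpatialLift.sheetBesovNorm T (2 * β) (2 * α) (m / 2)
            (fun t => (SpatialLift.dyadicLift ψ k ω t).snd)) ^ p ∂P < ⊤) ∧
        Tendsto (fun k : ℕ =>
          (∫⁻ ω, (SpatialLift.sheetBesovNorm T (2 * β) (2 * α) (m / 2) (fun t x y =>
            (SpatialLift.dyadicLift ψ k ω t).snd x y - (Ψ ω t).snd x y)) ^ p ∂P) ^ (1 / p))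
          atTop (𝓝 0)) ∧
      -- almost sure convergence in the Besov path space over geometric Besov rough paths
      (∀ᵐ ω ∂P,
        (∀ k : ℕ, 1 ≤ k → SpatialLift.IsBesovPath T β α m (SpatialLift.dyadicLift ψ k ω)) ∧
        SpatialLift.IsBesovPath T β α m (Ψ ω) ∧
        Tendsto (fun k : ℕ =>
          SpatialLift.besovPathDist T β α m (SpatialLift.dyadicLift ψ k ω) (Ψ ω))
          atTop (𝓝 0)) := by
  have hm0 : 0 < m := by linarith
  have hβ₀ : 0 < β := by linarith
  -- 1/m < β < (1 - 2α)/4 < 1/12, the last step by α > 1/3.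
  have hm12 : 12 < m := by
    have h : 1 / m < 1 / 12 := by linarith
    exact (one_div_lt_one_div hm0 (by norm_num)).1 h
  have hmβ : 1 < m * β := by rwa [div_lt_iff₀' hm0] at hβm
  have hq0 : 0 < m / 2 := by linarith
  have hq1 : 1 ≤ m / 2 := by linarith
  obtain ⟨φ, hφ, hψφ⟩ := SpatialLift.exists_isRegularField hT hW hψ
  have hsum := SpatialLift.ae_isSummableAt (α := α) hW hφ hα₁ hβ₀ hβ₂ (by linarith : 4 ≤ m)
  obtain ⟨Ψ, hΨ0, hΨ1, hΨm, hΨ⟩ := SpatialLift.exists_limit hT hφ (by linarith) hα₂ hm12 hmβ hsum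
  obtain ⟨η, hη0, hη1, hη⟩ :=
    SpatialLift.exists_second_level_moments hW hφ hα₁ hβ₀ hβ₂ hq0
  -- All norms and distances see only times in [0,T] and points of the simplex, so statements about
  -- φ transfer to ψ off one null set for all `k` and `t`. Measurability for φ becomes almost
  -- everywhere measurability for ψ.
  have hagree : ∀ᵐ ω ∂P, ∀ k : ℕ, ∀ t ∈ Icc 0 T,
      SpatialLift.AgreeOn (SpatialLift.dyadicLift ψ k ω t) (SpatialLift.dyadicLift φ k ω t) :=
    hψφ.mono fun ω hω k t ht => SpatialLift.agreeOn_dyadicLift (hω t ht) k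
  have hlevel : ∀ k : ℕ, (fun ω => SpatialLift.sheetBesovNorm T (2 * β) (2 * α) (m / 2)
      (fun t => (SpatialLift.dyadicLift ψ k ω t).snd)) =ᵐ[P]
      fun ω => SpatialLift.sheetBesovNorm T (2 * β) (2 * α) (m / 2)
        (fun t => (SpatialLift.dyadicLift φ k ω t).snd) := fun k => hagree.mono fun ω hω =>
    SpatialLift.sheetBesovNorm_congr fun t ht p hp => (hω k t ht).snd p hp
  have hincr : ∀ k : ℕ, (fun ω => SpatialLift.sheetBesovNorm T (2 * β) (2 * α) (m / 2)
      (fun t x y => (SpatialLift.dyadicLift ψ (k + 1) ω t).snd x y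
        - (SpatialLift.dyadicLift ψ k ω t).snd x y)) =ᵐ[P]
      fun ω => SpatialLift.sheetBesovNorm T (2 * β) (2 * α) (m / 2)
        (fun t x y => (SpatialLift.dyadicLift φ (k + 1) ω t).snd x y
        - (SpatialLift.dyadicLift φ k ω t).snd x y) := fun k => hagree.mono fun ω hω =>
    SpatialLift.sheetBesovNorm_congr fun t ht p hp => by
      rw [(hω k t ht).snd p hp, (hω (k + 1) t ht).snd p hp]
  have hrest : ∀ k : ℕ, (fun ω => SpatialLift.sheetBesovNorm T (2 * β) (2 * α) (m / 2)
      (fun t x y => (SpatialLift.dyadicLift ψ k ω t).snd x y - (Ψ ω t).snd x y)) =ᵐ[P]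
      fun ω => SpatialLift.sheetBesovNorm T (2 * β) (2 * α) (m / 2)
        (fun t x y => (SpatialLift.dyadicLift φ k ω t).snd x y - (Ψ ω t).snd x y) :=
    fun k => hagree.mono fun ω hω => SpatialLift.sheetBesovNorm_congr fun t ht p hp => by
      rw [(hω k t ht).snd p hp]
  have hlim := (hsum.and hΨ).mono fun ω hω => SpatialLift.isSheetLimit_snd hα₂ hm12
    (hφ.continuous ω) (fun z => hφ.zero z ω) hω.1 hω.2
  refine ⟨fun k _ => ⟨_, (hφ.measurable_sheet_snd hq0 (2 * β) (2 * α) k).2, hincr k⟩, ?_,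
    Ψ, fun t _ => ⟨?_, fun p _ => ⟨?_, ?_⟩⟩, ?_,
    fun k _ => ⟨⟨_, (hφ.measurable_sheet_snd hq0 (2 * β) (2 * α) k).1, hlevel k⟩,
      _, SpatialLift.measurable_sheetBesovNorm hq0 ((hφ.measurable_snd k).sub hΨm), hrest k⟩,
    fun p hp => ?_, ?_⟩
  · obtain ⟨K, hK, h⟩ := hη (m / 2) (by linarith) le_rfl
    have hK0 : 0 ≤ K.toReal := ENNReal.toReal_nonneg
    -- The added 1 makes the constant positive even if K vanishes.
    refine ⟨K.toReal + 1, η, by linarith, hη0, hη1, fun k _ => ?_⟩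
    rw [show 2 / m = 1 / (m / 2) by field_simp, SpatialLift.lintegral_rpow_eq_eLpNorm',
      eLpNorm'_congr_ae (hincr k)]
    refine (h k).2.trans ?_
    rw [ENNReal.ofReal_mul (by linarith)]
    gcongr
    exact ENNReal.le_ofReal_iff_toReal_le hK (by linarith) |>.2 (by linarith)
  · simp only [hΨ0]; exact hφ.measurable t 0
  · simp only [hΨ1]; exact (hφ.measurable t _).sub (hφ.measurable t _)
  · exact hΨm.comp (measurable_id.prodMk measurable_const : Measurable fun ω : Ω => (ω, t, p))
  · filter_upwards [hlim, ae_all_iff.2 hrest] with ω hω h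
    exact (hω.tendsto_sheet hq1).congr fun k => (h k).symm
  -- The moment bounds need an order at least 2 and at least m/2. The order max(p,m) qualifies for
  -- every `p`, and L^p norms increase with `p` on a probability space.
  · have hr2 : 2 ≤ max p m := le_max_of_le_right hm.le
    obtain ⟨K, hK, h⟩ := hη (max p m) hr2 (le_max_of_le_right (by linarith))
    have hmono : ∀ {f : Ω → ℝ≥0∞}, Measurable f → eLpNorm' f p P ≤ eLpNorm' f (max p m) P :=
      fun hf => eLpNorm'_le_eLpNorm'_of_exponent_le (by linarith) (le_max_left _ _) P
        hf.aestronglyMeasurable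
    refine ⟨fun k _ => SpatialLift.lintegral_rpow_lt_top (by linarith) ?_, ?_⟩
    · rw [eLpNorm'_congr_ae (hlevel k)]
      exact ne_top_of_le_ne_top hK
        ((hmono (hφ.measurable_sheet_snd hq0 (2 * β) (2 * α) k).1).trans (h k).1)
    · simp only [SpatialLift.lintegral_rpow_eq_eLpNorm']
      refine tendsto_of_tendsto_of_tendsto_of_le_of_le tendsto_const_nhds
        (SpatialLift.tendsto_eLpNorm'_snd hφ hq1 hlim (by linarith) hK hη0 hη1
          fun k => (h k).2) (fun _ => zero_le) fun k => ?_
      rw [eLpNorm'_congr_ae (hrest k)]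
      exact hmono (SpatialLift.measurable_sheetBesovNorm hq0 ((hφ.measurable_snd k).sub hΨm))
  · filter_upwards [hagree, hsum, hΨ] with ω h hω hX
    have hc := hφ.continuous ω
    have h0 : ∀ z, φ 0 z ω = 0 := fun z => hφ.zero z ω
    refine ⟨fun k _ => (SpatialLift.isBesovPath_dyadicLift hT hα₂ hm12 hmβ hc h0 hω hX k).congr
      hT.le (h k), SpatialLift.isBesovPath_limit hT (by linarith) hα₂ hm12 hmβ hc h0 hω hX, ?_⟩
    exact (SpatialLift.tendsto_besovPathDist hT hα₂ hm12 hmβ hc h0 hω hX).congr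
      fun k => (SpatialLift.besovPathDist_congr hT.le (h k)).symm
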